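/- **Setting.** Let $p,q\ge 1$ be integers, let $(\mathsf H_j)_{1\le j\le p}$ and $(\mathsf G_k)_{1\le k\le q}$ be separable real Hilbert spaces, and let $\mathsf H=\mathsf H_1\oplus\cdots\oplus\mathsf H_p$, $\mathsf G=\mathsf G_1\oplus\cdots\oplus\mathsf G_q$ be their Hilbert direct sums. For all $j,k$, let $\mathsf A_j\colon\mathsf H_j\to 2^{\mathsf H_j}$ and $\mathsf B_k\colon\mathsf G_k\to 2^{\mathsf G_k}$ be maximally monotone, $\mathsf C_j\colon\mathsf H_j\to\mathsf H_j$ cocoercive, $\mathsf D_k\colon\mathsf G_k\to2^{\mathsf G_k}$ maximally and strongly monotone (so that $\mathsf D_k^{-1}$ is a map from $\mathsf G_k$ to $\mathsf G_k$), and $\mathsf L_{k,j}\colon\mathsf H_j\to\mathsf G_k$ bounded linear. Here a map $\mathsf T$ is $\beta$-cocoercive ($\beta>0$) if $\langle x-y,\mathsf Tx-\mathsf Ty\rangle\ge\beta\|\mathsf Tx-\mathsf Ty\|^2$ for all $x,y$; the parallel sum is $\mathsf A\,\square\,\mathsf C=(\mathsf A^{-1}+\mathsf C^{-1})^{-1}$;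 and $\mathsf J_{\mathsf A}=(\mathrm{Id}+\mathsf A)^{-1}$. Put $\mathbb L_k=\{j:\mathsf L_{k,j}\ne0\}$, $\mathbb L_j^*=\{k:\mathsf L_{k,j}\neq0\}$ and assume that all these sets are nonempty. Let $\mathsf L\colon\mathsf H\to\mathsf G$, $\mathsf x\mapsto(\sum_j\mathsf L_{k,j}\mathsf x_j)_k$. Let $\mathsf F$ be the set of all $\mathsf x\in\mathsf H$ for which there is $\mathsf w\in\mathsf G$ such that $\mathsf w_k\in(\mathsf B_k\,\square\,\mathsf D_k)\big(\sum_{j}\mathsf L_{k,j}\mathsf x_{j}\big)$ for every $k$ and $0\in\mathsf A_j\mathsf x_j+\mathsf C_j\mathsf x_j+\sum_k\mathsf L_{k,j}^*\mathsf w_k$ for every $j$. Let $\mathsf F^*$ be the set of all $\mathsf v\in\mathsf G$ for which there is $\mathsf y\in\mathsf H$ such that $\mathsf y_j\in(\mathsf A_j^{-1}\,\square\,\mathsf C_j^{-1})\big(-\sum_{k}\mathsf L_{k,j}^*\mathsf v_{k}\big)$ for every $j$ and $0\in-\sum_j\mathsf L_{k,j}\mathsf y_j+\mathsf B_k^{-1}\mathsf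 v_k+\mathsf D_k^{-1}\mathsf v_k$ for every $k$. Assume that $\mathsf F\ne\varnothing$ and that $\mathsf A_j=0$ for every $j$. **Preconditioners.** For every $j$ let $\mathsf W_j$ be a strongly positive self-adjoint bounded operator on $\mathsf H_j$ such that $\mathsf W_j^{1/2}\mathsf C_j\mathsf W_j^{1/2}$ is $\mu_j$-cocoercive with $\mu_j>0$; for every $k$ let $\mathsf U_k$ be a strongly positive self-adjoint bounded operator on $\mathsf G_k$ such that $\mathsf U_k^{1/2}\mathsf D_k^{-1}\mathsf U_k^{1/2}$ is $\nu_k$-cocoercive with $\nu_k>0$. Let $\mathsf W\colon\mathsf x\mapsto(\mathsf W_j\mathsf x_j)_j$, $\mathsf U\colon\mathsf v\mapsto(\mathsf U_k\mathsf v_k)_k$, $\mu=\min_j\mu_j$, $\nu=\min_k\nu_k$, and suppose that $$\min\big\{\mu,\ \nu\,(1-\|\mathsf U^{1/2}\mathsf L\mathsf W^{1/2}\|^2)\big\}>\tfrac12 .$$ **Algorithm.** Let $(\lambda_n)_{n\in\mathbb N}$ be a sequence in $]0,1]$ with $\inf_n\lambda_n>0$. On a probability space $(\Omega,\mathcal F,\mathbb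 P)$, let $x_0$ and $(c_n)_{n\in\mathbb N}$ be $\mathsf H$-valued random variables, let $v_0$, $(b_n)_{n\in\mathbb N}$ and $(d_n)_{n\in\mathbb N}$ be $\mathsf G$-valued random variables, and let $(\varepsilon_n)_{n\in\mathbb N}$ be identically distributed random variables with values in $\{0,1\}^{p+q}\smallsetminus\{0\}$. For $n=0,1,\dots$ iterate: for all $j$, $$w_{j,n}=\eta_{j,n}\big(x_{j,n}-\mathsf W_j(\mathsf C_jx_{j,n}+c_{j,n})\big),\qquad \eta_{j,n}=\max\{\varepsilon_{p+k,n}: k\in\mathbb L_j^*\};$$ then for all $k$, $$u_{k,n}=\varepsilon_{p+k,n}\Big(\mathsf J_{\mathsf U_k\mathsf B_k^{-1}}\Big(v_{k,n}+\mathsf U_k\Big(\sum_{j\in\mathbb L_k}\mathsf L_{k,j}\Big(w_{j,n}-\mathsf W_j\sum_{k'\in\mathbb L_j^*}\mathsf L_{k',j}^*v_{k',n}\Big)-\mathsf D_k^{-1}v_{k,n}+d_{k,n}\Big)\Big)+b_{k,n}\Big),$$ $$v_{k,n+1}=v_{k,n}+\lambda_n\varepsilon_{p+k,n}(u_{k,n}-v_{k,n});$$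 then for all $j$, $$x_{j,n+1}=x_{j,n}+\lambda_n\varepsilon_{j,n}\Big(w_{j,n}-\mathsf W_j\sum_{k\in\mathbb L_j^*}\mathsf L_{k,j}^*u_{k,n}-x_{j,n}\Big).$$ Set $\mathcal E_n=\sigma(\varepsilon_n)$ and $\mathcal X_n=\sigma(x_0,\dots,x_n,v_0,\dots,v_n)$. **Assumptions.** 1. Almost surely, $\sum_n\sqrt{\mathbb E(\|b_n\|^2\mid\mathcal X_n)}$, $\sum_n\sqrt{\mathbb E(\|c_n\|^2\mid\mathcal X_n)}$ and $\sum_n\sqrt{\mathbb E(\|d_n\|^2\mid\mathcal X_n)}$ are finite (conditional expectations of $[0,+\infty]$-valued random variables). 2. For every $n$, $\mathcal E_n$ and $\mathcal X_n$ are independent, and $\mathbb P[\varepsilon_{j,0}=1]>0$ for every $j\in\{1,\dots,p\}$. 3. For every $k\in\{1,\dots,q\}$ and every $n$, $\bigcup_{j\in\mathbb L_k}\{\omega:\varepsilon_{j,n}(\omega)=1\}\subset\{\omega:\varepsilon_{p+k,n}(\omega)=1\}$. **Conclusion.** $(x_n)_{n\in\mathbb N}$ converges weakly almost surely to an $\mathsf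 F$-valued random variable, and $(v_n)_{n\in\mathbb N}$ converges weakly almost surely to an $\mathsf F^*$-valued random variable. -/

import Mathlib

open MeasureTheory ProbabilityTheory Filter Topology
open scoped ENNReal Pointwise InnerProductSpace

namespace BlockPD

/-! ### Set-valued operators on real Hilbert spaces -/

section Operators

variable {E F : Type*} [NormedAddCommGroup E] [InnerProductSpace ℝ E]

/-- The inverse of a set-valued operator. -/
def inverse (A : E → Set F) : F → Set E := fun u => {x | u ∈ A x}

/-- A map seen as a set-valued operator whose values are singletons. -/
def toSetOp (T : E → F) : E → Set F := fun x => {T x}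

/-- A set-valued operator whose values are singletons, identified with a map
(the value is `0` where the operator is empty-valued). -/
noncomputable def asMap [Zero F] (A : E → Set F) (x : E) : F :=
  open Classical in if h : (A x).Nonempty then h.some else 0

/-- Monotone set-valued operators. -/
def IsMonotone (A : E → Set E) : Prop :=
  ∀ x y, ∀ u ∈ A x, ∀ v ∈ A y, 0 ≤ ⟪x - y, u - v⟫_ℝ

/-- Maximally monotone operators: monotone, and no other monotone operator has a graph
that includes the graph of `A`. -/
def IsMaximallyMonotone (A : E → Set E) : Prop :=
  IsMonotone A ∧ ∀ A' : E → Set E, IsMonotone A' → (∀ x, A x ⊆ A' x) → A' = A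

/-- `β`-strongly monotone set-valued operators. -/
def IsStronglyMonotone (β : ℝ) (A : E → Set E) : Prop :=
  0 < β ∧ ∀ x y, ∀ u ∈ A x, ∀ v ∈ A y, β * ‖x - y‖ ^ 2 ≤ ⟪x - y, u - v⟫_ℝ

/-- `β`-cocoercive single-valued operators. -/
def IsCocoercive (β : ℝ) (T : E → E) : Prop :=
  0 < β ∧ ∀ x y, β * ‖T x - T y‖ ^ 2 ≤ ⟪x - y, T x - T y⟫_ℝ

/-- The parallel sum `(A⁻¹ + C⁻¹)⁻¹`. -/
def parallelSum (A C : E → Set E) : E → Set E :=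
  inverse fun u => inverse A u + inverse C u

/-- The operator `U A : x ↦ {U u | u ∈ A x}` for a bounded linear operator `U`. -/
def precond (U : E →L[ℝ] E) (A : E → Set E) : E → Set E := fun x => U '' A x

/-- The resolvent `(Id + A)⁻¹`, as a set-valued operator. -/
def resolventOp (A : E → Set E) : E → Set E := inverse fun x => {x} + A x

/-- The resolvent `J_A` as a map. -/
noncomputable def J (A : E → Set E) : E → E := asMap (resolventOp A)

/-- Strongly positive self-adjoint bounded linear operators. -/
def IsStronglyPositive [CompleteSpace E] (T : E →L[ℝ] E) : Prop :=
  IsSelfAdjoint T ∧ ∃ α : ℝ, 0 < α ∧ ∀ x, α * ‖x‖ ^ 2 ≤ ⟪x, T x⟫_ℝ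

/-- The positive self-adjoint square root of a bounded linear operator
(only used for strongly positive self-adjoint operators, which have exactly one). -/
noncomputable def opSqrt (T : E →L[ℝ] E) : E →L[ℝ] E :=
  open Classical in
  if h : ∃ S : E →L[ℝ] E, S.IsPositive ∧ S ∘L S = T then h.choose else 0

end Operators

/-! ### Existence of the square root, by the binomial series -/

theorem summable_choose (a : ℝ) {r : ℝ} (h0 : 0 ≤ r) (h1 : r < 1) :
    Summable fun n => |Ring.choose a n| * r ^ n := by
  lift r to NNReal using h0
  have hr : (r : ENNReal) < (binomialSeries ℝ a).radius :=
    lt_of_lt_of_le (by exact_mod_cast h1) (binomialSeries_radius_ge_one (𝕂 := ℝ) (𝔸 := ℝ) (a := a))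
  have := (binomialSeries ℝ a).summable_norm_mul_pow hr
  simpa [binomialSeries] using this

theorem summable_binomial {R : Type*} [NormedRing R] [NormedAlgebra ℝ R]
    (a : ℝ) {T : R} (h : ‖T‖ < 1) : Summable fun n => ‖Ring.choose a n • T ^ n‖ := by
  refine (summable_nat_add_iff 1).1 (Summable.of_nonneg_of_le (fun _ => norm_nonneg _) (fun n => ?_)
    ((summable_nat_add_iff 1).2 (summable_choose a (norm_nonneg T) h)))
  rw [norm_smul, Real.norm_eq_abs]
  gcongr
  exact norm_pow_le' _ (Nat.succ_pos _)

theorem binomial_mul_binomial {R : Type*} [NormedRing R] [NormedAlgebra ℝ R] [CompleteSpace R]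
    (a b : ℝ) {T : R} (h : ‖T‖ < 1) :
    (∑' n, Ring.choose a n • T ^ n) * (∑' n, Ring.choose b n • T ^ n)
      = ∑' n, Ring.choose (a + b) n • T ^ n := by
  rw [tsum_mul_tsum_eq_tsum_sum_antidiagonal_of_summable_norm (summable_binomial a h) (summable_binomial b h)]
  congr 1; ext n
  rw [Ring.add_choose_eq n (Commute.all a b), Finset.sum_smul]
  refine Finset.sum_congr rfl fun ij hij => ?_
  rw [smul_mul_smul_comm, ← pow_add, Finset.HasAntidiagonal.mem_antidiagonal.1 hij]

theorem binomial_one {R : Type*} [NormedRing R] [NormedAlgebra ℝ R] (T : R) : (∑' n, Ring.choose (1:ℝ) n • T ^ n) = 1 + T := by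
  have : ∀ n, Ring.choose (1:ℝ) n = ((1:ℕ).choose n : ℝ) := fun n => by
    have := Ring.choose_natCast (R := ℝ) 1 n
    simpa using this
  rw [tsum_eq_sum (s := Finset.range 2)]
  · simp [Finset.sum_range_succ, this]
  · intro n hn
    rw [this, Nat.choose_eq_zero_of_lt (by simpa using hn)]; simp

/-- A strongly positive self-adjoint operator has a positive self-adjoint square root. -/
theorem exists_positive_sqrt {E : Type*} [NormedAddCommGroup E] [InnerProductSpace ℝ E]
    [CompleteSpace E] {W : E →L[ℝ] E} (hWpos : IsStronglyPositive W) :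
    ∃ S : E →L[ℝ] E, S.IsPositive ∧ S ∘L S = W := by
  obtain ⟨hW, α, hα, h⟩ := hWpos
  set M := ‖W‖
  have hM : 0 ≤ M := norm_nonneg _
  set t := α / (M ^ 2 + 1) with ht
  have htp : 0 < t := by positivity
  have htm : t * (M ^ 2 + 1) = α := by rw [ht]; field_simp
  set T := t • W - 1 with hT
  have hTn : ‖T‖ < 1 := by
    have : ‖T‖ ≤ √(max 0 (1 - t * α)) := by
      refine T.opNorm_le_bound (Real.sqrt_nonneg _) fun x => ?_
      have e : ‖T x‖ ^ 2 ≤ (1 - t * α) * ‖x‖ ^ 2 := by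
        have h1 : ‖T x‖ ^ 2 = t ^ 2 * ‖W x‖ ^ 2 - 2 * t * ⟪x, W x⟫_ℝ + ‖x‖ ^ 2 := by
          have : T x = t • W x - x := rfl
          rw [this, @norm_sub_sq_real, norm_smul, inner_smul_left, mul_pow, Real.norm_eq_abs, sq_abs,
            real_inner_comm]; simp; ring
        have h2 : ‖W x‖ ^ 2 ≤ M ^ 2 * ‖x‖ ^ 2 := by
          rw [← mul_pow]; gcongr; exact W.le_opNorm x
        have h3 := h x
        have h4 : t ^ 2 * ‖W x‖ ^ 2 ≤ t * α * ‖x‖ ^ 2 := by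
          have : t ^ 2 * ‖W x‖ ^ 2 ≤ t ^ 2 * (M ^ 2 * ‖x‖ ^ 2) := by gcongr
          have h5 : t * α * ‖x‖^2 = t ^ 2 * (M ^ 2 * ‖x‖ ^ 2) + t ^ 2 * ‖x‖ ^ 2 := by
            rw [← htm]; ring
          nlinarith [mul_nonneg (sq_nonneg t) (sq_nonneg ‖x‖)]
        nlinarith
      have e' : ‖T x‖ ^ 2 ≤ max 0 (1 - t * α) * ‖x‖ ^ 2 :=
        e.trans (by gcongr; exact le_max_right _ _)
      calc ‖T x‖ = √(‖T x‖ ^ 2) := (Real.sqrt_sq (norm_nonneg _)).symm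
        _ ≤ √(max 0 (1 - t * α) * ‖x‖ ^ 2) := Real.sqrt_le_sqrt e'
        _ = _ := by rw [Real.sqrt_mul (le_max_left _ _), Real.sqrt_sq (norm_nonneg _)]
    refine this.trans_lt ?_
    rw [Real.sqrt_lt' one_pos]
    have := mul_pos htp hα
    simp [this]
  have hTs : IsSelfAdjoint T := ((IsSelfAdjoint.all t).smul hW).sub (IsSelfAdjoint.one _)
  have hsa : ∀ a : ℝ, IsSelfAdjoint (∑' n, Ring.choose a n • T ^ n) := fun a => by
    rw [isSelfAdjoint_iff, tsum_star]
    simp [hTs.star_eq]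
  set Q := ∑' n, Ring.choose (1/4 : ℝ) n • T ^ n with hQ
  set S := ∑' n, Ring.choose (1/2 : ℝ) n • T ^ n with hS
  have hQS : Q * Q = S := by rw [hQ, binomial_mul_binomial _ _ hTn, hS]; norm_num
  have hSS : S * S = t • W := by
    rw [hS, binomial_mul_binomial _ _ hTn]; norm_num; rw [binomial_one, hT]; abel
  have hSp : S.IsPositive := by
    have := ContinuousLinearMap.isPositive_adjoint_comp_self Q
    rw [← ContinuousLinearMap.star_eq_adjoint, (hsa _).star_eq] at this
    rw [← hQS]; exact this
  refine ⟨(√t)⁻¹ • S, hSp.smul_of_nonneg (by positivity), ?_⟩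
  have : ((√t)⁻¹ • S) * ((√t)⁻¹ • S) = W := by
    rw [smul_mul_smul_comm, hSS, smul_smul, ← mul_inv, Real.mul_self_sqrt htp.le,
      inv_mul_cancel₀ htp.ne', one_smul]
  exact this

theorem opSqrt_spec {E : Type*} [NormedAddCommGroup E] [InnerProductSpace ℝ E]
    [CompleteSpace E] {W : E →L[ℝ] E} (hW : IsStronglyPositive W) :
    (opSqrt W).IsPositive ∧ opSqrt W ∘L opSqrt W = W := by
  have h := exists_positive_sqrt hW
  rw [opSqrt, dif_pos h]
  exact h.choose_spec

/-! ### Block structure -/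

section Blocks

variable {p q : ℕ} {H : Fin p → Type*} {G : Fin q → Type*}
  [∀ j, NormedAddCommGroup (H j)] [∀ j, InnerProductSpace ℝ (H j)] [∀ j, CompleteSpace (H j)]
  [∀ k, NormedAddCommGroup (G k)] [∀ k, InnerProductSpace ℝ (G k)] [∀ k, CompleteSpace (G k)]

/-- The operator `x ↦ (∑ j, L k j (x j))_k` between the Hilbert direct sums. -/
noncomputable def blockOp (L : (k : Fin q) → (j : Fin p) → H j →L[ℝ] G k) :
    PiLp 2 H →L[ℝ] PiLp 2 G :=
  ((PiLp.continuousLinearEquiv 2 ℝ G).symm : (∀ k, G k) →L[ℝ] PiLp 2 G) ∘L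
    ContinuousLinearMap.pi fun k => ∑ j, L k j ∘L PiLp.proj 2 H j

/-- The block-diagonal operator `x ↦ (W j (x j))_j` on the Hilbert direct sum. -/
noncomputable def blockDiag (W : (j : Fin p) → H j →L[ℝ] H j) : PiLp 2 H →L[ℝ] PiLp 2 H :=
  ((PiLp.continuousLinearEquiv 2 ℝ H).symm : (∀ j, H j) →L[ℝ] PiLp 2 H) ∘L
    ContinuousLinearMap.pi fun j => W j ∘L PiLp.proj 2 H j

/-- `𝕃_k`: the indices `j` with `L k j ≠ 0`. -/
noncomputable def primalIdx (L : (k : Fin q) → (j : Fin p) → H j →L[ℝ] G k) (k : Fin q) :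
    Finset (Fin p) :=
  open Classical in Finset.univ.filter fun j => L k j ≠ 0

/-- `𝕃_j^*`: the indices `k` with `L k j ≠ 0`. -/
noncomputable def dualIdx (L : (k : Fin q) → (j : Fin p) → H j →L[ℝ] G k) (j : Fin p) :
    Finset (Fin q) :=
  open Classical in Finset.univ.filter fun k => L k j ≠ 0

/-- Solutions of the primal inclusion `0 ∈ A x + C x + L^* (B □ D) (L x)` in the Hilbert direct
sum, written blockwise: one selection `w` of the product operator `B □ D` at `L x` serves
all the block rows. -/
def primalSolutions (A : (j : Fin p) → H j → Set (H j)) (C : (j : Fin p) → H j → H j)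
    (B D : (k : Fin q) → G k → Set (G k)) (L : (k : Fin q) → (j : Fin p) → H j →L[ℝ] G k) :
    Set (PiLp 2 H) :=
  {x | ∃ w : PiLp 2 G, (∀ k, w k ∈ parallelSum (B k) (D k) (∑ j, L k j (x j))) ∧
    ∀ j, (0 : H j) ∈
      A j (x j) + {C j (x j)} + {∑ k, ContinuousLinearMap.adjoint (L k j) (w k)}}

/-- Solutions of the dual inclusion `0 ∈ -L (A⁻¹ □ C⁻¹) (-L^* v) + B⁻¹ v + D⁻¹ v` in the Hilbert
direct sum, written blockwise: one selection `y` of the product operator `A⁻¹ □ C⁻¹` at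
`-L^* v` serves all the block rows. -/
def dualSolutions (A : (j : Fin p) → H j → Set (H j)) (C : (j : Fin p) → H j → H j)
    (B D : (k : Fin q) → G k → Set (G k)) (L : (k : Fin q) → (j : Fin p) → H j →L[ℝ] G k) :
    Set (PiLp 2 G) :=
  {v | ∃ y : PiLp 2 H,
    (∀ j, y j ∈ parallelSum (inverse (A j)) (inverse (toSetOp (C j)))
      (-∑ k, ContinuousLinearMap.adjoint (L k j) (v k))) ∧
    ∀ k, (0 : G k) ∈ {-∑ j, L k j (y j)} + inverse (B k) (v k) + inverse (D k) (v k)}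

end Blocks

/-! ### Probabilistic notions -/

/-- Nonzero binary strings indexed by `ι` (`true` stands for `1`). -/
abbrev BinaryString (ι : Type*) : Type _ := {e : ι → Bool // ∃ i, e i = true}

/-- The numerical value of a bit. -/
def bit (b : Bool) : ℝ := if b then 1 else 0

section Probability

variable {Ω : Type*} [MeasurableSpace Ω]

/-- The σ-algebra generated by the random variables `x 0, …, x n, v 0, …, v n`. -/
@[reducible]
def history {E F : Type*} [mE : MeasurableSpace E] [mF : MeasurableSpace F]
    (x : ℕ → Ω → E) (v : ℕ → Ω → F) (n : ℕ) : MeasurableSpace Ω :=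
  ⨆ (i : ℕ) (_ : i ≤ n), (mE.comap (x i) ⊔ mF.comap (v i))

/-- `∑ n, √(E(‖a n‖² | 𝒳 n)) < +∞` almost surely. The conditional expectation is that of a
nonnegative, possibly nonintegrable, random variable. -/
def SummableErrors {E : Type*} [NormedAddCommGroup E] (P : Measure Ω)
    (𝒳 : ℕ → MeasurableSpace Ω) (a : ℕ → Ω → E) : Prop :=
  ∀ᵐ ω ∂P, ∑' n, (condLExp (𝒳 n) P (fun ω' => ‖a n ω'‖ₑ ^ 2) ω) ^ (1 / 2 : ℝ) < ∞

/-- `x n` converges weakly almost surely to some `S`-valued random variable. -/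
def ConvergesWeaklyTo {E : Type*} [NormedAddCommGroup E] [InnerProductSpace ℝ E]
    [MeasurableSpace E] (P : Measure Ω) (x : ℕ → Ω → E) (S : Set E) : Prop :=
  ∃ xhat : Ω → E, Measurable xhat ∧ (∀ ω, xhat ω ∈ S) ∧
    ∀ᵐ ω ∂P, Tendsto (fun n => toWeakSpace ℝ E (x n ω)) atTop (𝓝 (toWeakSpace ℝ E (xhat ω)))

end Probability

end BlockPD

open BlockPD

/-! Put x = W^{1/2} x̃ and v = U^{1/2} ṽ. In the variables z = (x̃, ṽ), one full error-free update
is a single operator T (`scaledStep`, an instance of `primalDualStep`): ũ = R(ṽ + L(x̃ - C x̃ - L*ṽ)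
- D ṽ) and x̃⁺ = x̃ - C x̃ - L*ũ, where L, C and the inverse of the original D are conjugated by the
square roots and R is a blockwise resolvent. Since A = 0, the primal half carries no resolvent:
expanding ‖x̃⁺‖² produces the cross term 2⟨x̃ - C x̃, L*ũ⟩, and firm nonexpansiveness of R supplies
exactly the opposite term. Cocoercivity and the step-size condition control the rest, so that ‖Tz -
Tz'‖² + κ‖(T - Id)z - (T - Id)z'‖² ≤ ‖z - z'‖² for some κ > 0 (`primalDualStep_averaged`). The fixed
points of T are the scaled Kuhn-Tucker pairs (`scaledStep_eq_self_iff`).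

The norm here is the plain norm of the direct sum, for which the blocks are orthogonal; this is what
permits random sweeping. If block i is active with probability π_i, the weighted norm Σ ‖Q_i z‖²/π_i
has, after one sweep of step λ in direction d, conditional mean (weighted norm of z) - ‖z‖² + ‖z +
λd‖² (`lintegral_norm_sweep_sq`). Only the marginal laws of the activations enter. Averagedness
makes the weighted distance to a fixed point an almost supermartingale, and `robbinsSiegmund` yields
almost surely its convergence and Tz_n - z_n → 0. Opial's argument (`exists_weak_limit_of_opial`)
then gives the weak limit.

The activation condition enters through the errors: when a primal block is updated, every dual block
it reads has been updated in the same iteration, so on active coordinates the algorithm differs from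
T by at most a constant times ‖b‖ + ‖c‖ + ‖d‖ (`exists_norm_scaledError_le`). The conditional
standard deviations then provide summable adapted bounds (`exists_summable_error_bound`).

Conditional inequalities are expressed throughout as integrals against [0, ∞]-valued measurable test
functions, so no integrability of the iterates is required. Resolvents exist by Minty's theorem,
obtained from a minimization over a convex hull. -/

namespace BlockPD

/-! ### Maximally monotone operators and resolvents -/

section Monotone

variable {E : Type*} [NormedAddCommGroup E] [InnerProductSpace ℝ E]

/-- Adjoining the point (x, u) to the graph keeps the operator monotone, so maximality says that the
point was already there. -/
theorem IsMaximallyMonotone.mem_of_forall {A : E → Set E} (hA : IsMaximallyMonotone A) {x u : E}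
    (h : ∀ y, ∀ v ∈ A y, 0 ≤ ⟪x - y, u - v⟫_ℝ) : u ∈ A x := by
  have hmono : IsMonotone fun y => A y ∪ {v | y = x ∧ v = u} := by
    rintro y z v (hv | ⟨rfl, rfl⟩) w (hw | ⟨rfl, rfl⟩)
    · exact hA.1 _ _ _ hv _ hw
    · have := h _ _ hv
      rwa [← neg_sub y, ← neg_sub v, inner_neg_neg] at this
    · exact h _ _ hw
    · simp
  rw [← hA.2 _ hmono fun _ => Set.subset_union_left]
  exact Or.inr ⟨rfl, rfl⟩

theorem isMaximallyMonotone_of_forall {A : E → Set E} (hA : IsMonotone A)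
    (h : ∀ x u, (∀ y, ∀ v ∈ A y, 0 ≤ ⟪x - y, u - v⟫_ℝ) → u ∈ A x) : IsMaximallyMonotone A :=
  ⟨hA, fun _ hA' hAA' => funext fun x => (Set.Subset.antisymm · (hAA' x)) fun u hu =>
    h x u fun y v hv => hA' x y u hu v (hAA' y hv)⟩

theorem IsMaximallyMonotone.inverse {A : E → Set E} (hA : IsMaximallyMonotone A) :
    IsMaximallyMonotone (inverse A) :=
  isMaximallyMonotone_of_forall
    (fun x y u hu v hv => by rw [real_inner_comm]; exact hA.1 u v x hu y hv)
    fun x u h => hA.mem_of_forall fun y v hv => by rw [real_inner_comm]; exact h v y hv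

/-! ### Minty's theorem -/

/-- The lift `(y, v, ⟪y, v⟫)` of the graph of an operator. -/
def graphLift (A : E → Set E) : Set (E × E × ℝ) :=
  (fun z : E × E => (z.1, z.2, ⟪z.1, z.2⟫_ℝ)) '' {z | z.2 ∈ A z.1}

/-- For fixed s both sides are affine in q, so the inequality cuts out a convex set. -/
theorem inner_add_inner_le_of_mem_convexHull {s : E × E × ℝ} {S : Set (E × E × ℝ)}
    (h : ∀ q ∈ S, ⟪q.1, s.2.1⟫_ℝ + ⟪s.1, q.2.1⟫_ℝ ≤ q.2.2 + s.2.2) :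
    ∀ q ∈ convexHull ℝ S, ⟪q.1, s.2.1⟫_ℝ + ⟪s.1, q.2.1⟫_ℝ ≤ q.2.2 + s.2.2 := by
  refine fun q hq => convexHull_min (s := S)
    (t := {q | ⟪q.1, s.2.1⟫_ℝ + ⟪s.1, q.2.1⟫_ℝ ≤ q.2.2 + s.2.2}) h ?_ hq
  intro a ha b hb t t' ht ht' htt
  simp only [Set.mem_ofPred_eq, Prod.fst_add, Prod.snd_add, Prod.smul_fst, Prod.smul_snd,
    inner_add_left, inner_add_right, real_inner_smul_left, real_inner_smul_right, smul_eq_mul]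
    at ha hb ⊢
  have h1 := mul_le_mul_of_nonneg_left ha ht
  have h2 := mul_le_mul_of_nonneg_left hb ht'
  have h3 : s.2.2 = t * s.2.2 + t' * s.2.2 := by rw [← add_mul, htt, one_mul]
  linarith

/-- Between two lifted graph points, monotonicity is an inequality affine in each point separately.
It therefore extends to the hull first in one variable and then in the other; the diagonal case is
the claim. -/
theorem IsMonotone.inner_le_of_mem_convexHull {A : E → Set E} (hA : IsMonotone A)
    {q : E × E × ℝ} (hq : q ∈ convexHull ℝ (graphLift A)) : ⟪q.1, q.2.1⟫_ℝ ≤ q.2.2 := by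
  have h1 : ∀ s ∈ graphLift A, ∀ q ∈ graphLift A,
      ⟪q.1, s.2.1⟫_ℝ + ⟪s.1, q.2.1⟫_ℝ ≤ q.2.2 + s.2.2 := by
    rintro _ ⟨⟨y, v⟩, hv, rfl⟩ _ ⟨⟨z, w⟩, hw, rfl⟩
    have := hA _ _ _ hv _ hw
    simp only [inner_sub_left, inner_sub_right] at this ⊢
    linarith
  have h2 : ∀ s ∈ graphLift A, ⟪s.1, q.2.1⟫_ℝ + ⟪q.1, s.2.1⟫_ℝ ≤ s.2.2 + q.2.2 :=
    fun s hs => by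
      have := inner_add_inner_le_of_mem_convexHull (h1 s hs) q hq
      linarith
  have := inner_add_inner_le_of_mem_convexHull h2 q hq
  linarith

/-- The function minimized over the convex hull of the lifted graph in Minty's theorem. -/
noncomputable def liftEnergy (q : E × E × ℝ) : ℝ := q.2.2 + (‖q.1‖ ^ 2 + ‖q.2.1‖ ^ 2) / 2

theorem liftEnergy_lineMap (a b : E × E × ℝ) (t : ℝ) :
    liftEnergy ((1 - t) • a + t • b) = (1 - t) * liftEnergy a + t * liftEnergy b
      - t * (1 - t) / 2 * (‖a.1 - b.1‖ ^ 2 + ‖a.2.1 - b.2.1‖ ^ 2) := by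
  simp only [liftEnergy, Prod.fst_add, Prod.snd_add, Prod.smul_fst, Prod.smul_snd, smul_eq_mul,
    @norm_add_sq_real, @norm_sub_sq_real, norm_smul, mul_pow, Real.norm_eq_abs, sq_abs,
    real_inner_smul_left, real_inner_smul_right]
  ring

/-- Strong convexity in the two vector components makes minimizing sequences Cauchy there. The set
need not be closed and the real component has no quadratic term, so only the infimum and the limits
of the vector components are retained; the quadratic growth inequality survives without an attained
minimum. -/
theorem exists_min_liftEnergy [CompleteSpace E] {Q : Set (E × E × ℝ)} (hQ : Convex ℝ Q)
    (hne : Q.Nonempty) (h0 : ∀ q ∈ Q, 0 ≤ liftEnergy q) :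
    ∃ (m : ℝ) (y v : E), 0 ≤ m ∧ ∀ q ∈ Q,
      m + (‖y - q.1‖ ^ 2 + ‖v - q.2.1‖ ^ 2) / 2 ≤ liftEnergy q := by
  have hbdd : BddBelow (liftEnergy '' Q) := ⟨0, by rintro _ ⟨q, hq, rfl⟩; exact h0 q hq⟩
  set m := sInf (liftEnergy '' Q)
  have hm : ∀ q ∈ Q, m ≤ liftEnergy q := fun q hq => csInf_le hbdd ⟨q, hq, rfl⟩
  have hm0 : 0 ≤ m := le_csInf (hne.image _) (by rintro _ ⟨q, hq, rfl⟩; exact h0 q hq)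
  have hex : ∀ n : ℕ, ∃ q ∈ Q, liftEnergy q < m + 1 / ((n : ℝ) + 1) := fun n => by
    obtain ⟨_, ⟨q, hq, rfl⟩, h⟩ := exists_lt_of_csInf_lt (hne.image liftEnergy)
      (lt_add_of_pos_right m (by positivity : 0 < 1 / ((n : ℝ) + 1)))
    exact ⟨q, hq, h⟩
  choose q hqQ hqm using hex
  -- Midpoint comparison: at t = 1/2 the strong convexity term has coefficient 1/8.
  have hmid : ∀ a ∈ Q, ∀ b ∈ Q, ∀ δ, liftEnergy a ≤ m + δ → liftEnergy b ≤ m + δ →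
      ‖a.1 - b.1‖ ^ 2 + ‖a.2.1 - b.2.1‖ ^ 2 ≤ 8 * δ := by
    intro a ha b hb δ hδa hδb
    have := hm _ (hQ ha hb (by norm_num : (0:ℝ) ≤ 1 - 1 / 2) (by norm_num : (0:ℝ) ≤ 1 / 2)
      (by norm_num))
    rw [liftEnergy_lineMap] at this
    linarith
  have hδ : Tendsto (fun n : ℕ => √(8 * (1 / ((n : ℝ) + 1)))) atTop (𝓝 0) := by
    have := (tendsto_one_div_add_atTop_nhds_zero_nat (𝕜 := ℝ)).const_mul 8
    simpa using this.sqrt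
  have hpair : ∀ N k l, N ≤ k → N ≤ l → ‖(q k).1 - (q l).1‖ ^ 2 + ‖(q k).2.1 - (q l).2.1‖ ^ 2
      ≤ 8 * (1 / ((N : ℝ) + 1)) := fun N k l hk hl =>
    hmid _ (hqQ k) _ (hqQ l) _
      ((hqm k).le.trans (by gcongr)) ((hqm l).le.trans (by gcongr))
  have hc1 : CauchySeq fun n => (q n).1 := cauchySeq_of_le_tendsto_0 _ (fun k l N hk hl => by
    rw [dist_eq_norm]
    exact Real.le_sqrt_of_sq_le ((le_add_of_nonneg_right (sq_nonneg _)).trans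
      (hpair N k l hk hl))) hδ
  have hc2 : CauchySeq fun n => (q n).2.1 := cauchySeq_of_le_tendsto_0 _ (fun k l N hk hl => by
    rw [dist_eq_norm]
    exact Real.le_sqrt_of_sq_le ((le_add_of_nonneg_left (sq_nonneg _)).trans
      (hpair N k l hk hl))) hδ
  obtain ⟨y, hy⟩ := cauchySeq_tendsto_of_complete hc1
  obtain ⟨v, hv⟩ := cauchySeq_tendsto_of_complete hc2
  refine ⟨m, y, v, hm0, fun s hs => ?_⟩
  have hΦ : Tendsto (fun n => liftEnergy (q n)) atTop (𝓝 m) := by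
    refine tendsto_of_tendsto_of_tendsto_of_le_of_le tendsto_const_nhds ?_
      (fun n => hm _ (hqQ n)) (fun n => (hqm n).le)
    simpa using (tendsto_one_div_add_atTop_nhds_zero_nat (𝕜 := ℝ)).const_add m
  -- Compare m with the energy on the segment from q_n to s, let n → ∞ and divide by t; the limit t
  -- → 0 follows below.
  have key : ∀ t : ℝ, 0 < t → t < 1 →
      m + (1 - t) / 2 * (‖y - s.1‖ ^ 2 + ‖v - s.2.1‖ ^ 2) ≤ liftEnergy s := by
    intro t ht ht1
    have hn : ∀ n, m ≤ (1 - t) * liftEnergy (q n) + t * liftEnergy s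
      - t * (1 - t) / 2 * (‖(q n).1 - s.1‖ ^ 2 + ‖(q n).2.1 - s.2.1‖ ^ 2) := fun n => by
      rw [← liftEnergy_lineMap]
      exact hm _ (hQ (hqQ n) hs (by linarith) ht.le (by ring))
    have hlim := ge_of_tendsto'
      (((hΦ.const_mul (1 - t)).add_const (t * liftEnergy s)).sub
        ((((hy.sub_const s.1).norm.pow 2).add ((hv.sub_const s.2.1).norm.pow 2)).const_mul
          (t * (1 - t) / 2))) hn
    refine le_of_mul_le_mul_left ?_ ht
    linarith
  have hcont : Tendsto
      (fun t : ℝ => m + (1 - t) / 2 * (‖y - s.1‖ ^ 2 + ‖v - s.2.1‖ ^ 2)) (𝓝[>] 0)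
      (𝓝 (m + (1 - 0) / 2 * (‖y - s.1‖ ^ 2 + ‖v - s.2.1‖ ^ 2))) :=
    (Continuous.tendsto (by fun_prop) 0).mono_left nhdsWithin_le_nhds
  have := le_of_tendsto hcont (Filter.mem_of_superset
    (Ioo_mem_nhdsGT (by norm_num : (0:ℝ) < 1)) fun t ht => key t ht.1 ht.2)
  linarith

/-- **Minty's theorem** at the origin. -/
theorem IsMaximallyMonotone.exists_neg_mem [CompleteSpace E] {A : E → Set E}
    (hA : IsMaximallyMonotone A) : ∃ x, -x ∈ A x := by
  have hne : (convexHull ℝ (graphLift A)).Nonempty := by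
    rw [convexHull_nonempty_iff]
    by_contra h
    rw [Set.not_nonempty_iff_eq_empty, graphLift, Set.image_eq_empty] at h
    have : (0 : E) ∈ A 0 := hA.mem_of_forall fun y v hv =>
      absurd (show (y, v) ∈ {z : E × E | z.2 ∈ A z.1} from hv) (by simp [h])
    exact absurd (show ((0 : E), (0 : E)) ∈ {z : E × E | z.2 ∈ A z.1} from this) (by simp [h])
  have hpos : ∀ q ∈ convexHull ℝ (graphLift A), 0 ≤ liftEnergy q := fun q hq => by
    have h1 := hA.1.inner_le_of_mem_convexHull hq
    have h2 := sq_nonneg ‖q.1 + q.2.1‖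
    rw [@norm_add_sq_real] at h2
    rw [liftEnergy]
    linarith
  obtain ⟨m, y, v, hm, h⟩ := exists_min_liftEnergy (convex_convexHull ℝ _) hne hpos
  -- Quadratic growth at a lifted graph point rearranges into a monotone relation between (z, w) and
  -- (-v, -y). Hence (-v, -y) lies in the graph, and taking (z, w) equal to it forces y + v = 0.
  have key : ∀ z, ∀ w ∈ A z, m + ‖y + v‖ ^ 2 / 2 ≤ ⟪-v - z, -y - w⟫_ℝ := fun z w hw => by
    have := h _ (subset_convexHull ℝ _ ⟨(z, w), hw, rfl⟩)
    simp only [liftEnergy, @norm_sub_sq_real, @norm_add_sq_real, inner_sub_left, inner_sub_right,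
      inner_neg_left, inner_neg_right] at this ⊢
    rw [real_inner_comm v y, real_inner_comm y z]
    linarith [real_inner_comm y z, real_inner_comm v y]
  have hmem : -y ∈ A (-v) := hA.mem_of_forall fun z w hw =>
    le_trans (by positivity) (key z w hw)
  have h0 := key _ _ hmem
  simp only [sub_self, inner_zero_left] at h0
  have hyv : ‖y + v‖ ^ 2 = 0 := le_antisymm (by linarith) (sq_nonneg _)
  have hyv' : y + v = 0 := by simpa using hyv
  refine ⟨y, ?_⟩
  rwa [← eq_neg_of_add_eq_zero_left hyv'] at hmem

/-- A maximally monotone and strongly monotone operator is surjective. -/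
theorem IsMaximallyMonotone.exists_mem_of_isStronglyMonotone [CompleteSpace E] {D : E → Set E}
    (hD : IsMaximallyMonotone D) {β : ℝ} (hβ : IsStronglyMonotone β D) (w : E) :
    ∃ x, w ∈ D x := by
  obtain ⟨hβ0, hβ⟩ := hβ
  -- This operator is β⁻¹(D - w) - Id, monotone precisely because D is β-strongly monotone. Minty's
  -- theorem for it gives a point x with w + β(x - x) in D x.
  have : IsMaximallyMonotone fun y => {u : E | w + β • (y + u) ∈ D y} := by
    have hid : ∀ y z u v : E, ⟪y - z, (w + β • (y + u)) - (w + β • (z + v))⟫_ℝ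
        = β * ‖y - z‖ ^ 2 + β * ⟪y - z, u - v⟫_ℝ := fun y z u v => by
      rw [show (w + β • (y + u)) - (w + β • (z + v)) = β • ((y - z) + (u - v)) by module,
        real_inner_smul_right, inner_add_right, real_inner_self_eq_norm_sq]
      ring
    refine isMaximallyMonotone_of_forall (fun y z u hu v hv => ?_) fun y u h => ?_
    · have := hβ _ _ _ hu _ hv
      rw [hid] at this
      exact nonneg_of_mul_nonneg_right (by linarith) hβ0
    · refine hD.mem_of_forall fun z v hv => ?_
      have hv' : v = w + β • (z + (β⁻¹ • (v - w) - z)) := by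
        rw [add_sub_cancel, smul_inv_smul₀ hβ0.ne']; abel
      have := h z (β⁻¹ • (v - w) - z) (by rw [Set.mem_ofPred_eq, ← hv']; exact hv)
      rw [hv', hid]
      have := mul_nonneg hβ0.le this
      positivity
  obtain ⟨x, hx⟩ := this.exists_neg_mem
  exact ⟨x, by simpa using hx⟩

/-! ### Single-valued inverses and conjugated resolvents -/

theorem asMap_eq_of_eq_singleton {E F : Type*} [Zero F] {A : E → Set F} {x : E} {y : F}
    (h : A x = {y}) : asMap A x = y := by
  have hne : (A x).Nonempty := by simp [h]
  rw [asMap, dif_pos hne]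
  exact h.subset hne.some_mem

/-- Strong monotonicity gives uniqueness and, with maximality, surjectivity; hence the default value
0 of `asMap` never occurs for these inverses. -/
theorem inverse_eq_singleton_asMap [CompleteSpace E] {D : E → Set E}
    (hD : IsMaximallyMonotone D) {β : ℝ} (hβ : IsStronglyMonotone β D) (w : E) :
    inverse D w = {asMap (inverse D) w} := by
  obtain ⟨x, hx⟩ := hD.exists_mem_of_isStronglyMonotone hβ w
  have : inverse D w = {x} := by
    refine Set.Subset.antisymm (fun y hy => ?_) (by simpa [inverse] using hx)
    have h := hβ.2 _ _ _ hy _ hx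
    rw [sub_self, inner_zero_right] at h
    have : ‖y - x‖ ^ 2 = 0 := le_antisymm (nonpos_of_mul_nonpos_right h hβ.1) (sq_nonneg _)
    simpa [sub_eq_zero] using this
  rw [asMap_eq_of_eq_singleton this, this]

/-- The resolvent of `t A t`, for a bijective self-adjoint `t`, is everywhere defined. -/
theorem IsMaximallyMonotone.exists_resolvent [CompleteSpace E] {A : E → Set E}
    (hA : IsMaximallyMonotone A) {t : E →L[ℝ] E} (ht : IsSelfAdjoint t)
    (hbij : Function.Bijective t) (g : E) : ∃ p, ∃ a ∈ A (t p), p + t a = g := by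
  have hsym : ∀ x y, ⟪x, t y⟫_ℝ = ⟪t x, y⟫_ℝ := fun x y => (ht.isSymmetric x y).symm
  have : IsMaximallyMonotone fun p => {u : E | ∃ a ∈ A (t p), u = t a - g} := by
    refine isMaximallyMonotone_of_forall ?_ fun x u h => ?_
    · rintro y z _ ⟨a, ha, rfl⟩ _ ⟨b, hb, rfl⟩
      rw [sub_sub_sub_cancel_right, ← map_sub, hsym, map_sub]
      exact hA.1 _ _ _ ha _ hb
    · obtain ⟨a, ha⟩ := hbij.2 (u + g)
      refine ⟨a, hA.mem_of_forall fun z b hb => ?_, by rw [ha, add_sub_cancel_right]⟩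
      obtain ⟨y, rfl⟩ := hbij.2 z
      have := h y _ ⟨b, hb, rfl⟩
      rwa [show u - (t b - g) = t (a - b) by rw [map_sub, ha]; abel, hsym, map_sub] at this
  obtain ⟨p, a, ha, h⟩ := this.exists_neg_mem
  refine ⟨p, a, ha, ?_⟩
  rw [sub_eq_iff_eq_add.1 h.symm]
  abel

/-- The resolvent of `t A t`. -/
noncomputable def congrResolvent [CompleteSpace E] {A : E → Set E}
    (hA : IsMaximallyMonotone A) {t : E →L[ℝ] E} (ht : IsSelfAdjoint t)
    (hbij : Function.Bijective t) (g : E) : E :=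
  (hA.exists_resolvent ht hbij g).choose

section CongrResolvent

variable [CompleteSpace E] {A : E → Set E} (hA : IsMaximallyMonotone A) {t : E →L[ℝ] E}
  (ht : IsSelfAdjoint t) (hbij : Function.Bijective t)

theorem congrResolvent_spec (g : E) : ∃ a ∈ A (t (congrResolvent hA ht hbij g)),
    congrResolvent hA ht hbij g + t a = g :=
  (hA.exists_resolvent ht hbij g).choose_spec

/-- Moving the self-adjoint t across the inner product shows that t A t inherits monotonicity from
A. Both firm nonexpansiveness and uniqueness of the resolvent value follow from this estimate. -/
theorem norm_sub_sq_le_of_add_eq (hA : IsMonotone A) (ht : IsSelfAdjoint t) {p p' a a' g g' : E}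
    (ha : a ∈ A (t p)) (ha' : a' ∈ A (t p')) (hg : p + t a = g) (hg' : p' + t a' = g') :
    ‖p - p'‖ ^ 2 ≤ ⟪p - p', g - g'⟫_ℝ := by
  have h := hA _ _ _ ha _ ha'
  rw [← map_sub, show ⟪t (p - p'), a - a'⟫_ℝ = ⟪p - p', t (a - a')⟫_ℝ from
    ht.isSymmetric _ _] at h
  rw [← hg, ← hg', show p + t a - (p' + t a') = (p - p') + t (a - a') by rw [map_sub]; abel,
    inner_add_right, real_inner_self_eq_norm_sq]
  exact le_add_of_nonneg_right h

theorem congrResolvent_firmlyNonexpansive (g g' : E) :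
    ‖congrResolvent hA ht hbij g - congrResolvent hA ht hbij g'‖ ^ 2 ≤
      ⟪congrResolvent hA ht hbij g - congrResolvent hA ht hbij g', g - g'⟫_ℝ := by
  obtain ⟨a, ha, h⟩ := congrResolvent_spec hA ht hbij g
  obtain ⟨a', ha', h'⟩ := congrResolvent_spec hA ht hbij g'
  exact norm_sub_sq_le_of_add_eq hA.1 ht ha ha' h h'

theorem congrResolvent_eq_iff {g p : E} :
    congrResolvent hA ht hbij g = p ↔ ∃ a ∈ A (t p), p + t a = g := by
  constructor
  · rintro rfl
    exact congrResolvent_spec hA ht hbij g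
  · rintro ⟨a, ha, h⟩
    obtain ⟨a', ha', h'⟩ := congrResolvent_spec hA ht hbij g
    have := norm_sub_sq_le_of_add_eq hA.1 ht ha' ha h' h
    rw [sub_self, inner_zero_right] at this
    have : ‖congrResolvent hA ht hbij g - p‖ ^ 2 = 0 := le_antisymm this (sq_nonneg _)
    simpa [sub_eq_zero] using this

/-- With z = t p, the equation z + t(t a) = t g becomes p + t a = g after cancelling the injective
t. Thus the preconditioned resolvent, firmly nonexpansive only in a modified metric, is conjugate to
one that is so in the original metric. -/
theorem J_precond {U : E →L[ℝ] E} (htU : t ∘L t = U) (g : E) :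
    J (precond U A) (t g) = t (congrResolvent hA ht hbij g) := by
  subst htU
  refine asMap_eq_of_eq_singleton (Set.Subset.antisymm (fun z hz => ?_) ?_)
  · obtain ⟨p, rfl⟩ := hbij.2 z
    obtain ⟨_, rfl, _, ⟨a, ha, rfl⟩, h⟩ := hz
    have : p + t a = g := hbij.1 (by simpa using h)
    rw [(congrResolvent_eq_iff hA ht hbij).2 ⟨a, ha, this⟩]
    rfl
  · rintro _ rfl
    obtain ⟨a, ha, h⟩ := congrResolvent_spec hA ht hbij g
    exact ⟨_, rfl, _, ⟨a, ha, rfl⟩, by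
      conv_rhs => rw [← h]
      simp⟩

end CongrResolvent

end Monotone

/-! ### Square roots of strongly positive operators -/

section SquareRoot

variable {E : Type*} [NormedAddCommGroup E] [InnerProductSpace ℝ E] [CompleteSpace E]
  {W : E →L[ℝ] E}

theorem IsStronglyPositive.bijective (hW : IsStronglyPositive W) : Function.Bijective W := by
  obtain ⟨-, α, hα, h⟩ := hW
  lift α to NNReal using hα.le
  have : IsUnit W := ContinuousLinearMap.isUnit_of_forall_le_norm_inner_map W
    (c := α) (by exact_mod_cast hα) fun x => by
      rw [mul_comm, real_inner_comm]
      exact (h x).trans (Real.le_norm_self _)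
  exact ContinuousLinearMap.isUnit_iff_bijective.1 this

theorem IsStronglyPositive.isSelfAdjoint_opSqrt (hW : IsStronglyPositive W) :
    IsSelfAdjoint (opSqrt W) :=
  (opSqrt_spec hW).1.isSelfAdjoint

theorem IsStronglyPositive.opSqrt_comp_opSqrt (hW : IsStronglyPositive W) :
    opSqrt W ∘L opSqrt W = W :=
  (opSqrt_spec hW).2

theorem IsStronglyPositive.opSqrt_opSqrt (hW : IsStronglyPositive W) (x : E) :
    opSqrt W (opSqrt W x) = W x :=
  DFunLike.congr_fun hW.opSqrt_comp_opSqrt x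

theorem IsStronglyPositive.bijective_opSqrt (hW : IsStronglyPositive W) :
    Function.Bijective (opSqrt W) := by
  have h := hW.bijective
  rw [← hW.opSqrt_comp_opSqrt, ContinuousLinearMap.coe_comp] at h
  exact ⟨h.1.of_comp, h.2.of_comp⟩

end SquareRoot

end BlockPD

namespace BlockPD

/-! ### The deterministic primal-dual operator -/

/-- The surplus in the basic estimate dominates the displacement. Here a and d stand for the
increments of C and D, b for that of L*v, t for that of u - v, and s for L*t. Completing the square
in t + 2νd leaves γ‖t‖² with γ = 1 - ℓ - 1/(2ν), positive exactly because ν(1 - ℓ) > 1/2. -/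
theorem primalDual_gap {E F : Type*} [NormedAddCommGroup E]
    [NormedAddCommGroup F] [InnerProductSpace ℝ F] {ℓ μ ν : ℝ} (hμ : 1 / 2 < μ) (hν : 0 < ν)
    (hνℓ : 1 / 2 < ν * (1 - ℓ)) : ∃ κ > 0, ∀ (a b s : E) (t d : F), ‖s‖ ^ 2 ≤ ℓ * ‖t‖ ^ 2 →
    κ * (‖a + (b + s)‖ ^ 2 + ‖t‖ ^ 2) ≤ ‖b‖ ^ 2 + (2 * μ - 1) * ‖a‖ ^ 2
        + ((1 - ℓ) * ‖t‖ ^ 2 + 2 * ⟪t, d⟫_ℝ + 2 * ν * ‖d‖ ^ 2) := by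
  have hℓ1 : ℓ < 1 := by
    have := pos_of_mul_pos_right (by linarith : 0 < ν * (1 - ℓ)) hν.le
    linarith
  set γ := 1 - ℓ - 1 / (2 * ν) with hγ
  have hγ0 : 0 < γ := by
    have : 1 / (2 * ν) < 1 - ℓ := by rw [div_lt_iff₀ (by positivity)]; linarith
    linarith
  -- The divisor 4 pays for the factor 3 in bounding the square of a three-term sum, plus the
  -- separate ‖t‖².
  set κ := min 1 (min (2 * μ - 1) γ) / 4 with hκ
  have h1 : 4 * κ ≤ 1 := by rw [hκ]; linarith [min_le_left 1 (min (2 * μ - 1) γ)]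
  have h2 : 4 * κ ≤ 2 * μ - 1 := by
    rw [hκ]; linarith [(min_le_right 1 (min (2 * μ - 1) γ)).trans (min_le_left _ _)]
  have h3 : 4 * κ ≤ γ := by
    rw [hκ]; linarith [(min_le_right 1 (min (2 * μ - 1) γ)).trans (min_le_right _ _)]
  have hκ0 : 0 < κ := by
    have : 0 < min 1 (min (2 * μ - 1) γ) := lt_min one_pos (lt_min (by linarith) hγ0)
    positivity
  refine ⟨κ, hκ0, fun a b s t d hs => ?_⟩
  have ht : γ * ‖t‖ ^ 2 ≤ (1 - ℓ) * ‖t‖ ^ 2 + 2 * ⟪t, d⟫_ℝ + 2 * ν * ‖d‖ ^ 2 := by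
    have h := sq_nonneg ‖t + (2 * ν) • d‖
    rw [@norm_add_sq_real, norm_smul, mul_pow, Real.norm_eq_abs, sq_abs,
      real_inner_smul_right] at h
    have h' := mul_nonneg (by positivity : 0 ≤ 1 / (2 * ν)) h
    have : 1 / (2 * ν) * (‖t‖ ^ 2 + 2 * (2 * ν * ⟪t, d⟫_ℝ) + (2 * ν) ^ 2 * ‖d‖ ^ 2)
        = 1 / (2 * ν) * ‖t‖ ^ 2 + 2 * ⟪t, d⟫_ℝ + 2 * ν * ‖d‖ ^ 2 := by field_simp
    rw [this] at h'
    rw [hγ]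
    linarith
  have hsum : ‖a + (b + s)‖ ^ 2 ≤ 3 * (‖a‖ ^ 2 + ‖b‖ ^ 2 + ‖s‖ ^ 2) := by
    have : ‖a + (b + s)‖ ≤ ‖a‖ + (‖b‖ + ‖s‖) :=
      (norm_add_le _ _).trans (by gcongr; exact norm_add_le _ _)
    have : ‖a + (b + s)‖ ^ 2 ≤ (‖a‖ + (‖b‖ + ‖s‖)) ^ 2 := by gcongr
    linarith [sq_nonneg (‖a‖ - ‖b‖), sq_nonneg (‖a‖ - ‖s‖), sq_nonneg (‖b‖ - ‖s‖)]
  have hst : ‖s‖ ^ 2 ≤ ‖t‖ ^ 2 := hs.trans (mul_le_of_le_one_left (sq_nonneg _) hℓ1.le)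
  have e1 := mul_le_mul_of_nonneg_right h1 (sq_nonneg ‖b‖)
  have e2 := mul_le_mul_of_nonneg_right h2 (sq_nonneg ‖a‖)
  have e3 := mul_le_mul_of_nonneg_right h3 (sq_nonneg ‖t‖)
  have e4 := mul_le_mul_of_nonneg_left
    (add_le_add_left (hsum.trans (by gcongr : _ ≤ 3 * (‖a‖ ^ 2 + ‖b‖ ^ 2 + ‖t‖ ^ 2)))
      (‖t‖ ^ 2)) hκ0.le
  have e5 := mul_nonneg hκ0.le (sq_nonneg ‖a‖)
  have e6 := mul_nonneg hκ0.le (sq_nonneg ‖b‖)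
  linarith

section PrimalDual

variable {E F : Type*} [NormedAddCommGroup E] [InnerProductSpace ℝ E] [CompleteSpace E]
  [NormedAddCommGroup F] [InnerProductSpace ℝ F] [CompleteSpace F]

/-- The basic estimate, for the differences of the variables at two points. -/
theorem primalDual_estimate {L : E →L[ℝ] F} {ℓ μ ν : ℝ}
    (hL : ∀ v, ‖ContinuousLinearMap.adjoint L v‖ ^ 2 ≤ ℓ * ‖v‖ ^ 2) {x c : E} {v d u : F}
    (hc : μ * ‖c‖ ^ 2 ≤ ⟪x, c⟫_ℝ) (hd : ν * ‖d‖ ^ 2 ≤ ⟪v, d⟫_ℝ)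
    (hu : ‖u‖ ^ 2 ≤ ⟪u, v + L (x - c - ContinuousLinearMap.adjoint L v) - d⟫_ℝ) :
    ‖x - c - ContinuousLinearMap.adjoint L u‖ ^ 2 + ‖u‖ ^ 2
      + (‖ContinuousLinearMap.adjoint L v‖ ^ 2 + (2 * μ - 1) * ‖c‖ ^ 2
        + ((1 - ℓ) * ‖u - v‖ ^ 2 + 2 * ⟪u - v, d⟫_ℝ + 2 * ν * ‖d‖ ^ 2))
      ≤ ‖x‖ ^ 2 + ‖v‖ ^ 2 := by
  -- Twice `hu` cancels the cross term ⟨x - c, L*u⟩ and leaves ‖L*(u - v)‖² - ‖L*v‖², together with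
  -- ‖v‖² - ‖u - v‖² and -2⟨u, d⟩. The last term splits into -2⟨u - v, d⟩ and -2⟨v, d⟩, which
  -- cocoercivity controls.
  have h := hL (u - v)
  rw [inner_sub_right, inner_add_right, ← ContinuousLinearMap.adjoint_inner_left] at hu
  rw [map_sub] at h
  set a := ContinuousLinearMap.adjoint L u
  set b := ContinuousLinearMap.adjoint L v
  simp only [@norm_sub_sq_real, inner_sub_left, inner_sub_right] at h hu ⊢
  linarith [real_inner_comm a c, real_inner_comm a x]

/-- The dual part of the primal-dual operator. -/
noncomputable def dualStep (C : E → E) (D R : F → F) (L : E →L[ℝ] F) (z : WithLp 2 (E × F)) : F :=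
  R (z.snd + L (z.fst - C z.fst - ContinuousLinearMap.adjoint L z.snd) - D z.snd)

/-- The primal-dual operator. -/
noncomputable def primalDualStep (C : E → E) (D R : F → F) (L : E →L[ℝ] F)
    (z : WithLp 2 (E × F)) : WithLp 2 (E × F) :=
  WithLp.toLp 2 (z.fst - C z.fst - ContinuousLinearMap.adjoint L (dualStep C D R L z),
    dualStep C D R L z)

variable {C : E → E} {D R : F → F} {L : E →L[ℝ] F} {ℓ μ ν : ℝ}

theorem primalDualStep_fst (z : WithLp 2 (E × F)) : (primalDualStep C D R L z).fst =
    z.fst - C z.fst - ContinuousLinearMap.adjoint L (dualStep C D R L z) := rfl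

theorem primalDualStep_snd (z : WithLp 2 (E × F)) :
    (primalDualStep C D R L z).snd = dualStep C D R L z := rfl

theorem primalDualStep_estimate
    (hL : ∀ v, ‖ContinuousLinearMap.adjoint L v‖ ^ 2 ≤ ℓ * ‖v‖ ^ 2)
    (hC : ∀ x y, μ * ‖C x - C y‖ ^ 2 ≤ ⟪x - y, C x - C y⟫_ℝ)
    (hD : ∀ x y, ν * ‖D x - D y‖ ^ 2 ≤ ⟪x - y, D x - D y⟫_ℝ)
    (hR : ∀ x y, ‖R x - R y‖ ^ 2 ≤ ⟪R x - R y, x - y⟫_ℝ) (z z' : WithLp 2 (E × F)) :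
    ‖primalDualStep C D R L z - primalDualStep C D R L z'‖ ^ 2
      + (‖ContinuousLinearMap.adjoint L (z.snd - z'.snd)‖ ^ 2
        + (2 * μ - 1) * ‖C z.fst - C z'.fst‖ ^ 2
        + ((1 - ℓ) * ‖dualStep C D R L z - dualStep C D R L z' - (z.snd - z'.snd)‖ ^ 2
          + 2 * ⟪dualStep C D R L z - dualStep C D R L z' - (z.snd - z'.snd),
              D z.snd - D z'.snd⟫_ℝ
          + 2 * ν * ‖D z.snd - D z'.snd‖ ^ 2)) ≤ ‖z - z'‖ ^ 2 := by
  have h := primalDual_estimate (u := dualStep C D R L z - dualStep C D R L z') hL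
    (hC z.fst z'.fst) (hD z.snd z'.snd) (by
      refine (hR _ _).trans_eq ?_
      rw [dualStep, dualStep]
      congr 1
      simp only [map_sub]
      abel)
  rw [WithLp.prod_norm_sq_eq_of_L2, WithLp.prod_norm_sq_eq_of_L2]
  refine le_trans (le_of_eq ?_) h
  congr 3
  · simp only [WithLp.sub_fst, primalDualStep_fst, map_sub]
    congr 1
    abel

theorem primalDualStep_averaged (hμ : 1 / 2 < μ) (hν : 0 < ν)
    (hνℓ : 1 / 2 < ν * (1 - ℓ))
    (hL : ∀ v, ‖ContinuousLinearMap.adjoint L v‖ ^ 2 ≤ ℓ * ‖v‖ ^ 2)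
    (hC : ∀ x y, μ * ‖C x - C y‖ ^ 2 ≤ ⟪x - y, C x - C y⟫_ℝ)
    (hD : ∀ x y, ν * ‖D x - D y‖ ^ 2 ≤ ⟪x - y, D x - D y⟫_ℝ)
    (hR : ∀ x y, ‖R x - R y‖ ^ 2 ≤ ⟪R x - R y, x - y⟫_ℝ) :
    ∃ κ > 0, ∀ z z', ‖primalDualStep C D R L z - primalDualStep C D R L z'‖ ^ 2
      + κ * ‖primalDualStep C D R L z - z - (primalDualStep C D R L z' - z')‖ ^ 2
        ≤ ‖z - z'‖ ^ 2 := by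
  obtain ⟨κ, hκ, h⟩ := primalDual_gap (E := E) (F := F) hμ hν hνℓ
  refine ⟨κ, hκ, fun z z' => le_trans ?_ (primalDualStep_estimate hL hC hD hR z z')⟩
  gcongr
  refine le_trans (le_of_eq ?_) (h (C z.fst - C z'.fst)
    (ContinuousLinearMap.adjoint L (z.snd - z'.snd))
    (ContinuousLinearMap.adjoint L
      (dualStep C D R L z - dualStep C D R L z' - (z.snd - z'.snd)))
    (dualStep C D R L z - dualStep C D R L z' - (z.snd - z'.snd)) (D z.snd - D z'.snd) (hL _))
  rw [WithLp.prod_norm_sq_eq_of_L2]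
  congr 3
  · rw [← norm_neg]
    simp only [WithLp.sub_fst, primalDualStep_fst, map_sub]
    congr 1
    abel
  · simp only [WithLp.sub_snd, primalDualStep_snd]
    congr 1
    abel

end PrimalDual

end BlockPD

namespace BlockPD

/-! ### The Robbins-Siegmund theorem -/

section RobbinsSiegmund

variable {Ω : Type*} {m0 : MeasurableSpace Ω} {P : Measure Ω} [IsFiniteMeasure P]
  {ℱ : Filtration ℕ m0}

/-- The process F is a supermartingale up to the increments a. Subtracting it from the partial sums
of a gives a submartingale, bounded in L¹ because these sums are bounded by M, and Doob's
convergence theorem applies. -/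
theorem tendsto_of_setLIntegral_succ_le {F a : ℕ → Ω → ℝ} {M : ℝ}
    (hFm : ∀ n, Measurable[ℱ n] (F n)) (ham : ∀ n, Measurable[ℱ n] (a n))
    (hF0 : ∀ n ω, 0 ≤ F n ω) (ha0 : ∀ n ω, 0 ≤ a n ω) (hFM : ∀ ω, F 0 ω ≤ M)
    (haM : ∀ n ω, ∑ i ∈ Finset.range n, a i ω ≤ M)
    (h : ∀ n s, MeasurableSet[ℱ n] s → ∫⁻ ω in s, ENNReal.ofReal (F (n + 1) ω) ∂P ≤
      ∫⁻ ω in s, ENNReal.ofReal (F n ω) ∂P + ∫⁻ ω in s, ENNReal.ofReal (a n ω) ∂P) :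
    ∀ᵐ ω ∂P, ∃ l, Tendsto (fun n => F n ω) atTop (𝓝 l) := by
  have hFm' : ∀ n, Measurable (F n) := fun n => (hFm n).mono (ℱ.le n) le_rfl
  have ham' : ∀ n, Measurable (a n) := fun n => (ham n).mono (ℱ.le n) le_rfl
  set S : ℕ → Ω → ℝ := fun n ω => ∑ i ∈ Finset.range n, a i ω with hS
  have hS0 : ∀ n ω, 0 ≤ S n ω := fun n ω => Finset.sum_nonneg fun i _ => ha0 i ω
  have hSm : ∀ n, Measurable[ℱ n] (S n) := fun n =>
    Finset.measurable_fun_sum _ fun i hi =>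
      (ham i).mono (ℱ.mono (Finset.mem_range.1 hi).le) le_rfl
  have hSm' : ∀ n, Measurable (S n) := fun n => (hSm n).mono (ℱ.le n) le_rfl
  have hle : ∀ n, ∫⁻ ω, ENNReal.ofReal (F n ω) ∂P ≤ ∫⁻ ω, ENNReal.ofReal (M + S n ω) ∂P := by
    intro n
    induction n with
    | zero => exact lintegral_mono fun ω => ENNReal.ofReal_le_ofReal (by simpa [hS] using hFM ω)
    | succ n ih =>
      have := h n Set.univ MeasurableSet.univ
      simp only [Measure.restrict_univ] at this
      refine this.trans ((add_le_add_left ih _).trans ?_)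
      rw [← lintegral_add_left (by fun_prop)]
      refine lintegral_mono fun ω => ?_
      simp only
      rw [← ENNReal.ofReal_add (add_nonneg ((hF0 0 ω).trans (hFM ω)) (hS0 n ω)) (ha0 n ω)]
      simp [hS, Finset.sum_range_succ, add_assoc]
  have hle2 : ∀ n, ∫⁻ ω, ENNReal.ofReal (F n ω) ∂P ≤ ENNReal.ofReal (M + M) * P Set.univ :=
    fun n => (hle n).trans (by
      rw [← lintegral_const]
      exact lintegral_mono fun ω => ENNReal.ofReal_le_ofReal (add_le_add_right (haM n ω) _))
  have hfin : ENNReal.ofReal (M + M) * P Set.univ < ∞ :=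
    ENNReal.mul_lt_top ENNReal.ofReal_lt_top (measure_lt_top _ _)
  have hFi : ∀ n, Integrable (F n) P := fun n =>
    ⟨(hFm' n).aestronglyMeasurable,
      (hasFiniteIntegral_iff_ofReal (ae_of_all _ (hF0 n))).2 ((hle2 n).trans_lt hfin)⟩
  have hSi : ∀ n, Integrable (S n) P := fun n =>
    Integrable.of_bound (hSm' n).aestronglyMeasurable M (ae_of_all _ fun ω => by
      rw [Real.norm_of_nonneg (hS0 n ω)]; exact haM n ω)
  have hai : ∀ n, Integrable (a n) P := fun n => by
    have : a n = S (n + 1) - S n := by ext ω; simp [hS, Finset.sum_range_succ]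
    rw [this]
    exact (hSi _).sub (hSi _)
  have hsub : Submartingale (fun n ω => S n ω - F n ω) ℱ P := by
    refine submartingale_of_setIntegral_le_succ
      (fun n => ((hSm n).sub (hFm n)).stronglyMeasurable) (fun n => (hSi n).sub (hFi n))
      fun n s hs => ?_
    have h1 := h n s hs
    rw [← ofReal_integral_eq_lintegral_ofReal (hFi _).integrableOn (ae_of_all _ (hF0 _)),
      ← ofReal_integral_eq_lintegral_ofReal (hFi _).integrableOn (ae_of_all _ (hF0 _)),
      ← ofReal_integral_eq_lintegral_ofReal (hai _).integrableOn (ae_of_all _ (ha0 _)),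
      ← ENNReal.ofReal_add (integral_nonneg (hF0 _)) (integral_nonneg (ha0 _)),
      ENNReal.ofReal_le_ofReal_iff
        (add_nonneg (integral_nonneg (hF0 _)) (integral_nonneg (ha0 _)))] at h1
    rw [integral_sub (hSi _).integrableOn (hFi _).integrableOn,
      integral_sub (hSi _).integrableOn (hFi _).integrableOn]
    have h2 : ∫ ω in s, S (n + 1) ω ∂P = ∫ ω in s, S n ω ∂P + ∫ ω in s, a n ω ∂P := by
      rw [← integral_add (hSi _).integrableOn (hai _).integrableOn]
      simp [hS, Finset.sum_range_succ]
    linarith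
  have hbdd : ∀ n, eLpNorm (fun ω => S n ω - F n ω) 1 P ≤
      (ENNReal.ofReal M * P Set.univ + ENNReal.ofReal (M + M) * P Set.univ).toNNReal := by
    intro n
    rw [ENNReal.coe_toNNReal (ENNReal.add_lt_top.2
      ⟨ENNReal.mul_lt_top ENNReal.ofReal_lt_top (measure_lt_top _ _), hfin⟩).ne,
      eLpNorm_one_eq_lintegral_enorm]
    refine le_trans ?_ (add_le_add_right (hle2 n) _)
    rw [← lintegral_const, ← lintegral_add_left measurable_const]
    refine lintegral_mono fun ω => ?_
    simp only
    rw [← ENNReal.ofReal_add ((hF0 0 ω).trans (hFM ω)) (hF0 n ω), Real.enorm_eq_ofReal_abs]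
    refine ENNReal.ofReal_le_ofReal (abs_le.2 ⟨?_, ?_⟩) <;>
      linarith [hS0 n ω, hF0 n ω, haM n ω]
  filter_upwards [hsub.exists_ae_tendsto_of_bdd hbdd] with ω ⟨l, hl⟩
  have hsum := (summable_of_sum_range_le (fun n => ha0 n ω) (fun n => haM n ω)).hasSum
  refine ⟨_, (hsum.tendsto_sum_nat.sub hl).congr fun n => ?_⟩
  simp [hS]

/-- The Robbins-Siegmund theorem for a bounded initial value and uniformly bounded sums of
perturbations. -/
theorem robbinsSiegmund_of_bounded {f g a : ℕ → Ω → ℝ} {M : ℝ}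
    (hfm : ∀ n, Measurable[ℱ n] (f n)) (hgm : ∀ n, Measurable[ℱ n] (g n))
    (ham : ∀ n, Measurable[ℱ n] (a n))
    (hf0 : ∀ n ω, 0 ≤ f n ω) (hg0 : ∀ n ω, 0 ≤ g n ω) (ha0 : ∀ n ω, 0 ≤ a n ω)
    (hfM : ∀ ω, f 0 ω ≤ M) (haM : ∀ n ω, ∑ i ∈ Finset.range n, a i ω ≤ M)
    (h : ∀ n (φ : Ω → ℝ≥0∞), Measurable[ℱ n] φ →
      ∫⁻ ω, φ ω * ENNReal.ofReal (f (n + 1) ω) ∂P + ∫⁻ ω, φ ω * ENNReal.ofReal (g n ω) ∂P ≤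
        ∫⁻ ω, φ ω * ENNReal.ofReal ((1 + a n ω) * f n ω + a n ω) ∂P) :
    ∀ᵐ ω ∂P, (∃ l, Tendsto (fun n => f n ω) atTop (𝓝 l)) ∧ Summable fun n => g n ω := by
  have hlift : ∀ {b : ℕ → Ω → ℝ}, (∀ n, Measurable[ℱ n] (b n)) → ∀ n, Measurable (b n) :=
    fun hb n => (hb n).mono (ℱ.le n) le_rfl
  -- Dividing f by this product removes the growth factors 1 + a. With the discounted g accumulated
  -- in G below, the sum f/p + G satisfies the hypothesis of the previous lemma.
  set p : ℕ → Ω → ℝ := fun n ω => ∏ i ∈ Finset.range n, (1 + a i ω) with hp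
  have hp1 : ∀ n ω, 1 ≤ p n ω := fun n ω => by
    induction n with
    | zero => simp [hp]
    | succ n ih =>
      simp only [hp, Finset.prod_range_succ] at ih ⊢
      exact one_le_mul_of_one_le_of_one_le ih (by linarith [ha0 n ω])
  have hpp : ∀ n ω, 0 < p n ω := fun n ω => one_pos.trans_le (hp1 n ω)
  -- The product is predictable: p (n + 1) involves only a 0, …, a n, so its inverse is an
  -- admissible test function at time n.
  have hpm : ∀ n k, n ≤ k + 1 → Measurable[ℱ k] (p n) := fun n k hk =>
    Finset.measurable_fun_prod _ fun i hi => ((ham i).mono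
      (ℱ.mono (Nat.lt_succ_iff.1 ((Finset.mem_range.1 hi).trans_le hk))) le_rfl).const_add 1
  have hps : ∀ n ω, p (n + 1) ω = p n ω * (1 + a n ω) := fun n ω => Finset.prod_range_succ _ _
  have hpM : ∀ n ω, p n ω ≤ Real.exp M := fun n ω => by
    refine le_trans (Finset.prod_le_prod (fun i _ => by linarith [ha0 i ω])
      fun i _ => (add_comm 1 (a i ω)).trans_le (Real.add_one_le_exp _)) ?_
    rw [← Real.exp_sum]
    exact Real.exp_le_exp.2 (haM n ω)
  set G : ℕ → Ω → ℝ := fun n ω => ∑ i ∈ Finset.range n, g i ω / p (i + 1) ω with hG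
  have hG0 : ∀ n ω, 0 ≤ G n ω := fun n ω =>
    Finset.sum_nonneg fun i _ => div_nonneg (hg0 i ω) (hpp _ ω).le
  have hGm : ∀ n, Measurable[ℱ n] (G n) := fun n =>
    Finset.measurable_fun_sum _ fun i hi =>
      (((hgm i).div (hpm _ _ le_rfl)).mono (ℱ.mono (Finset.mem_range.1 hi).le) le_rfl)
  have hconv := tendsto_of_setLIntegral_succ_le (P := P) (ℱ := ℱ) (a := a) (M := M)
    (F := fun n ω => f n ω / p n ω + G n ω)
    (fun n => ((hfm n).div (hpm n n n.le_succ)).add (hGm n)) ham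
    (fun n ω => add_nonneg (div_nonneg (hf0 n ω) (hpp n ω).le) (hG0 n ω)) ha0
    (fun ω => by simpa [hp, hG] using hfM ω) haM fun n s hs => by
      have hsm : MeasurableSet s := ℱ.le n s hs
      have h1 := h n (s.indicator fun ω => ENNReal.ofReal (p (n + 1) ω)⁻¹)
        ((ENNReal.measurable_ofReal.comp (hpm _ _ le_rfl).inv).indicator hs)
      have e : ∀ b : Ω → ℝ, ∫⁻ ω, s.indicator (fun ω => ENNReal.ofReal (p (n + 1) ω)⁻¹) ω *
          ENNReal.ofReal (b ω) ∂P = ∫⁻ ω in s, ENNReal.ofReal (b ω / p (n + 1) ω) ∂P := by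
        intro b
        rw [← lintegral_indicator hsm]
        refine lintegral_congr fun ω => ?_
        by_cases hω : ω ∈ s
        · simp only [Set.indicator_of_mem hω]
          rw [← ENNReal.ofReal_mul (inv_nonneg.2 (hpp _ ω).le), div_eq_inv_mul]
        · simp [Set.indicator_of_notMem hω]
      rw [e, e, e] at h1
      have m1 := hlift hfm (n + 1)
      have m2 := hlift hgm n
      have m3 := hlift ham n
      have m4 := hlift hfm n
      have m5 := hlift hGm n
      have m6 := (hpm (n + 1) n le_rfl).mono (ℱ.le n) le_rfl
      have m7 := (hpm n n n.le_succ).mono (ℱ.le n) le_rfl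
      calc ∫⁻ ω in s, ENNReal.ofReal (f (n + 1) ω / p (n + 1) ω + G (n + 1) ω) ∂P
          = ∫⁻ ω in s, ENNReal.ofReal (f (n + 1) ω / p (n + 1) ω) ∂P
            + ∫⁻ ω in s, ENNReal.ofReal (g n ω / p (n + 1) ω) ∂P
            + ∫⁻ ω in s, ENNReal.ofReal (G n ω) ∂P := by
            rw [← lintegral_add_left (by fun_prop), ← lintegral_add_left (by fun_prop)]
            refine lintegral_congr fun ω => ?_
            have q1 := div_nonneg (hf0 (n + 1) ω) (hpp (n + 1) ω).le
            have q2 := div_nonneg (hg0 n ω) (hpp (n + 1) ω).le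
            rw [← ENNReal.ofReal_add q1 q2, ← ENNReal.ofReal_add (add_nonneg q1 q2) (hG0 n ω)]
            simp only [hG, Finset.sum_range_succ]
            congr 1
            ring
        _ ≤ ∫⁻ ω in s, ENNReal.ofReal (((1 + a n ω) * f n ω + a n ω) / p (n + 1) ω) ∂P
            + ∫⁻ ω in s, ENNReal.ofReal (G n ω) ∂P := by gcongr
        _ ≤ ∫⁻ ω in s, ENNReal.ofReal (f n ω / p n ω + G n ω) ∂P
            + ∫⁻ ω in s, ENNReal.ofReal (a n ω) ∂P := by
            rw [← lintegral_add_left (by fun_prop), ← lintegral_add_left (by fun_prop)]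
            refine lintegral_mono fun ω => ?_
            have q0 : 0 < 1 + a n ω := by linarith [ha0 n ω]
            have q1 := div_nonneg (hf0 n ω) (hpp n ω).le
            have q2 : ((1 + a n ω) * f n ω + a n ω) / p (n + 1) ω
                = f n ω / p n ω + a n ω / p (n + 1) ω := by
              have := hpp n ω
              rw [hps]
              field_simp
            have q3 : a n ω / p (n + 1) ω ≤ a n ω := div_le_self (ha0 n ω) (hp1 _ ω)
            simp only
            rw [← ENNReal.ofReal_add (by
                rw [q2]; exact add_nonneg q1 (div_nonneg (ha0 n ω) (hpp _ ω).le)) (hG0 n ω),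
              ← ENNReal.ofReal_add (add_nonneg q1 (hG0 n ω)) (ha0 n ω), q2]
            exact ENNReal.ofReal_le_ofReal (by linarith)
  filter_upwards [hconv] with ω ⟨l, hl⟩
  obtain ⟨R, hR⟩ := hl.bddAbove_range
  have hGsum : Summable fun i => g i ω / p (i + 1) ω :=
    summable_of_sum_range_le (fun i => div_nonneg (hg0 i ω) (hpp _ ω).le) fun n =>
      (le_add_of_nonneg_left (div_nonneg (hf0 n ω) (hpp n ω).le)).trans (hR ⟨n, rfl⟩)
  have hpmono : Monotone fun n => p n ω := monotone_nat_of_le_succ fun n => by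
    rw [hps]
    exact le_mul_of_one_le_right (hpp n ω).le (by linarith [ha0 n ω])
  have hplim := tendsto_atTop_ciSup hpmono ⟨Real.exp M, by rintro _ ⟨n, rfl⟩; exact hpM n ω⟩
  refine ⟨⟨_, ((hl.sub hGsum.hasSum.tendsto_sum_nat).mul hplim).congr fun n => ?_⟩, ?_⟩
  · simp only [hG, add_sub_cancel_right]
    exact div_mul_cancel₀ _ (hpp n ω).ne'
  · refine Summable.of_nonneg_of_le (fun n => hg0 n ω) (fun n => ?_)
      (hGsum.mul_left (Real.exp M))
    calc g n ω = p (n + 1) ω * (g n ω / p (n + 1) ω) := by rw [mul_div_cancel₀ _ (hpp _ ω).ne']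
      _ ≤ _ := mul_le_mul_of_nonneg_right (hpM _ ω) (div_nonneg (hg0 n ω) (hpp _ ω).le)

/-- The **Robbins-Siegmund theorem** on almost supermartingales. -/
theorem robbinsSiegmund {f g a : ℕ → Ω → ℝ}
    (hfm : ∀ n, Measurable[ℱ n] (f n)) (hgm : ∀ n, Measurable[ℱ n] (g n))
    (ham : ∀ n, Measurable[ℱ n] (a n))
    (hf0 : ∀ n ω, 0 ≤ f n ω) (hg0 : ∀ n ω, 0 ≤ g n ω) (ha0 : ∀ n ω, 0 ≤ a n ω)
    (hasum : ∀ᵐ ω ∂P, Summable fun n => a n ω)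
    (h : ∀ n (φ : Ω → ℝ≥0∞), Measurable[ℱ n] φ →
      ∫⁻ ω, φ ω * ENNReal.ofReal (f (n + 1) ω) ∂P + ∫⁻ ω, φ ω * ENNReal.ofReal (g n ω) ∂P ≤
        ∫⁻ ω, φ ω * ENNReal.ofReal ((1 + a n ω) * f n ω + a n ω) ∂P) :
    ∀ᵐ ω ∂P, (∃ l, Tendsto (fun n => f n ω) atTop (𝓝 l)) ∧ Summable fun n => g n ω := by
  -- Localization: these events decrease in n, and including a n in the sum keeps them ℱ
  -- n-measurable. Almost every ω lies in all of them once M is large.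
  set B : ℕ → ℕ → Set Ω := fun M n =>
    {ω | f 0 ω ≤ M ∧ ∑ i ∈ Finset.range (n + 1), a i ω ≤ M} with hB
  have hBm : ∀ M n, MeasurableSet[ℱ n] (B M n) := fun M n =>
    MeasurableSet.inter
      (measurableSet_le ((hfm 0).mono (ℱ.mono n.zero_le) le_rfl) measurable_const)
      (measurableSet_le (Finset.measurable_fun_sum _ fun i hi => (ham i).mono
        (ℱ.mono (Nat.lt_succ_iff.1 (Finset.mem_range.1 hi))) le_rfl) measurable_const)
  have hBanti : ∀ M n, B M (n + 1) ⊆ B M n := fun M n ω hω => ⟨hω.1, by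
    refine le_trans ?_ hω.2
    rw [Finset.sum_range_succ _ (n + 1)]
    exact le_add_of_nonneg_right (ha0 _ ω)⟩
  -- The truncation of f (k + 1) uses the event at time k: this is what the inequality tested with
  -- the indicator of B M k controls. On B M n both f' and f agree, since the events decrease.
  set f' : ℕ → ℕ → Ω → ℝ := fun M n => n.casesOn
    ({ω | f 0 ω ≤ M}.indicator (f 0)) fun k => (B M k).indicator (f (k + 1)) with hf'
  have hfB : ∀ M n ω, ω ∈ B M n → f' M n ω = f n ω := fun M n ω hω => by
    cases n with
    | zero => exact Set.indicator_of_mem (s := {ω | f 0 ω ≤ M}) hω.1 (f 0)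
    | succ k => exact Set.indicator_of_mem (hBanti M k hω) (f (k + 1))
  have hloc : ∀ M : ℕ, ∀ᵐ ω ∂P, (∃ l, Tendsto (fun n => f' M n ω) atTop (𝓝 l)) ∧
      Summable fun n => (B M n).indicator (g n) ω := by
    intro M
    refine robbinsSiegmund_of_bounded (ℱ := ℱ) (M := M) (a := fun n => (B M n).indicator (a n))
      ?_ (fun n => (hgm n).indicator (hBm M n)) (fun n => (ham n).indicator (hBm M n)) ?_
      (fun n ω => Set.indicator_nonneg (fun ω _ => hg0 n ω) ω)
      (fun n ω => Set.indicator_nonneg (fun ω _ => ha0 n ω) ω) ?_ ?_ ?_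
    · intro n
      cases n with
      | zero => exact (hfm 0).indicator (measurableSet_le (hfm 0) measurable_const)
      | succ k => exact (hfm _).indicator (ℱ.mono k.le_succ _ (hBm M k))
    · intro n ω
      cases n with
      | zero => exact Set.indicator_nonneg (fun ω _ => hf0 _ ω) ω
      | succ k => exact Set.indicator_nonneg (fun ω _ => hf0 _ ω) ω
    · intro ω
      exact Set.indicator_apply_le' (a := ω) (f := f 0) (fun hω => hω) fun _ => Nat.cast_nonneg M
    · intro n ω
      induction n with
      | zero => simp
      | succ n ih =>
        by_cases hω : ω ∈ B M n
        · refine le_trans (Finset.sum_le_sum fun i _ => ?_) hω.2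
          exact Set.indicator_le_self' (f := a i) (fun _ _ => ha0 i _) ω
        · rwa [Finset.sum_range_succ, Set.indicator_of_notMem hω, add_zero]
    · intro n φ hφ
      have h1 := h n ((B M n).indicator φ) (hφ.indicator (hBm M n))
      refine le_trans (le_of_eq ?_) (h1.trans (lintegral_mono fun ω => ?_))
      · congr 1 <;> refine lintegral_congr fun ω => ?_ <;> by_cases hω : ω ∈ B M n <;>
          simp [hf', hω]
      · by_cases hω : ω ∈ B M n
        · simp [hω, hfB M n ω hω]
        · simp [hω]
  filter_upwards [ae_all_iff.2 hloc, hasum] with ω hω hs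
  obtain ⟨M, hM⟩ := exists_nat_ge (max (f 0 ω) (∑' i, a i ω))
  have hmem : ∀ n, ω ∈ B M n := fun n => ⟨(le_max_left _ _).trans hM,
    (hs.sum_le_tsum _ fun i _ => ha0 i ω).trans ((le_max_right _ _).trans hM)⟩
  obtain ⟨⟨l, hl⟩, hg⟩ := hω M
  exact ⟨⟨l, hl.congr fun n => hfB M n ω (hmem n)⟩,
    hg.congr fun n => by simp [hmem n]⟩

end RobbinsSiegmund

end BlockPD

namespace BlockPD

/-! ### Weak convergence: Opial's argument and measurability of weak limits -/

/-- Browder's demiclosedness principle. Expanding ‖z_n - T a‖² around a isolates ‖a - T a‖² plus a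
term that vanishes by weak convergence, while nonexpansiveness bounds ‖z_n - T a‖ by ‖z_n - a‖ +
o(1). -/
theorem fixed_of_weak_tendsto {K : Type*} [NormedAddCommGroup K]
    [InnerProductSpace ℝ K] {T : K → K} (hT : ∀ z z', ‖T z - T z'‖ ≤ ‖z - z'‖) {z : ℕ → K}
    {r : ℝ} (hz : ∀ n, ‖z n‖ ≤ r) {l : Filter ℕ} [l.NeBot]
    (hTz : Tendsto (fun n => T (z n) - z n) l (𝓝 0)) {a : K}
    (ha : ∀ y, Tendsto (fun n => ⟪z n, y⟫_ℝ) l (𝓝 ⟪a, y⟫_ℝ)) : T a = a := by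
  have hbound : ∀ n, ‖a - T a‖ ^ 2 ≤ ‖T (z n) - z n‖ * (‖T (z n) - z n‖ + 2 * (r + ‖a‖))
      - 2 * (⟪z n, a - T a⟫_ℝ - ⟪a, a - T a⟫_ℝ) := by
    intro n
    have h1 : ‖z n - T a‖ ≤ ‖T (z n) - z n‖ + ‖z n - a‖ := by
      rw [show z n - T a = (T (z n) - T a) - (T (z n) - z n) by abel]
      refine (norm_sub_le _ _).trans ?_
      linarith [hT (z n) a]
    have h2 : ‖z n - T a‖ ^ 2 ≤ (‖T (z n) - z n‖ + ‖z n - a‖) ^ 2 := by gcongr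
    rw [show z n - T a = (z n - a) + (a - T a) by abel, @norm_add_sq_real, inner_sub_left] at h2
    have h3 : ‖z n - a‖ ≤ r + ‖a‖ := (norm_sub_le _ _).trans (by gcongr; exact hz n)
    have h4 := mul_le_mul_of_nonneg_left h3 (norm_nonneg (T (z n) - z n))
    linarith
  have hn := hTz.norm
  rw [norm_zero] at hn
  have hlim := ge_of_tendsto' ((hn.mul (hn.add_const (2 * (r + ‖a‖)))).sub
    (((ha (a - T a)).sub_const ⟪a, a - T a⟫_ℝ).const_mul 2)) hbound
  have : ‖a - T a‖ ^ 2 = 0 := le_antisymm (by simpa using hlim) (sq_nonneg _)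
  simpa [sub_eq_zero, eq_comm] using this

section Weak

variable {K : Type*} [NormedAddCommGroup K] [InnerProductSpace ℝ K] [CompleteSpace K]

/-- Banach-Alaoglu through the Riesz identification. Ultrafilters take the place of weakly
convergent subsequences. -/
theorem exists_weak_limit_ultrafilter {z : ℕ → K} {r : ℝ} (hz : ∀ n, ‖z n‖ ≤ r)
    (𝒰 : Ultrafilter ℕ) : ∃ a, ∀ y, Tendsto (fun n => ⟪z n, y⟫_ℝ) 𝒰 (𝓝 ⟪a, y⟫_ℝ) := by
  let g : ℕ → WeakDual ℝ K := fun n => StrongDual.toWeakDual (InnerProductSpace.toDual ℝ K (z n))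
  have hg : ∀ n, g n ∈ WeakDual.toStrongDual ⁻¹' Metric.closedBall (0 : StrongDual ℝ K) r :=
    fun n => by
      rw [Set.mem_preimage, mem_closedBall_zero_iff]
      exact ((InnerProductSpace.toDual ℝ K).norm_map (z n)).trans_le (hz n)
  obtain ⟨f, -, hf⟩ := (WeakDual.isCompact_closedBall (𝕜 := ℝ) (E := K) 0 r).ultrafilter_le_nhds
    (𝒰.map g) (by
      rw [le_principal_iff, Ultrafilter.coe_map, mem_map]
      exact Filter.mem_of_superset Filter.univ_mem fun n _ => hg n)
  refine ⟨(InnerProductSpace.toDual ℝ K).symm (WeakDual.toStrongDual f), fun y => ?_⟩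
  rw [InnerProductSpace.toDual_symm_apply]
  exact ((WeakDual.eval_continuous y).tendsto f).comp hf

/-- **Opial's lemma**, with a weighted norm. -/
theorem exists_weak_limit_of_opial {T : K → K} (hT : ∀ z z', ‖T z - T z'‖ ≤ ‖z - z'‖)
    {S : K →L[ℝ] K} (hS : IsSelfAdjoint S) {α : ℝ} (hα : 0 < α)
    (hSα : ∀ x, α * ‖x‖ ^ 2 ≤ ⟪x, S x⟫_ℝ) {z : ℕ → K} (hne : ∃ a, T a = a)
    (hfejer : ∀ a, T a = a → ∃ l, Tendsto (fun n => ⟪z n - a, S (z n - a)⟫_ℝ) atTop (𝓝 l))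
    (hTz : Tendsto (fun n => T (z n) - z n) atTop (𝓝 0)) :
    ∃ a, T a = a ∧ ∀ y, Tendsto (fun n => ⟪z n, y⟫_ℝ) atTop (𝓝 ⟪a, y⟫_ℝ) := by
  have hsym : ∀ x y, ⟪x, S y⟫_ℝ = ⟪y, S x⟫_ℝ := fun x y => by
    rw [real_inner_comm]
    exact hS.isSymmetric y x
  obtain ⟨r, hr⟩ : ∃ r, ∀ n, ‖z n‖ ≤ r := by
    obtain ⟨a, ha⟩ := hne
    obtain ⟨l, hl⟩ := hfejer a ha
    obtain ⟨R, hR⟩ := hl.bddAbove_range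
    refine ⟨√(R / α) + ‖a‖, fun n => ?_⟩
    have : ‖z n - a‖ ≤ √(R / α) := Real.le_sqrt_of_sq_le (by
      rw [le_div_iff₀ hα, mul_comm]
      exact (hSα _).trans (hR ⟨n, rfl⟩))
    calc ‖z n‖ = ‖(z n - a) + a‖ := by rw [sub_add_cancel]
      _ ≤ _ := (norm_add_le _ _).trans (by gcongr)
  have hlim : ∀ 𝒰 : Ultrafilter ℕ, ↑𝒰 ≤ (atTop : Filter ℕ) → ∃ a, T a = a ∧
      ∀ y, Tendsto (fun n => ⟪z n, y⟫_ℝ) 𝒰 (𝓝 ⟪a, y⟫_ℝ) := fun 𝒰 h𝒰 => by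
    obtain ⟨a, ha⟩ := exists_weak_limit_ultrafilter hr 𝒰
    exact ⟨a, fixed_of_weak_tendsto hT hr (hTz.mono_left h𝒰) ha, ha⟩
  obtain ⟨a, haT, ha⟩ := hlim (Ultrafilter.of atTop) (Ultrafilter.of_le _)
  refine ⟨a, haT, fun y => ?_⟩
  rw [tendsto_iff_ultrafilter]
  intro 𝒰 h𝒰
  obtain ⟨b, hbT, hb⟩ := hlim 𝒰 h𝒰
  obtain ⟨la, hla⟩ := hfejer a haT
  obtain ⟨lb, hlb⟩ := hfejer b hbT
  -- The quadratic terms in z_n cancel between the two weighted distances, so ⟨z_n, S(a - b)⟩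
  -- converges along the whole sequence. Its limit is computed along both ultrafilters, whence ⟨a -
  -- b, S(a - b)⟩ = 0.
  have hdiff : Tendsto (fun n => ⟪z n, S (a - b)⟫_ℝ) atTop
      (𝓝 ((lb - la + (⟪a, S a⟫_ℝ - ⟪b, S b⟫_ℝ)) / 2)) := by
    refine (((hlb.sub hla).add_const _).div_const 2).congr fun n => ?_
    simp only [map_sub, inner_sub_left, inner_sub_right]
    rw [hsym a (z n), hsym b (z n)]
    ring
  have e1 := tendsto_nhds_unique (ha (S (a - b))) (hdiff.mono_left (Ultrafilter.of_le _))
  have e2 := tendsto_nhds_unique (hb (S (a - b))) (hdiff.mono_left h𝒰)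
  have h0 := hSα (a - b)
  rw [inner_sub_left, e1, e2, sub_self] at h0
  have : ‖a - b‖ ^ 2 = 0 :=
    le_antisymm (nonpos_of_mul_nonpos_right h0 hα) (sq_nonneg _)
  have hab : a = b := by simpa [sub_eq_zero] using this
  rw [hab]
  exact hb y

variable [TopologicalSpace.SeparableSpace K] [MeasurableSpace K] [BorelSpace K]
  {Ω : Type*} {m0 : MeasurableSpace Ω}

/-- Weakly measurable functions with values in a separable Hilbert space are measurable. -/
theorem measurable_of_measurable_inner {f : Ω → K} (hf : ∀ y, Measurable fun ω => ⟪f ω, y⟫_ℝ) :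
    Measurable f := by
  have : Nonempty K := ⟨0⟩
  have := UniformSpace.secondCountable_of_separable K
  have hinj : Function.Injective fun (x : K) (k : ℕ) => ⟪x, TopologicalSpace.denseSeq K k⟫_ℝ := by
    intro x y hxy
    have h : ∀ u, ⟪x, u⟫_ℝ = ⟪y, u⟫_ℝ := fun u => congrFun
      (DenseRange.equalizer (TopologicalSpace.denseRange_denseSeq K)
        (continuous_const.inner continuous_id) (continuous_const.inner continuous_id) hxy) u
    exact ext_inner_right ℝ h
  have hcont : Continuous fun (x : K) (k : ℕ) => ⟪x, TopologicalSpace.denseSeq K k⟫_ℝ :=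
    continuous_pi fun k => continuous_id.inner continuous_const
  rw [← (hcont.measurableEmbedding hinj).measurable_comp_iff]
  exact measurable_pi_lambda _ fun k => hf _

/-- On a measurable null set containing the exceptional points the limit is replaced by a fixed
element of S, so that membership holds everywhere. Measurability is weak measurability, by pointwise
limits of scalar functions. -/
theorem exists_measurable_weak_limit {P : Measure Ω} {z : ℕ → Ω → K} (hz : ∀ n, Measurable (z n))
    {S : Set K} (hS : S.Nonempty)
    (h : ∀ᵐ ω ∂P, ∃ a ∈ S, ∀ y, Tendsto (fun n => ⟪z n ω, y⟫_ℝ) atTop (𝓝 ⟪a, y⟫_ℝ)) :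
    ∃ zhat : Ω → K, Measurable zhat ∧ (∀ ω, zhat ω ∈ S) ∧
      ∀ᵐ ω ∂P, ∀ y, Tendsto (fun n => ⟪z n ω, y⟫_ℝ) atTop (𝓝 ⟪zhat ω, y⟫_ℝ) := by
  classical
  obtain ⟨a₀, ha₀⟩ := hS
  obtain ⟨N, hsub, hNm, hN0⟩ := exists_measurable_superset_of_null (ae_iff.1 h)
  have hex : ∀ ω, ∃ a ∈ S, (ω ∈ N → a = a₀) ∧
      (ω ∉ N → ∀ y, Tendsto (fun n => ⟪z n ω, y⟫_ℝ) atTop (𝓝 ⟪a, y⟫_ℝ)) := fun ω => by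
    by_cases hω : ω ∈ N
    · exact ⟨a₀, ha₀, fun _ => rfl, fun h => absurd hω h⟩
    · obtain ⟨a, ha, hy⟩ := not_not.1 fun h' => hω (hsub h')
      exact ⟨a, ha, fun h => absurd h hω, fun _ => hy⟩
  choose zhat hzS hzN hz' using hex
  refine ⟨zhat, measurable_of_measurable_inner fun y => ?_, hzS, ?_⟩
  · refine measurable_of_tendsto_metrizable
      (f := fun n ω => if ω ∈ N then ⟪a₀, y⟫_ℝ else ⟪z n ω, y⟫_ℝ)
      (fun n => Measurable.ite hNm measurable_const
        ((continuous_id.inner continuous_const).measurable.comp (hz n)))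
      (tendsto_pi_nhds.2 fun ω => ?_)
    by_cases hω : ω ∈ N
    · simp [hω, hzN ω hω]
    · simpa [hω] using hz' ω hω y
  · filter_upwards [measure_eq_zero_iff_ae_notMem.1 hN0] with ω hω using hz' ω hω

end Weak

end BlockPD

namespace BlockPD

/-! ### Randomly swept block-coordinate iterations -/

theorem norm_add_smul_sq_le {V : Type*} [NormedAddCommGroup V] [InnerProductSpace ℝ V]
    {z d : V} {κ lam : ℝ} (hlam : lam ∈ Set.Ioc (0 : ℝ) 1)
    (h : ‖z + d‖ ^ 2 + κ * ‖d‖ ^ 2 ≤ ‖z‖ ^ 2) :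
    ‖z + lam • d‖ ^ 2 ≤ ‖z‖ ^ 2 - lam * κ * ‖d‖ ^ 2 := by
  rw [@norm_add_sq_real] at h ⊢
  rw [norm_smul, mul_pow, Real.norm_eq_abs, sq_abs, real_inner_smul_right]
  have h1 := mul_le_mul_of_nonneg_left h hlam.1.le
  have h2 := mul_nonneg (mul_nonneg hlam.1.le (sub_nonneg.2 hlam.2)) (sq_nonneg ‖d‖)
  linarith

theorem norm_add_sq_le_weighted {V : Type*} [NormedAddCommGroup V] [InnerProductSpace ℝ V]
    (x y : V) {t : ℝ} (ht : 0 < t) :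
    ‖x + y‖ ^ 2 ≤ (1 + t) * ‖x‖ ^ 2 + (1 + t⁻¹) * ‖y‖ ^ 2 := by
  have h := mul_nonneg (inv_pos.2 ht).le (sq_nonneg ‖t • x - y‖)
  rw [@norm_sub_sq_real, norm_smul, mul_pow, Real.norm_eq_abs, sq_abs, real_inner_smul_left] at h
  rw [@norm_add_sq_real]
  have : t⁻¹ * (t ^ 2 * ‖x‖ ^ 2 - 2 * (t * ⟪x, y⟫_ℝ) + ‖y‖ ^ 2)
      = t * ‖x‖ ^ 2 - 2 * ⟪x, y⟫_ℝ + t⁻¹ * ‖y‖ ^ 2 := by field_simp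
  linarith

section Sweeping

variable {ι : Type*} [Fintype ι] {K : Type*} [NormedAddCommGroup K] [InnerProductSpace ℝ K]

/-- The map whose norm is the weighted norm `√(∑ i, ‖Q i x‖ ^ 2 / π i)`. -/
noncomputable def weightedMap (Q : ι → K →L[ℝ] K) (π : ι → ℝ) : K →L[ℝ] PiLp 2 fun _ : ι => K :=
  ((PiLp.continuousLinearEquiv 2 ℝ fun _ : ι => K).symm : (ι → K) →L[ℝ] PiLp 2 fun _ : ι => K) ∘L
    ContinuousLinearMap.pi fun i => (√(π i))⁻¹ • Q i

variable {Q : ι → K →L[ℝ] K} {π : ι → ℝ}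

theorem norm_weightedMap_sq (hπ : ∀ i, 0 < π i) (x : K) :
    ‖weightedMap Q π x‖ ^ 2 = ∑ i, (π i)⁻¹ * ‖Q i x‖ ^ 2 := by
  rw [PiLp.norm_sq_eq_of_L2]
  refine Finset.sum_congr rfl fun i _ => ?_
  change ‖(√(π i))⁻¹ • Q i x‖ ^ 2 = _
  rw [norm_smul, mul_pow, Real.norm_eq_abs, sq_abs, inv_pow, Real.sq_sqrt (hπ i).le]

variable [CompleteSpace K]

/-- A finite family of mutually orthogonal projections with sum the identity. -/
structure IsOrthogonalResolution (Q : ι → K →L[ℝ] K) : Prop where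
  isSelfAdjoint : ∀ i, IsSelfAdjoint (Q i)
  idempotent : ∀ i x, Q i (Q i x) = Q i x
  orthogonal : ∀ i j, i ≠ j → ∀ x, Q i (Q j x) = 0
  sum_apply : ∀ x, ∑ i, Q i x = x

namespace IsOrthogonalResolution

theorem norm_sq (hQ : IsOrthogonalResolution Q) (x : K) : ‖x‖ ^ 2 = ∑ i, ‖Q i x‖ ^ 2 := by
  have h : ∀ i, ‖Q i x‖ ^ 2 = ⟪x, Q i x⟫_ℝ := fun i => by
    rw [← real_inner_self_eq_norm_sq]
    refine ((hQ.isSelfAdjoint i).isSymmetric x (Q i x)).trans ?_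
    change ⟪x, Q i (Q i x)⟫_ℝ = _
    rw [hQ.idempotent]
  rw [Finset.sum_congr rfl fun i _ => h i, ← inner_sum, hQ.sum_apply, real_inner_self_eq_norm_sq]

theorem norm_apply_sq_le (hQ : IsOrthogonalResolution Q) (i : ι) (x : K) :
    ‖Q i x‖ ^ 2 ≤ ‖x‖ ^ 2 := by
  rw [hQ.norm_sq x]
  exact Finset.single_le_sum (f := fun i => ‖Q i x‖ ^ 2) (fun i _ => sq_nonneg _)
    (Finset.mem_univ i)

theorem apply_sum_smul (hQ : IsOrthogonalResolution Q) (c : ι → ℝ) (x : K) (i : ι) :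
    Q i (∑ j, c j • Q j x) = c i • Q i x := by
  rw [map_sum, Finset.sum_eq_single i]
  · rw [map_smul, hQ.idempotent]
  · intro j _ hj
    rw [map_smul, hQ.orthogonal i j hj.symm, smul_zero]
  · simp

theorem norm_weightedMap_sum_sq_le (hQ : IsOrthogonalResolution Q) (hπ : ∀ i, 0 < π i)
    {c : ι → ℝ} (hc : ∀ i, |c i| ≤ 1) (x : K) :
    ‖weightedMap Q π (∑ j, c j • Q j x)‖ ^ 2 ≤ (∑ i, (π i)⁻¹) * ‖x‖ ^ 2 := by
  rw [norm_weightedMap_sq hπ, Finset.sum_mul]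
  refine Finset.sum_le_sum fun i _ => ?_
  refine mul_le_mul_of_nonneg_left ?_ (inv_pos.2 (hπ i)).le
  rw [hQ.apply_sum_smul, norm_smul, mul_pow, Real.norm_eq_abs]
  exact (mul_le_of_le_one_left (sq_nonneg _) (pow_le_one₀ (abs_nonneg _) (hc i))).trans
    (hQ.norm_apply_sq_le i x)

theorem norm_sq_le_norm_weightedMap_sq (hQ : IsOrthogonalResolution Q) (hπ : ∀ i, 0 < π i)
    (hπ1 : ∀ i, π i ≤ 1) (x : K) : ‖x‖ ^ 2 ≤ ‖weightedMap Q π x‖ ^ 2 := by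
  rw [norm_weightedMap_sq hπ, hQ.norm_sq x]
  exact Finset.sum_le_sum fun i _ =>
    le_mul_of_one_le_left (sq_nonneg _) ((one_le_inv₀ (hπ i)).2 (hπ1 i))

end IsOrthogonalResolution

theorem bit_true : bit true = 1 := rfl

theorem bit_false : bit false = 0 := rfl

theorem bit_nonneg (b : Bool) : 0 ≤ bit b := by cases b <;> simp [bit]

theorem bit_le_one (b : Bool) : bit b ≤ 1 := by cases b <;> simp [bit]

/-- Integral of a random choice that is independent of the two alternatives. -/
theorem lintegral_ite_of_indep {Ω : Type*} {m0 m 𝒢 : MeasurableSpace Ω} {P : Measure[m0] Ω}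
    [IsProbabilityMeasure P] (hm : m ≤ m0) (h𝒢 : 𝒢 ≤ m0) (hind : Indep 𝒢 m P) {ε : Ω → Bool}
    (hε : MeasurableSet[𝒢] {ω | ε ω = true}) {π : ℝ} (hπ : 0 ≤ π)
    (hεπ : P {ω | ε ω = true} = ENNReal.ofReal π) {ψ₀ ψ₁ : Ω → ℝ≥0∞} (hψ₀ : Measurable[m] ψ₀)
    (hψ₁ : Measurable[m] ψ₁) :
    ∫⁻ ω, (if ε ω = true then ψ₁ ω else ψ₀ ω) ∂P =
      ∫⁻ ω, (ENNReal.ofReal (1 - π) * ψ₀ ω + ENNReal.ofReal π * ψ₁ ω) ∂P := by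
  set s := {ω | ε ω = true} with hs
  have hsm : MeasurableSet[m0] s := h𝒢 _ hε
  have h₁ : ∀ t : Set Ω, MeasurableSet[𝒢] t → Measurable[𝒢] (t.indicator (1 : Ω → ℝ≥0∞)) :=
    fun t ht => (@measurable_one _ _ _ 𝒢 _).indicator ht
  have hint : ∀ t : Set Ω, MeasurableSet[𝒢] t → ∀ ψ : Ω → ℝ≥0∞, Measurable[m] ψ →
      ∫⁻ ω, t.indicator 1 ω * ψ ω ∂P = ∫⁻ ω, P t * ψ ω ∂P := fun t ht ψ hψ => by
    rw [lintegral_mul_eq_lintegral_mul_lintegral_of_independent_measurableSpace h𝒢 hm hind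
      (h₁ t ht) hψ, lintegral_indicator_one (h𝒢 _ ht),
      lintegral_const_mul _ (hψ.mono hm le_rfl)]
  have hpt : ∀ ω, (if ε ω = true then ψ₁ ω else ψ₀ ω)
      = sᶜ.indicator 1 ω * ψ₀ ω + s.indicator 1 ω * ψ₁ ω := fun ω => by
    by_cases h : ε ω = true <;> simp [hs, h]
  have hm₀ : Measurable[m0] fun ω => sᶜ.indicator 1 ω * ψ₀ ω :=
    ((h₁ _ hε.compl).mono h𝒢 le_rfl).mul (hψ₀.mono hm le_rfl)
  rw [lintegral_congr hpt, lintegral_add_left hm₀, hint _ hε.compl _ hψ₀,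
    hint _ hε _ hψ₁, ← lintegral_add_left ((hψ₀.mono hm le_rfl).const_mul _),
    prob_compl_eq_one_sub hsm, hεπ, ENNReal.ofReal_sub _ hπ, ENNReal.ofReal_one]

theorem IsOrthogonalResolution.ofReal_norm_sweep_sq (hQ : IsOrthogonalResolution Q)
    (hπ : ∀ i, 0 < π i) (ε : ι → Bool) (z d : K) (lam : ℝ) :
    ENNReal.ofReal (‖weightedMap Q π (z + ∑ i, (lam * bit (ε i)) • Q i d)‖ ^ 2) =
      ∑ i, if ε i = true then ENNReal.ofReal ((π i)⁻¹ * ‖Q i z + lam • Q i d‖ ^ 2)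
        else ENNReal.ofReal ((π i)⁻¹ * ‖Q i z‖ ^ 2) := by
  rw [norm_weightedMap_sq hπ, ENNReal.ofReal_sum_of_nonneg
    fun i _ => mul_nonneg (inv_pos.2 (hπ i)).le (sq_nonneg _)]
  refine Finset.sum_congr rfl fun i _ => ?_
  rw [map_add, hQ.apply_sum_smul]
  by_cases h : ε i = true
  · simp [h, bit_true]
  · simp [h, bit_false]

/-- Block i contributes (1 - π_i)/π_i ‖Q_i z‖² + ‖Q_i z + λ Q_i d‖²: the weight 1/π_i cancels the
activation probability, and the second terms reassemble into the unweighted norm, the one in which T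
is averaged. -/
theorem IsOrthogonalResolution.ofReal_mean_norm_sq (hQ : IsOrthogonalResolution Q)
    (hπ : ∀ i, 0 < π i) (hπ1 : ∀ i, π i ≤ 1) (z d : K) (lam : ℝ) :
    ENNReal.ofReal (‖weightedMap Q π z‖ ^ 2 - ‖z‖ ^ 2 + ‖z + lam • d‖ ^ 2) =
      ∑ i, (ENNReal.ofReal (1 - π i) * ENNReal.ofReal ((π i)⁻¹ * ‖Q i z‖ ^ 2)
        + ENNReal.ofReal (π i) * ENNReal.ofReal ((π i)⁻¹ * ‖Q i z + lam • Q i d‖ ^ 2)) := by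
  have hi0 : ∀ i, 0 ≤ (π i)⁻¹ := fun i => (inv_pos.2 (hπ i)).le
  have h0 : ∀ i, 0 ≤ 1 - π i := fun i => sub_nonneg.2 (hπ1 i)
  have h : ∀ i, ENNReal.ofReal (1 - π i) * ENNReal.ofReal ((π i)⁻¹ * ‖Q i z‖ ^ 2)
        + ENNReal.ofReal (π i) * ENNReal.ofReal ((π i)⁻¹ * ‖Q i z + lam • Q i d‖ ^ 2)
      = ENNReal.ofReal ((1 - π i) * ((π i)⁻¹ * ‖Q i z‖ ^ 2)
        + π i * ((π i)⁻¹ * ‖Q i z + lam • Q i d‖ ^ 2)) := fun i => by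
    rw [← ENNReal.ofReal_mul (h0 i), ← ENNReal.ofReal_mul (hπ i).le, ← ENNReal.ofReal_add
      (mul_nonneg (h0 i) (mul_nonneg (hi0 i) (sq_nonneg _)))
      (mul_nonneg (hπ i).le (mul_nonneg (hi0 i) (sq_nonneg _)))]
  rw [Finset.sum_congr rfl fun i _ => h i, ← ENNReal.ofReal_sum_of_nonneg fun i _ => add_nonneg
      (mul_nonneg (h0 i) (mul_nonneg (hi0 i) (sq_nonneg _)))
      (mul_nonneg (hπ i).le (mul_nonneg (hi0 i) (sq_nonneg _))),
    norm_weightedMap_sq hπ, hQ.norm_sq z, hQ.norm_sq (z + _), ← Finset.sum_sub_distrib,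
    ← Finset.sum_add_distrib]
  congr 1
  refine Finset.sum_congr rfl fun i _ => ?_
  have := (hπ i).ne'
  rw [map_add, map_smul]
  field_simp

variable [TopologicalSpace.SeparableSpace K] [MeasurableSpace K] [BorelSpace K]
  {Ω : Type*} {m0 : MeasurableSpace Ω} {P : Measure Ω} [IsProbabilityMeasure P]

/-- The conditional expectation of the weighted norm after a random sweep, tested against
nonnegative random variables. -/
theorem lintegral_norm_sweep_sq (hQ : IsOrthogonalResolution Q) (hπ : ∀ i, 0 < π i)
    {m 𝒢 : MeasurableSpace Ω} (hm : m ≤ m0) (h𝒢 : 𝒢 ≤ m0) (hind : Indep 𝒢 m P)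
    {ε : Ω → ι → Bool} (hε : ∀ i, MeasurableSet[𝒢] {ω | ε ω i = true})
    (hεπ : ∀ i, P {ω | ε ω i = true} = ENNReal.ofReal (π i))
    {z d : Ω → K} (hz : Measurable[m] z) (hd : Measurable[m] d) (lam : ℝ)
    {φ : Ω → ℝ≥0∞} (hφ : Measurable[m] φ) :
    ∫⁻ ω, φ ω * ENNReal.ofReal
        (‖weightedMap Q π (z ω + ∑ i, (lam * bit (ε ω i)) • Q i (d ω))‖ ^ 2) ∂P =
      ∫⁻ ω, φ ω * ENNReal.ofReal
        (‖weightedMap Q π (z ω)‖ ^ 2 - ‖z ω‖ ^ 2 + ‖z ω + lam • d ω‖ ^ 2) ∂P := by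
  have := UniformSpace.secondCountable_of_separable K
  have hπ1 : ∀ i, π i ≤ 1 := fun i => by
    rw [← ENNReal.ofReal_le_one, ← hεπ]
    exact prob_le_one
  have hψ₀ : ∀ i, Measurable[m] fun ω => φ ω * ENNReal.ofReal ((π i)⁻¹ * ‖Q i (z ω)‖ ^ 2) :=
    fun i => by
      have h : Measurable fun x : K => ENNReal.ofReal ((π i)⁻¹ * ‖Q i x‖ ^ 2) := by fun_prop
      exact hφ.mul (h.comp hz)
  have hψ₁ : ∀ i, Measurable[m] fun ω =>
      φ ω * ENNReal.ofReal ((π i)⁻¹ * ‖Q i (z ω) + lam • Q i (d ω)‖ ^ 2) := fun i => by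
    have h : Measurable[m] fun ω => Q i (z ω) + lam • Q i (d ω) :=
      ((Q i).continuous.measurable.comp hz).add
        (((Q i).continuous.measurable.comp hd).const_smul lam)
    have h' : Measurable fun x : K => ENNReal.ofReal ((π i)⁻¹ * ‖x‖ ^ 2) := by fun_prop
    exact hφ.mul (h'.comp h)
  have e1 := fun i => lintegral_ite_of_indep hm h𝒢 hind (hε i) (hπ i).le (hεπ i) (hψ₀ i) (hψ₁ i)
  simp only [hQ.ofReal_norm_sweep_sq hπ, hQ.ofReal_mean_norm_sq hπ hπ1, Finset.mul_sum, mul_ite,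
    mul_add, mul_left_comm (φ _)]
  rw [lintegral_finsetSum _ fun i _ => Measurable.ite (h𝒢 _ (hε i))
    ((hψ₁ i).mono hm le_rfl) ((hψ₀ i).mono hm le_rfl),
    lintegral_finsetSum]
  · exact Finset.sum_congr rfl fun i _ => e1 i
  · exact fun i _ => (((hψ₀ i).mono hm le_rfl).const_mul _).add
      (((hψ₁ i).mono hm le_rfl).const_mul _)

/-- One step of a perturbed randomly swept iteration. -/
theorem lintegral_norm_sweep_error_le (hQ : IsOrthogonalResolution Q) (hπ : ∀ i, 0 < π i)
    {m 𝒢 : MeasurableSpace Ω} (hm : m ≤ m0) (h𝒢 : 𝒢 ≤ m0) (hind : Indep 𝒢 m P)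
    {ε : Ω → ι → Bool} (hε : ∀ i, MeasurableSet[𝒢] {ω | ε ω i = true})
    (hεπ : ∀ i, P {ω | ε ω i = true} = ENNReal.ofReal (π i))
    {z d e : Ω → K} (hz : Measurable[m] z) (hd : Measurable[m] d) {lam κ : ℝ} (hκ : 0 ≤ κ)
    (hlam : lam ∈ Set.Ioc (0 : ℝ) 1)
    (hzd : ∀ ω, ‖z ω + d ω‖ ^ 2 + κ * ‖d ω‖ ^ 2 ≤ ‖z ω‖ ^ 2)
    {ζ : Ω → ℝ} (hζm : Measurable[m] ζ) (hζ0 : ∀ ω, 0 < ζ ω)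
    (hζ : ∀ φ : Ω → ℝ≥0∞, Measurable[m] φ →
      ∫⁻ ω, φ ω * ENNReal.ofReal (‖e ω‖ ^ 2) ∂P ≤ ∫⁻ ω, φ ω * ENNReal.ofReal (ζ ω ^ 2) ∂P)
    {φ : Ω → ℝ≥0∞} (hφ : Measurable[m] φ) :
    ∫⁻ ω, φ ω * ENNReal.ofReal
        (‖weightedMap Q π (z ω + ∑ i, (lam * bit (ε ω i)) • Q i (d ω + e ω))‖ ^ 2) ∂P
      + ∫⁻ ω, φ ω * ENNReal.ofReal (lam * κ * ‖d ω‖ ^ 2) ∂P ≤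
      ∫⁻ ω, φ ω * ENNReal.ofReal ((1 + ζ ω) * ‖weightedMap Q π (z ω)‖ ^ 2
        + (∑ i, (π i)⁻¹) * (ζ ω ^ 2 + ζ ω)) ∂P := by
  have := UniformSpace.secondCountable_of_separable K
  have hπ1 : ∀ i, π i ≤ 1 := fun i => by
    rw [← ENNReal.ofReal_le_one, ← hεπ]
    exact prob_le_one
  set R := weightedMap Q π
  set M := ∑ i, (π i)⁻¹
  have hM : 0 ≤ M := Finset.sum_nonneg fun i _ => (inv_pos.2 (hπ i)).le
  have hlk : 0 ≤ lam * κ := mul_nonneg hlam.1.le hκ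
  -- Young's inequality is used with the random parameter ζ, so its coefficients 1 + ζ and 1 + 1/ζ
  -- are absorbed into the test functions. They are m-measurable, and (1 + 1/ζ)ζ² = ζ² + ζ stays
  -- first order in ζ. This is why ζ must be strictly positive.
  set φ₁ : Ω → ℝ≥0∞ := fun ω => φ ω * ENNReal.ofReal (1 + ζ ω) with hφ₁
  set φ₂ : Ω → ℝ≥0∞ := fun ω => φ ω * ENNReal.ofReal ((1 + (ζ ω)⁻¹) * M) with hφ₂
  have hφ₁m : Measurable[m] φ₁ := hφ.mul (ENNReal.measurable_ofReal.comp (hζm.const_add 1))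
  have hφ₂m : Measurable[m] φ₂ :=
    hφ.mul (ENNReal.measurable_ofReal.comp ((hζm.inv.const_add 1).mul_const M))
  have zm := hz.mono hm le_rfl
  have dm := hd.mono hm le_rfl
  have ζm := hζm.mono hm le_rfl
  have φm := hφ.mono hm le_rfl
  have φ₁m := hφ₁m.mono hm le_rfl
  set y : Ω → K := fun ω => z ω + ∑ i, (lam * bit (ε ω i)) • Q i (d ω) with hy
  have hym : Measurable[m0] y := by
    refine zm.add (Finset.measurable_fun_sum _ fun i _ => Measurable.smul
      (Measurable.const_mul ?_ lam) ((Q i).continuous.measurable.comp dm))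
    exact Measurable.ite (h𝒢 _ (hε i)) measurable_const measurable_const
  have hstep : ∀ ω, ENNReal.ofReal (‖R (z ω + ∑ i, (lam * bit (ε ω i)) • Q i (d ω + e ω))‖ ^ 2)
      ≤ ENNReal.ofReal (1 + ζ ω) * ENNReal.ofReal (‖R (y ω)‖ ^ 2)
        + ENNReal.ofReal ((1 + (ζ ω)⁻¹) * M) * ENNReal.ofReal (‖e ω‖ ^ 2) := fun ω => by
    have h0 := hζ0 ω
    have h1 := norm_add_sq_le_weighted (R (y ω))
      (R (∑ i, (lam * bit (ε ω i)) • Q i (e ω))) h0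
    have h2 := hQ.norm_weightedMap_sum_sq_le hπ (c := fun i => lam * bit (ε ω i)) (fun i => by
      rw [abs_of_nonneg (mul_nonneg hlam.1.le (bit_nonneg _))]
      exact mul_le_one₀ hlam.2 (bit_nonneg _) (bit_le_one _)) (e ω)
    have h3 : z ω + ∑ i, (lam * bit (ε ω i)) • Q i (d ω + e ω)
        = y ω + ∑ i, (lam * bit (ε ω i)) • Q i (e ω) := by
      simp only [hy, map_add, smul_add, Finset.sum_add_distrib, add_assoc]
    rw [← ENNReal.ofReal_mul (by positivity), ← ENNReal.ofReal_mul (by positivity),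
      ← ENNReal.ofReal_add (by positivity) (by positivity), h3, map_add]
    refine ENNReal.ofReal_le_ofReal (h1.trans ?_)
    rw [mul_assoc]
    gcongr
  have hexp : ∫⁻ ω, φ₁ ω * ENNReal.ofReal (‖R (y ω)‖ ^ 2) ∂P =
      ∫⁻ ω, φ₁ ω * ENNReal.ofReal
        (‖R (z ω)‖ ^ 2 - ‖z ω‖ ^ 2 + ‖z ω + lam • d ω‖ ^ 2) ∂P :=
    lintegral_norm_sweep_sq hQ hπ hm h𝒢 hind hε hεπ hz hd lam hφ₁m
  calc _ ≤ ∫⁻ ω, (φ₁ ω * ENNReal.ofReal (‖R (y ω)‖ ^ 2)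
          + φ₂ ω * ENNReal.ofReal (‖e ω‖ ^ 2)) ∂P
        + ∫⁻ ω, φ₁ ω * ENNReal.ofReal (lam * κ * ‖d ω‖ ^ 2) ∂P := by
        refine add_le_add (lintegral_mono fun ω => ?_) (lintegral_mono fun ω => ?_)
        · simp only [hφ₁, hφ₂]
          rw [mul_assoc, mul_assoc, ← mul_add]
          exact mul_le_mul_right (hstep ω) _
        -- The decrease term is enlarged by 1 + ζ ≥ 1 so that it cancels against the one produced,
        -- with the same factor, by averagedness.
        · simp only [hφ₁]
          gcongr
          refine le_mul_of_one_le_right (by positivity) ?_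
          rw [ENNReal.one_le_ofReal]
          linarith [hζ0 ω]
    _ ≤ ∫⁻ ω, φ₁ ω * ENNReal.ofReal
          (‖R (z ω)‖ ^ 2 - ‖z ω‖ ^ 2 + ‖z ω + lam • d ω‖ ^ 2) ∂P
        + ∫⁻ ω, φ₂ ω * ENNReal.ofReal (ζ ω ^ 2) ∂P
        + ∫⁻ ω, φ₁ ω * ENNReal.ofReal (lam * κ * ‖d ω‖ ^ 2) ∂P := by
        rw [lintegral_add_left (by fun_prop), hexp]
        exact add_le_add_left (add_le_add_right (hζ φ₂ hφ₂m) _) _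
    _ ≤ _ := by
        have φ₂m := hφ₂m.mono hm le_rfl
        rw [← lintegral_add_left (by fun_prop), ← lintegral_add_left (by fun_prop)]
        refine lintegral_mono fun ω => ?_
        have h0 := hζ0 ω
        have h1 := norm_add_smul_sq_le hlam (hzd ω)
        have h2 : ‖z ω‖ ^ 2 ≤ ‖R (z ω)‖ ^ 2 := hQ.norm_sq_le_norm_weightedMap_sq hπ hπ1 _
        have h3 : 0 ≤ ‖R (z ω)‖ ^ 2 - ‖z ω‖ ^ 2 + ‖z ω + lam • d ω‖ ^ 2 := by
          linarith [sq_nonneg ‖z ω + lam • d ω‖]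
        simp only [hφ₁, hφ₂]
        rw [mul_assoc, mul_assoc, mul_assoc, ← mul_add, ← mul_add,
          ← ENNReal.ofReal_mul (by positivity), ← ENNReal.ofReal_mul (by positivity),
          ← ENNReal.ofReal_mul (by positivity),
          ← ENNReal.ofReal_add (by positivity) (by positivity),
          ← ENNReal.ofReal_add (by positivity) (by positivity)]
        refine mul_le_mul_right (ENNReal.ofReal_le_ofReal ?_) _
        have h4 : (1 + (ζ ω)⁻¹) * M * ζ ω ^ 2 = M * (ζ ω ^ 2 + ζ ω) := by field_simp
        have h5 := mul_le_mul_of_nonneg_left h1 (by linarith : 0 ≤ 1 + ζ ω)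
        rw [h4]
        linarith

end Sweeping

end BlockPD

namespace BlockPD

/-! ### Almost sure weak convergence of randomly swept iterations -/

/-- Uniform limits of convergent sequences converge; this extends convergence of distances from a
dense set of fixed points to all of them. -/
theorem exists_tendsto_of_approx {u : ℕ → ℝ}
    (h : ∀ δ > 0, ∃ v : ℕ → ℝ, (∃ l, Tendsto v atTop (𝓝 l)) ∧ ∀ n, |u n - v n| ≤ δ) :
    ∃ l, Tendsto u atTop (𝓝 l) := by
  refine cauchySeq_tendsto_of_complete (Metric.cauchySeq_iff.2 fun δ hδ => ?_)
  obtain ⟨v, ⟨l, hl⟩, hv⟩ := h (δ / 4) (by positivity)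
  obtain ⟨N, hN⟩ := Metric.cauchySeq_iff.1 hl.cauchySeq (δ / 4) (by positivity)
  refine ⟨N, fun m hm n hn => ?_⟩
  have h1 := hN m hm n hn
  have h2 := abs_le.1 (hv m)
  have h3 := abs_le.1 (hv n)
  rw [Real.dist_eq, abs_lt] at h1 ⊢
  constructor <;> linarith [h1.1, h1.2, h2.1, h2.2, h3.1, h3.2]

section Convergence

variable {ι : Type*} [Fintype ι] {K : Type*} [NormedAddCommGroup K] [InnerProductSpace ℝ K]
  [CompleteSpace K] [TopologicalSpace.SeparableSpace K] [MeasurableSpace K] [BorelSpace K]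
  {Ω : Type*} {m0 : MeasurableSpace Ω} {P : Measure Ω} [IsProbabilityMeasure P]
  {Q : ι → K →L[ℝ] K} {π : ι → ℝ}

theorem summable_errorCoeff {ζ : ℕ → ℝ} (h0 : ∀ n, 0 ≤ ζ n) (h : Summable ζ) (M : ℝ) :
    Summable fun n => ζ n + M * (ζ n ^ 2 + ζ n) := by
  refine h.add ((Summable.add ?_ h).mul_left M)
  obtain ⟨b, hb⟩ := h.tendsto_atTop_zero.bddAbove_range
  refine Summable.of_nonneg_of_le (fun n => sq_nonneg _) (fun n => ?_) (h.mul_left b)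
  rw [sq]
  exact mul_le_mul_of_nonneg_right (hb ⟨n, rfl⟩) (h0 n)

/-- Stochastic quasi-Fejér monotonicity of randomly swept iterations with respect to a given
fixed point. -/
theorem ae_tendsto_and_summable_of_random_sweep (hQ : IsOrthogonalResolution Q)
    (hπ : ∀ i, 0 < π i) {T : K → K} {κ : ℝ} (hκ : 0 < κ)
    (hT : ∀ z z', ‖T z - T z'‖ ^ 2 + κ * ‖T z - z - (T z' - z')‖ ^ 2 ≤ ‖z - z'‖ ^ 2)
    (hTc : Continuous T)
    {ℱ : Filtration ℕ m0} {𝒢 : ℕ → MeasurableSpace Ω} (h𝒢 : ∀ n, 𝒢 n ≤ m0)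
    (hind : ∀ n, Indep (𝒢 n) (ℱ n) P) {ε : ℕ → Ω → ι → Bool}
    (hε : ∀ n i, MeasurableSet[𝒢 n] {ω | ε n ω i = true})
    (hεπ : ∀ n i, P {ω | ε n ω i = true} = ENNReal.ofReal (π i))
    {lam : ℕ → ℝ} (hlam : ∀ n, lam n ∈ Set.Ioc (0 : ℝ) 1) {z e : ℕ → Ω → K}
    (hz : ∀ n, Measurable[ℱ n] (z n))
    (hstep : ∀ n ω, z (n + 1) ω = z n ω +
      ∑ i, (lam n * bit (ε n ω i)) • Q i (T (z n ω) - z n ω + e n ω))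
    {ζ : ℕ → Ω → ℝ} (hζm : ∀ n, Measurable[ℱ n] (ζ n)) (hζ0 : ∀ n ω, 0 < ζ n ω)
    (hζs : ∀ᵐ ω ∂P, Summable fun n => ζ n ω)
    (hζ : ∀ n (φ : Ω → ℝ≥0∞), Measurable[ℱ n] φ →
      ∫⁻ ω, φ ω * ENNReal.ofReal (‖e n ω‖ ^ 2) ∂P ≤
        ∫⁻ ω, φ ω * ENNReal.ofReal (ζ n ω ^ 2) ∂P)
    {a : K} (ha : T a = a) :
    ∀ᵐ ω ∂P, (∃ l, Tendsto (fun n => ‖weightedMap Q π (z n ω - a)‖ ^ 2) atTop (𝓝 l)) ∧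
      Summable fun n => lam n * κ * ‖T (z n ω) - z n ω‖ ^ 2 := by
  have := UniformSpace.secondCountable_of_separable K
  have hM : 0 ≤ ∑ i, (π i)⁻¹ := Finset.sum_nonneg fun i _ => (inv_pos.2 (hπ i)).le
  have hzm : ∀ n, Measurable[ℱ n] fun ω => z n ω - a := fun n => (hz n).sub_const a
  have hdm : ∀ n, Measurable[ℱ n] fun ω => T (z n ω) - z n ω := fun n =>
    (hTc.measurable.comp (hz n)).sub (hz n)
  have hnorm : ∀ c : ℝ, Measurable fun x : K => c * ‖x‖ ^ 2 := fun c => by fun_prop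
  have hR : Measurable fun x : K => ‖weightedMap Q π x‖ ^ 2 :=
    ((weightedMap Q π).continuous.norm.pow 2).measurable
  -- A single coefficient sequence must dominate both the growth factor ζ and the additive
  -- perturbation M(ζ² + ζ), hence the sum.
  refine robbinsSiegmund (ℱ := ℱ)
    (a := fun n ω => ζ n ω + (∑ i, (π i)⁻¹) * (ζ n ω ^ 2 + ζ n ω))
    (fun n => hR.comp (hzm n)) (fun n => (hnorm (lam n * κ)).comp (hdm n))
    (fun n => (hζm n).add ((((hζm n).pow_const 2).add (hζm n)).const_mul _))
    (fun n ω => sq_nonneg _)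
    (fun n ω => mul_nonneg (mul_nonneg (hlam n).1.le hκ.le) (sq_nonneg _))
    (fun n ω => ?_) ?_ fun n φ hφ => ?_
  · have := hζ0 n ω
    positivity
  · filter_upwards [hζs] with ω hω
    exact summable_errorCoeff (fun n => (hζ0 n ω).le) hω _
  · have h := lintegral_norm_sweep_error_le hQ hπ (ℱ.le n) (h𝒢 n) (hind n) (hε n) (hεπ n)
      (hzm n) (hdm n) hκ.le (hlam n) (fun ω => by
        have := hT (z n ω) a
        rw [ha, sub_self, sub_zero] at this
        rwa [sub_add_sub_cancel']) (hζm n) (hζ0 n) (hζ n) hφ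
    refine le_trans (add_le_add_left (le_of_eq (lintegral_congr fun ω => ?_)) _)
      (h.trans (lintegral_mono fun ω => ?_))
    · rw [hstep, add_sub_right_comm]
    · refine mul_le_mul_right (ENNReal.ofReal_le_ofReal ?_) _
      have h0 := hζ0 n ω
      have : 0 ≤ (∑ i, (π i)⁻¹) * (ζ n ω ^ 2 + ζ n ω) * ‖weightedMap Q π (z n ω - a)‖ ^ 2 := by
        positivity
      linarith

/-- Almost sure weak convergence of the randomly swept iterations of an averaged operator. -/
theorem exists_weak_limit_of_random_sweep (hQ : IsOrthogonalResolution Q)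
    (hπ : ∀ i, 0 < π i) {T : K → K} {κ : ℝ} (hκ : 0 < κ)
    (hT : ∀ z z', ‖T z - T z'‖ ^ 2 + κ * ‖T z - z - (T z' - z')‖ ^ 2 ≤ ‖z - z'‖ ^ 2)
    (hfix : ∃ a, T a = a)
    {ℱ : Filtration ℕ m0} {𝒢 : ℕ → MeasurableSpace Ω} (h𝒢 : ∀ n, 𝒢 n ≤ m0)
    (hind : ∀ n, Indep (𝒢 n) (ℱ n) P) {ε : ℕ → Ω → ι → Bool}
    (hε : ∀ n i, MeasurableSet[𝒢 n] {ω | ε n ω i = true})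
    (hεπ : ∀ n i, P {ω | ε n ω i = true} = ENNReal.ofReal (π i))
    {lam : ℕ → ℝ} (hlam : ∀ n, lam n ∈ Set.Ioc (0 : ℝ) 1) {lam₀ : ℝ} (hlam₀ : 0 < lam₀)
    (hlam₀' : ∀ n, lam₀ ≤ lam n) {z e : ℕ → Ω → K}
    (hz : ∀ n, Measurable[ℱ n] (z n))
    (hstep : ∀ n ω, z (n + 1) ω = z n ω +
      ∑ i, (lam n * bit (ε n ω i)) • Q i (T (z n ω) - z n ω + e n ω))
    {ζ : ℕ → Ω → ℝ} (hζm : ∀ n, Measurable[ℱ n] (ζ n)) (hζ0 : ∀ n ω, 0 < ζ n ω)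
    (hζs : ∀ᵐ ω ∂P, Summable fun n => ζ n ω)
    (hζ : ∀ n (φ : Ω → ℝ≥0∞), Measurable[ℱ n] φ →
      ∫⁻ ω, φ ω * ENNReal.ofReal (‖e n ω‖ ^ 2) ∂P ≤
        ∫⁻ ω, φ ω * ENNReal.ofReal (ζ n ω ^ 2) ∂P) :
    ∃ zhat : Ω → K, Measurable zhat ∧ (∀ ω, T (zhat ω) = zhat ω) ∧
      ∀ᵐ ω ∂P, ∀ y, Tendsto (fun n => ⟪z n ω, y⟫_ℝ) atTop (𝓝 ⟪zhat ω, y⟫_ℝ) := by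
  have hπ1 : ∀ i, π i ≤ 1 := fun i => by
    rw [← ENNReal.ofReal_le_one, ← hεπ 0]
    exact prob_le_one
  have hne : ∀ z z', ‖T z - T z'‖ ≤ ‖z - z'‖ := fun z z' => by
    refine le_of_sq_le_sq ?_ (norm_nonneg _)
    exact (le_add_of_nonneg_right (mul_nonneg hκ.le (sq_nonneg _))).trans (hT z z')
  have hTc : Continuous T := (LipschitzWith.of_dist_le_mul (K := 1) fun x y => by
    simpa [dist_eq_norm] using hne x y).continuous
  have := UniformSpace.secondCountable_of_separable K
  set S : Set K := {a | T a = a} with hS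
  have hSne : Nonempty S := let ⟨a, ha⟩ := hfix; ⟨⟨a, ha⟩⟩
  -- The exceptional null set depends on the fixed point. A countable dense family of fixed points
  -- yields one null set valid for all of them.
  have hall := ae_all_iff.2 fun k => ae_tendsto_and_summable_of_random_sweep hQ hπ hκ hT hTc h𝒢
    hind hε hεπ hlam hz hstep hζm hζ0 hζs hζ (TopologicalSpace.denseSeq S k).2
  refine exists_measurable_weak_limit (S := S) (fun n => (hz n).mono (ℱ.le n) le_rfl) hfix ?_
  filter_upwards [hall] with ω hω
  set R := weightedMap Q π with hR
  have hRsq : ∀ x, ⟪x, (ContinuousLinearMap.adjoint R ∘L R) x⟫_ℝ = ‖R x‖ ^ 2 := fun x => by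
    rw [ContinuousLinearMap.comp_apply, ContinuousLinearMap.adjoint_inner_right,
      real_inner_self_eq_norm_sq]
  refine exists_weak_limit_of_opial hne (S := ContinuousLinearMap.adjoint R ∘L R)
    (ContinuousLinearMap.isPositive_adjoint_comp_self R).isSelfAdjoint one_pos
    (fun x => by rw [hRsq, one_mul]; exact hQ.norm_sq_le_norm_weightedMap_sq hπ hπ1 x) hfix
    (fun a ha => ?_) ?_
  · simp only [hRsq]
    obtain ⟨l, hl⟩ : ∃ l, Tendsto (fun n => ‖R (z n ω - a)‖) atTop (𝓝 l) := by
      refine exists_tendsto_of_approx fun δ hδ => ?_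
      obtain ⟨k, hk⟩ := (TopologicalSpace.denseRange_denseSeq S).exists_mem_open
        (Metric.isOpen_ball (x := (⟨a, ha⟩ : S)) (ε := δ / (‖R‖ + 1)))
        ⟨⟨a, ha⟩, Metric.mem_ball_self (by positivity)⟩
      obtain ⟨l, hl⟩ := (hω k).1
      refine ⟨fun n => ‖R (z n ω - (TopologicalSpace.denseSeq S k : K))‖,
        ⟨√l, by simpa [Real.sqrt_sq] using hl.sqrt⟩, fun n => ?_⟩
      refine (abs_norm_sub_norm_le _ _).trans ?_
      rw [← map_sub, sub_sub_sub_cancel_left]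
      refine (R.le_opNorm _).trans ?_
      rw [Metric.mem_ball, Subtype.dist_eq, dist_eq_norm, lt_div_iff₀ (by positivity)] at hk
      linarith [norm_nonneg ((TopologicalSpace.denseSeq S k : K) - a)]
    exact ⟨_, hl.pow 2⟩
  · have h0 := (hω 0).2.tendsto_atTop_zero
    rw [tendsto_zero_iff_norm_tendsto_zero]
    have h1 : Tendsto (fun n => ‖T (z n ω) - z n ω‖ ^ 2) atTop (𝓝 0) := by
      refine squeeze_zero (fun n => sq_nonneg _) (fun n => ?_)
        (by simpa only [mul_zero] using h0.const_mul (lam₀ * κ)⁻¹)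
      rw [inv_mul_eq_div, le_div_iff₀ (by positivity), mul_comm]
      exact mul_le_mul_of_nonneg_right (mul_le_mul_of_nonneg_right (hlam₀' n) hκ.le)
        (sq_nonneg _)
    simpa [Real.sqrt_sq] using h1.sqrt

end Convergence

end BlockPD

namespace BlockPD

/-! ### Conditional error bounds -/

section Errors

variable {Ω : Type*} {m0 : MeasurableSpace Ω} {P : Measure Ω} [IsProbabilityMeasure P]

/-- The measures with densities X and its conditional expectation agree on m, so they integrate
every m-measurable function equally, finite or not. -/
theorem lintegral_mul_condLExp {m : MeasurableSpace Ω} (hm : m ≤ m0) {X φ : Ω → ℝ≥0∞}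
    (hX : Measurable[m0] X) (hφ : Measurable[m] φ) :
    ∫⁻ ω, φ ω * condLExp m P X ω ∂P = ∫⁻ ω, φ ω * X ω ∂P := by
  have hc := measurable_condLExp' m P X
  have htrim : (P.withDensity (condLExp m P X)).trim hm = (P.withDensity X).trim hm := by
    refine @Measure.ext _ m _ _ fun s hs => ?_
    rw [trim_measurableSet_eq hm hs, trim_measurableSet_eq hm hs, withDensity_apply _ (hm s hs),
      withDensity_apply _ (hm s hs), setLIntegral_condLExp hm P X hs]
  have h := congrArg (fun ρ : Measure[m] Ω => ∫⁻ ω, φ ω ∂ρ) htrim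
  rw [lintegral_trim hm hφ, lintegral_trim hm hφ,
    lintegral_withDensity_eq_lintegral_mul P hc (hφ.mono hm le_rfl),
    lintegral_withDensity_eq_lintegral_mul P hX (hφ.mono hm le_rfl)] at h
  simpa only [Pi.mul_apply, mul_comm] using h

theorem ennreal_add_add_sq_le (a b c : ℝ≥0∞) :
    (a + b + c) ^ 2 ≤ 9 * (a ^ 2 + b ^ 2 + c ^ 2) := by
  set M := max (max a b) c with hM
  have h1 : a + b + c ≤ 3 * M := by
    calc a + b + c ≤ M + M + M := by
          gcongr
          · exact (le_max_left _ _).trans (le_max_left _ _)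
          · exact (le_max_right _ _).trans (le_max_left _ _)
          · exact le_max_right _ _
      _ = 3 * M := by ring
  have h2 : M ^ 2 ≤ a ^ 2 + b ^ 2 + c ^ 2 := by
    rcases max_choice (max a b) c with h | h
    · rcases max_choice a b with h' | h' <;> rw [hM, h, h']
      · rw [add_assoc]; exact le_self_add
      · rw [add_assoc, add_left_comm]; exact le_self_add
    · rw [hM, h]; exact le_add_self
  calc (a + b + c) ^ 2 ≤ (3 * M) ^ 2 := by gcongr
    _ = 9 * M ^ 2 := by ring
    _ ≤ _ := by gcongr

theorem ennreal_add_sq_add_sq_le (a b c : ℝ≥0∞) :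
    a ^ 2 + b ^ 2 + c ^ 2 ≤ (a + b + c) ^ 2 := by
  have : (a + b + c) ^ 2 = a ^ 2 + b ^ 2 + c ^ 2 + 2 * (a * b + a * c + b * c) := by ring
  rw [this]
  exact le_self_add

/-- From summable conditional standard deviations to a summable adapted bound of a combined
error. -/
theorem exists_summable_error_bound {ℱ : Filtration ℕ m0} {α β γ : ℕ → Ω → ℝ≥0∞}
    (hα : ∀ n, Measurable (α n)) (hβ : ∀ n, Measurable (β n)) (hγ : ∀ n, Measurable (γ n))
    (hαs : ∀ᵐ ω ∂P, ∑' n, (condLExp (ℱ n) P (fun ω' => α n ω' ^ 2) ω) ^ (1 / 2 : ℝ) < ∞)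
    (hβs : ∀ᵐ ω ∂P, ∑' n, (condLExp (ℱ n) P (fun ω' => β n ω' ^ 2) ω) ^ (1 / 2 : ℝ) < ∞)
    (hγs : ∀ᵐ ω ∂P, ∑' n, (condLExp (ℱ n) P (fun ω' => γ n ω' ^ 2) ω) ^ (1 / 2 : ℝ) < ∞)
    (M : ℝ) : ∃ ζ : ℕ → Ω → ℝ, (∀ n, Measurable[ℱ n] (ζ n)) ∧ (∀ n ω, 0 < ζ n ω) ∧
      (∀ᵐ ω ∂P, Summable fun n => ζ n ω) ∧
      ∀ n (θ : Ω → ℝ≥0∞), (∀ ω, θ ω ≤ ENNReal.ofReal M * (α n ω + β n ω + γ n ω)) →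
        ∀ φ : Ω → ℝ≥0∞, Measurable[ℱ n] φ →
          ∫⁻ ω, φ ω * θ ω ^ 2 ∂P ≤ ∫⁻ ω, φ ω * ENNReal.ofReal (ζ n ω ^ 2) ∂P := by
  set r : (ℕ → Ω → ℝ≥0∞) → ℕ → Ω → ℝ≥0∞ := fun δ n ω =>
    (condLExp (ℱ n) P (fun ω' => δ n ω' ^ 2) ω) ^ (1 / 2 : ℝ) with hr
  have hrm : ∀ δ n, Measurable[ℱ n] (r δ n) := fun δ n =>
    (measurable_condLExp (ℱ n) P _).pow_const _
  have hrm' : ∀ δ n, Measurable (r δ n) := fun δ n => (hrm δ n).mono (ℱ.le n) le_rfl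
  have hrint : ∀ δ : ℕ → Ω → ℝ≥0∞, (∀ n, Measurable (δ n)) → ∀ n (φ : Ω → ℝ≥0∞),
      Measurable[ℱ n] φ → ∫⁻ ω, φ ω * δ n ω ^ 2 ∂P = ∫⁻ ω, φ ω * r δ n ω ^ 2 ∂P := by
    intro δ hδ n φ hφ
    rw [← lintegral_mul_condLExp (ℱ.le n) ((hδ n).pow_const 2) hφ]
    refine lintegral_congr fun ω => ?_
    rw [hr]
    simp only
    rw [← ENNReal.rpow_natCast, ← ENNReal.rpow_mul]
    norm_num
  -- The 3 is the square root of the constant 9 in `ennreal_add_add_sq_le`.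
  set κ : ℕ → Ω → ℝ≥0∞ := fun n ω => 3 * ENNReal.ofReal M * (r α n ω + r β n ω + r γ n ω)
    with hκ
  have hκm : ∀ n, Measurable[ℱ n] (κ n) := fun n =>
    (((hrm α n).add (hrm β n)).add (hrm γ n)).const_mul _
  have hκs : ∀ᵐ ω ∂P, ∑' n, κ n ω ≠ ∞ := by
    filter_upwards [hαs, hβs, hγs] with ω h1 h2 h3
    simp only [hκ]
    rw [ENNReal.tsum_mul_left, ENNReal.tsum_add, ENNReal.tsum_add]
    exact ENNReal.mul_ne_top (ENNReal.mul_ne_top (by norm_num) ENNReal.ofReal_ne_top)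
      (ENNReal.add_ne_top.2 ⟨ENNReal.add_ne_top.2 ⟨h1.ne, h2.ne⟩, h3.ne⟩)
  -- The summable term 2⁻ⁿ makes the bound strictly positive. Passing to real values loses nothing
  -- almost surely, since κ has a finite sum.
  refine ⟨fun n ω => (κ n ω).toReal + (1 / 2) ^ n, fun n => (hκm n).ennreal_toReal.add_const _,
    fun n ω => by positivity, ?_, fun n θ hθ φ hφ => ?_⟩
  · filter_upwards [hκs] with ω hω
    exact (ENNReal.summable_toReal hω).add summable_geometric_two
  · have φm := hφ.mono (ℱ.le n) le_rfl
    have m1 := hα n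
    have m2 := hβ n
    have m3 := hγ n
    have n1 := hrm' α n
    have n2 := hrm' β n
    have n3 := hrm' γ n
    calc ∫⁻ ω, φ ω * θ ω ^ 2 ∂P
        ≤ ∫⁻ ω, (9 * ENNReal.ofReal M ^ 2) *
            (φ ω * α n ω ^ 2 + φ ω * β n ω ^ 2 + φ ω * γ n ω ^ 2) ∂P := by
          refine lintegral_mono fun ω => ?_
          calc φ ω * θ ω ^ 2
              ≤ φ ω * (ENNReal.ofReal M * (α n ω + β n ω + γ n ω)) ^ 2 := by gcongr; exact hθ ω
            _ = ENNReal.ofReal M ^ 2 * (φ ω * (α n ω + β n ω + γ n ω) ^ 2) := by ring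
            _ ≤ ENNReal.ofReal M ^ 2 *
                (φ ω * (9 * (α n ω ^ 2 + β n ω ^ 2 + γ n ω ^ 2))) := by
                  gcongr
                  exact ennreal_add_add_sq_le _ _ _
            _ = _ := by ring
      _ = ∫⁻ ω, (9 * ENNReal.ofReal M ^ 2) *
            (φ ω * r α n ω ^ 2 + φ ω * r β n ω ^ 2 + φ ω * r γ n ω ^ 2) ∂P := by
          rw [lintegral_const_mul _ (by fun_prop), lintegral_const_mul _ (by fun_prop),
            lintegral_add_left (by fun_prop), lintegral_add_left (by fun_prop),
            lintegral_add_left (by fun_prop), lintegral_add_left (by fun_prop),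
            hrint α hα n φ hφ, hrint β hβ n φ hφ, hrint γ hγ n φ hφ]
      _ ≤ ∫⁻ ω, φ ω * κ n ω ^ 2 ∂P := by
          refine lintegral_mono fun ω => ?_
          calc _ = φ ω * ((3 * ENNReal.ofReal M) ^ 2 *
                (r α n ω ^ 2 + r β n ω ^ 2 + r γ n ω ^ 2)) := by ring
            _ ≤ φ ω * ((3 * ENNReal.ofReal M) ^ 2 * (r α n ω + r β n ω + r γ n ω) ^ 2) := by
                gcongr
                exact ennreal_add_sq_add_sq_le _ _ _
            _ = _ := by rw [← mul_pow]
      _ ≤ _ := by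
          refine lintegral_mono_ae ?_
          filter_upwards [hκs] with ω hω
          have h := ENNReal.ne_top_of_tsum_ne_top hω n
          rw [ENNReal.ofReal_pow (by positivity)]
          gcongr
          rw [ENNReal.le_ofReal_iff_toReal_le h (by positivity)]
          exact le_add_of_nonneg_right (by positivity)

end Errors

end BlockPD

namespace BlockPD

/-! ### Block operators -/

/-- Change of square roots in the norm of a product. -/
theorem norm_adjoint_sqrt_comp_sq_le {E F : Type*} [NormedAddCommGroup E] [InnerProductSpace ℝ E]
    [CompleteSpace E] [NormedAddCommGroup F] [InnerProductSpace ℝ F] [CompleteSpace F]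
    (L : E →L[ℝ] F) {s S : E →L[ℝ] E} {t T : F →L[ℝ] F} (hs : IsSelfAdjoint s)
    (hS : IsSelfAdjoint S) (ht : IsSelfAdjoint t) (hT : IsSelfAdjoint T)
    (hsS : ∀ x, s (s x) = S (S x)) (htT : ∀ x, t (t x) = T (T x)) (hbij : Function.Bijective t)
    (v : F) : ‖ContinuousLinearMap.adjoint (t ∘L L ∘L s) v‖ ^ 2 ≤ ‖T ∘L L ∘L S‖ ^ 2 * ‖v‖ ^ 2 := by
  have hsqE : ∀ {a : E →L[ℝ] E} (_ : IsSelfAdjoint a) (y : E), ‖a y‖ ^ 2 = ⟪y, a (a y)⟫_ℝ :=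
    fun ha y => by
      rw [← real_inner_self_eq_norm_sq]
      exact ha.isSymmetric y _
  have hsqF : ∀ {a : F →L[ℝ] F} (_ : IsSelfAdjoint a) (y : F), ‖a y‖ ^ 2 = ⟪y, a (a y)⟫_ℝ :=
    fun ha y => by
      rw [← real_inner_self_eq_norm_sq]
      exact ha.isSymmetric y _
  -- With v = t a every norm takes the form ‖r y‖² = ⟨y, r²y⟩ for a self-adjoint root r. Only the
  -- squares matter, so s and t may be exchanged for S and T without identifying the roots.
  obtain ⟨a, rfl⟩ := hbij.2 v
  have e1 : ContinuousLinearMap.adjoint (t ∘L L ∘L s) (t a)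
      = s (ContinuousLinearMap.adjoint L (t (t a))) := by
    rw [ContinuousLinearMap.adjoint_comp, ContinuousLinearMap.adjoint_comp, hs.adjoint_eq,
      ht.adjoint_eq]
    rfl
  have e2 : S (ContinuousLinearMap.adjoint L (T (T a)))
      = ContinuousLinearMap.adjoint (T ∘L L ∘L S) (T a) := by
    rw [ContinuousLinearMap.adjoint_comp, ContinuousLinearMap.adjoint_comp, hS.adjoint_eq,
      hT.adjoint_eq]
    rfl
  rw [e1, hsqE hs, hsS, ← hsqE hS, htT, e2, hsqF ht, htT, ← hsqF hT,
    ← LinearIsometryEquiv.norm_map ContinuousLinearMap.adjoint (T ∘L L ∘L S), ← mul_pow]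
  gcongr
  exact ContinuousLinearMap.le_opNorm _ _

theorem exists_pos_forall_le {ι : Type*} [Fintype ι] {f : ι → ℝ} (hf : ∀ i, 0 < f i) :
    ∃ α > 0, ∀ i, α ≤ f i := by
  have h0 : 0 ≤ ∑ i, (f i)⁻¹ := Finset.sum_nonneg fun i _ => (inv_pos.2 (hf i)).le
  refine ⟨(1 + ∑ i, (f i)⁻¹)⁻¹, by positivity, fun i => inv_le_of_inv_le₀ (hf i) ?_⟩
  refine le_trans ?_ (le_add_of_nonneg_left zero_le_one)
  exact Finset.single_le_sum (f := fun i => (f i)⁻¹) (fun i _ => (inv_pos.2 (hf i)).le)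
    (Finset.mem_univ i)

section Diagonal

variable {p : ℕ} {H : Fin p → Type*} [∀ j, NormedAddCommGroup (H j)]
  [∀ j, InnerProductSpace ℝ (H j)]

theorem blockDiag_apply (W : (j : Fin p) → H j →L[ℝ] H j) (x : PiLp 2 H) (j : Fin p) :
    blockDiag W x j = W j (x j) := rfl

theorem blockDiag_bijective {W : (j : Fin p) → H j →L[ℝ] H j}
    (hW : ∀ j, Function.Bijective (W j)) : Function.Bijective (blockDiag W) := by
  refine ⟨fun x y hxy => PiLp.ext fun j => (hW j).1 ?_, fun y => ?_⟩
  · rw [← blockDiag_apply, hxy, blockDiag_apply]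
  · choose x hx using fun j => (hW j).2 (y j)
    exact ⟨WithLp.toLp 2 x, PiLp.ext hx⟩

/-- The product of the maps `s j ∘ C j ∘ s j`. -/
def conjMap (s : (j : Fin p) → H j →L[ℝ] H j) (C : (j : Fin p) → H j → H j) (x : PiLp 2 H) :
    PiLp 2 H :=
  WithLp.toLp 2 fun j => s j (C j (s j (x j)))

theorem conjMap_cocoercive {s : (j : Fin p) → H j →L[ℝ] H j} {C : (j : Fin p) → H j → H j}
    {μ : Fin p → ℝ} {μ₀ : ℝ} (hμ : ∀ j, IsCocoercive (μ j) fun x => s j (C j (s j x)))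
    (hμ₀ : ∀ j, μ₀ ≤ μ j) (x y : PiLp 2 H) :
    μ₀ * ‖conjMap s C x - conjMap s C y‖ ^ 2 ≤ ⟪x - y, conjMap s C x - conjMap s C y⟫_ℝ := by
  rw [PiLp.norm_sq_eq_of_L2, PiLp.inner_apply, Finset.mul_sum]
  refine Finset.sum_le_sum fun j _ => le_trans ?_ ((hμ j).2 (x j) (y j))
  exact mul_le_mul_of_nonneg_right (hμ₀ j) (sq_nonneg _)

theorem prod_firmlyNonexpansive {R : (j : Fin p) → H j → H j}
    (hR : ∀ j x y, ‖R j x - R j y‖ ^ 2 ≤ ⟪R j x - R j y, x - y⟫_ℝ) (x y : PiLp 2 H) :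
    ‖WithLp.toLp 2 (fun j => R j (x j)) - WithLp.toLp 2 (fun j => R j (y j))‖ ^ 2 ≤
      ⟪WithLp.toLp 2 (fun j => R j (x j)) - WithLp.toLp 2 (fun j => R j (y j)), x - y⟫_ℝ := by
  rw [PiLp.norm_sq_eq_of_L2, PiLp.inner_apply]
  exact Finset.sum_le_sum fun j _ => hR j (x j) (y j)

theorem norm_le_sum_norm (x : PiLp 2 H) : ‖x‖ ≤ ∑ j, ‖x j‖ := by
  refine abs_le_of_sq_le_sq' ?_ (Finset.sum_nonneg fun j _ => norm_nonneg _) |>.2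
  rw [PiLp.norm_sq_eq_of_L2]
  exact Finset.sum_sq_le_sq_sum_of_nonneg fun j _ => norm_nonneg _

variable [∀ j, CompleteSpace (H j)]

theorem isSelfAdjoint_blockDiag {W : (j : Fin p) → H j →L[ℝ] H j}
    (hW : ∀ j, IsSelfAdjoint (W j)) : IsSelfAdjoint (blockDiag W) := by
  rw [ContinuousLinearMap.isSelfAdjoint_iff_isSymmetric]
  intro x y
  change ⟪blockDiag W x, y⟫_ℝ = ⟪x, blockDiag W y⟫_ℝ
  rw [PiLp.inner_apply, PiLp.inner_apply]
  exact Finset.sum_congr rfl fun j _ => (hW j).isSymmetric (x j) (y j)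

theorem isStronglyPositive_blockDiag {W : (j : Fin p) → H j →L[ℝ] H j}
    (hW : ∀ j, IsStronglyPositive (W j)) : IsStronglyPositive (blockDiag W) := by
  choose α hα h using fun j => (hW j).2
  obtain ⟨α₀, hα₀, hle⟩ := exists_pos_forall_le hα
  refine ⟨isSelfAdjoint_blockDiag fun j => (hW j).1, α₀, hα₀, fun x => ?_⟩
  rw [PiLp.norm_sq_eq_of_L2, PiLp.inner_apply, Finset.mul_sum]
  refine Finset.sum_le_sum fun j _ => le_trans ?_ (h j (x j))
  exact mul_le_mul_of_nonneg_right (hle j) (sq_nonneg _)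

end Diagonal

section Blocks

variable {p q : ℕ} {H : Fin p → Type*} {G : Fin q → Type*}
  [∀ j, NormedAddCommGroup (H j)] [∀ j, InnerProductSpace ℝ (H j)] [∀ j, CompleteSpace (H j)]
  [∀ k, NormedAddCommGroup (G k)] [∀ k, InnerProductSpace ℝ (G k)] [∀ k, CompleteSpace (G k)]
  {L : (k : Fin q) → (j : Fin p) → H j →L[ℝ] G k}

theorem blockOp_apply (x : PiLp 2 H) (k : Fin q) : blockOp L x k = ∑ j, L k j (x j) := by
  change (∑ j, L k j ∘L PiLp.proj 2 H j) x = _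
  rw [sum_apply]
  rfl

theorem adjoint_blockOp_apply (v : PiLp 2 G) (j : Fin p) :
    ContinuousLinearMap.adjoint (blockOp L) v j
      = ∑ k, ContinuousLinearMap.adjoint (L k j) (v k) := by
  have h : blockOp (fun j k => ContinuousLinearMap.adjoint (L k j))
      = ContinuousLinearMap.adjoint (blockOp L) := by
    rw [ContinuousLinearMap.eq_adjoint_iff]
    intro v x
    simp only [PiLp.inner_apply, blockOp_apply, sum_inner, inner_sum]
    rw [Finset.sum_comm]
    exact Finset.sum_congr rfl fun k _ => Finset.sum_congr rfl fun j _ =>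
      ContinuousLinearMap.adjoint_inner_left _ _ _
  rw [← h, blockOp_apply]

theorem sum_primalIdx (k : Fin q) (y : (j : Fin p) → H j) :
    ∑ j ∈ primalIdx L k, L k j (y j) = ∑ j, L k j (y j) := by
  classical
  refine Finset.sum_subset (Finset.subset_univ _) fun j _ hj => ?_
  have : L k j = 0 := by
    by_contra h
    exact hj (by simpa [primalIdx] using h)
  rw [this, zero_apply]

theorem sum_dualIdx (j : Fin p) (y : (k : Fin q) → G k) :
    ∑ k ∈ dualIdx L j, ContinuousLinearMap.adjoint (L k j) (y k)
      = ∑ k, ContinuousLinearMap.adjoint (L k j) (y k) := by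
  classical
  refine Finset.sum_subset (Finset.subset_univ _) fun k _ hk => ?_
  have : L k j = 0 := by
    by_contra h
    exact hk (by simpa [dualIdx] using h)
  rw [this, map_zero, zero_apply]

/-- The operator `L` in the scaled variables. -/
noncomputable def scaledOp (L : (k : Fin q) → (j : Fin p) → H j →L[ℝ] G k)
    (W : (j : Fin p) → H j →L[ℝ] H j) (U : (k : Fin q) → G k →L[ℝ] G k) :
    PiLp 2 H →L[ℝ] PiLp 2 G :=
  blockDiag (fun k => opSqrt (U k)) ∘L blockOp L ∘L blockDiag fun j => opSqrt (W j)

variable {W : (j : Fin p) → H j →L[ℝ] H j} {U : (k : Fin q) → G k →L[ℝ] G k}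

theorem scaledOp_apply (x : PiLp 2 H) (k : Fin q) :
    scaledOp L W U x k = opSqrt (U k) (∑ j, L k j (opSqrt (W j) (x j))) := by
  change opSqrt (U k) (blockOp L (blockDiag (fun j => opSqrt (W j)) x) k) = _
  rw [blockOp_apply]
  rfl

theorem adjoint_scaledOp_apply (hW : ∀ j, IsStronglyPositive (W j))
    (hU : ∀ k, IsStronglyPositive (U k)) (v : PiLp 2 G) (j : Fin p) :
    ContinuousLinearMap.adjoint (scaledOp L W U) v j
      = opSqrt (W j) (∑ k, ContinuousLinearMap.adjoint (L k j) (opSqrt (U k) (v k))) := by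
  have hs := isSelfAdjoint_blockDiag fun j => (hW j).isSelfAdjoint_opSqrt
  have ht := isSelfAdjoint_blockDiag fun k => (hU k).isSelfAdjoint_opSqrt
  rw [scaledOp, ContinuousLinearMap.adjoint_comp, ContinuousLinearMap.adjoint_comp,
    hs.adjoint_eq, ht.adjoint_eq]
  change opSqrt (W j) (ContinuousLinearMap.adjoint (blockOp L)
    (blockDiag (fun k => opSqrt (U k)) v) j) = _
  rw [adjoint_blockOp_apply]
  rfl

/-- The step-size condition uses square roots of the block-diagonal operators, whereas the scaled
operator uses blockwise roots. Their squares coincide, which is all that the comparison needs. -/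
theorem norm_adjoint_scaledOp_sq_le (hW : ∀ j, IsStronglyPositive (W j))
    (hU : ∀ k, IsStronglyPositive (U k)) (v : PiLp 2 G) :
    ‖ContinuousLinearMap.adjoint (scaledOp L W U) v‖ ^ 2 ≤
      ‖opSqrt (blockDiag U) ∘L blockOp L ∘L opSqrt (blockDiag W)‖ ^ 2 * ‖v‖ ^ 2 := by
  have hW' := isStronglyPositive_blockDiag hW
  have hU' := isStronglyPositive_blockDiag hU
  refine norm_adjoint_sqrt_comp_sq_le _
    (isSelfAdjoint_blockDiag fun j => (hW j).isSelfAdjoint_opSqrt) hW'.isSelfAdjoint_opSqrt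
    (isSelfAdjoint_blockDiag fun k => (hU k).isSelfAdjoint_opSqrt) hU'.isSelfAdjoint_opSqrt
    (fun x => ?_) (fun v => ?_) (blockDiag_bijective fun k => (hU k).bijective_opSqrt) v
  · rw [hW'.opSqrt_opSqrt]
    exact PiLp.ext fun j => (hW j).opSqrt_opSqrt (x j)
  · rw [hU'.opSqrt_opSqrt]
    exact PiLp.ext fun k => (hU k).opSqrt_opSqrt (v k)

/-! ### Kuhn-Tucker pairs -/

/-- Kuhn-Tucker pairs of the coupled inclusions without nonsmooth primal terms. -/
def IsKuhnTuckerPair (C : (j : Fin p) → H j → H j) (B D : (k : Fin q) → G k → Set (G k))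
    (L : (k : Fin q) → (j : Fin p) → H j →L[ℝ] G k) (x : PiLp 2 H) (v : PiLp 2 G) : Prop :=
  (∀ j, C j (x j) + ∑ k, ContinuousLinearMap.adjoint (L k j) (v k) = 0) ∧
    ∀ k, ∑ j, L k j (x j) - asMap (inverse (D k)) (v k) ∈ inverse (B k) (v k)

variable {A : (j : Fin p) → H j → Set (H j)} {C : (j : Fin p) → H j → H j}
  {B D : (k : Fin q) → G k → Set (G k)} {x : PiLp 2 H} {v : PiLp 2 G}

theorem IsKuhnTuckerPair.mem_primalSolutions (h : IsKuhnTuckerPair C B D L x v)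
    (hA : ∀ j x, A j x = {0})
    (hD : ∀ k u, inverse (D k) u = {asMap (inverse (D k)) u}) :
    x ∈ primalSolutions A C B D L := by
  refine ⟨v, fun k => ⟨_, h.2 k, asMap (inverse (D k)) (v k), ?_, sub_add_cancel _ _⟩,
    fun j => ?_⟩
  · change _ ∈ inverse (D k) (v k)
    rw [hD]
    rfl
  · rw [hA, Set.singleton_add_singleton, Set.singleton_add_singleton, zero_add]
    exact (h.1 j).symm

theorem IsKuhnTuckerPair.mem_dualSolutions (h : IsKuhnTuckerPair C B D L x v)
    (hA : ∀ j x, A j x = {0})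
    (hD : ∀ k u, inverse (D k) u = {asMap (inverse (D k)) u}) :
    v ∈ dualSolutions A C B D L := by
  refine ⟨x, fun j => ⟨0, ?_, C j (x j), rfl, ?_⟩, fun k => ?_⟩
  · change (0 : H j) ∈ A j (x j)
    rw [hA]
    rfl
  · simp only [zero_add]
    exact eq_neg_of_add_eq_zero_left (h.1 j)
  · rw [hD]
    refine ⟨_, ⟨_, rfl, _, h.2 k, rfl⟩, _, rfl, ?_⟩
    simp only
    abel

/-- The selection from the parallel sum in a primal solution is itself the multiplier;
single-valuedness of the inverse of D identifies the second summand. -/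
theorem exists_isKuhnTuckerPair (hx : x ∈ primalSolutions A C B D L)
    (hA : ∀ j x, A j x = {0})
    (hD : ∀ k u, inverse (D k) u = {asMap (inverse (D k)) u}) :
    ∃ v, IsKuhnTuckerPair C B D L x v := by
  obtain ⟨v, hv, hx⟩ := hx
  refine ⟨v, fun j => ?_, fun k => ?_⟩
  · have := hx j
    rw [hA, Set.singleton_add_singleton, Set.singleton_add_singleton, zero_add] at this
    exact this.symm
  · obtain ⟨a, ha, b, hb, hab⟩ := hv k
    have hb' : b ∈ inverse (D k) (v k) := hb
    rw [hD, Set.mem_singleton_iff] at hb'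
    have hab' : a + b = ∑ j, L k j (x j) := hab
    rw [← hab', hb', add_sub_cancel_right]
    exact ha

/-! ### The primal-dual operator in the scaled variables and its fixed points -/

/-- The primal-dual operator of the problem in the scaled variables. -/
noncomputable def scaledStep (hB : ∀ k, IsMaximallyMonotone (B k))
    (hU : ∀ k, IsStronglyPositive (U k)) (C : (j : Fin p) → H j → H j)
    (D : (k : Fin q) → G k → Set (G k)) (L : (k : Fin q) → (j : Fin p) → H j →L[ℝ] G k)
    (W : (j : Fin p) → H j →L[ℝ] H j) :
    WithLp 2 (PiLp 2 H × PiLp 2 G) → WithLp 2 (PiLp 2 H × PiLp 2 G) :=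
  primalDualStep (conjMap (fun j => opSqrt (W j)) C)
    (conjMap (fun k => opSqrt (U k)) fun k => asMap (inverse (D k)))
    (fun g => WithLp.toLp 2 fun k => congrResolvent (hB k).inverse (hU k).isSelfAdjoint_opSqrt
      (hU k).bijective_opSqrt (g k))
    (scaledOp L W U)

variable (hB : ∀ k, IsMaximallyMonotone (B k)) (hU : ∀ k, IsStronglyPositive (U k))

theorem scaledStep_snd_apply (hW : ∀ j, IsStronglyPositive (W j))
    (z : WithLp 2 (PiLp 2 H × PiLp 2 G)) (k : Fin q) :
    (scaledStep hB hU C D L W z).snd k =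
      congrResolvent (hB k).inverse (hU k).isSelfAdjoint_opSqrt (hU k).bijective_opSqrt
        (z.snd k + opSqrt (U k) (∑ j, L k j (opSqrt (W j) (z.fst j) - W j
          (C j (opSqrt (W j) (z.fst j))
            + ∑ k', ContinuousLinearMap.adjoint (L k' j) (opSqrt (U k') (z.snd k'))))
          - asMap (inverse (D k)) (opSqrt (U k) (z.snd k)))) := by
  change congrResolvent (hB k).inverse (hU k).isSelfAdjoint_opSqrt (hU k).bijective_opSqrt (z.snd k + scaledOp L W U (z.fst
    - conjMap (fun j => opSqrt (W j)) C z.fst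
    - ContinuousLinearMap.adjoint (scaledOp L W U) z.snd) k
    - opSqrt (U k) (asMap (inverse (D k)) (opSqrt (U k) (z.snd k)))) = _
  rw [scaledOp_apply, map_sub, add_sub_assoc]
  congr 4
  refine Finset.sum_congr rfl fun j _ => ?_
  congr 1
  change opSqrt (W j) (z.fst j - opSqrt (W j) (C j (opSqrt (W j) (z.fst j)))
    - ContinuousLinearMap.adjoint (scaledOp L W U) z.snd j) = _
  rw [adjoint_scaledOp_apply hW hU, map_sub, map_sub, (hW j).opSqrt_opSqrt,
    (hW j).opSqrt_opSqrt, map_add, sub_sub]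

theorem scaledStep_fst_apply (hW : ∀ j, IsStronglyPositive (W j))
    (z : WithLp 2 (PiLp 2 H × PiLp 2 G)) (j : Fin p) :
    (scaledStep hB hU C D L W z).fst j = z.fst j - opSqrt (W j) (C j (opSqrt (W j) (z.fst j))
      + ∑ k, ContinuousLinearMap.adjoint (L k j)
          (opSqrt (U k) ((scaledStep hB hU C D L W z).snd k))) := by
  rw [map_add, ← sub_sub, ← adjoint_scaledOp_apply hW hU]
  rfl

/-- At a fixed point the primal half reads W^{1/2}(C x + L*v) = 0, so C x + L*v = 0 by injectivity.
The gradient correction inside the resolvent then vanishes, and what is left is the dual inclusion.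
-/
theorem scaledStep_eq_self_iff (hW : ∀ j, IsStronglyPositive (W j))
    (z : WithLp 2 (PiLp 2 H × PiLp 2 G)) :
    scaledStep hB hU C D L W z = z ↔ IsKuhnTuckerPair C B D L
      (blockDiag (fun j => opSqrt (W j)) z.fst) (blockDiag (fun k => opSqrt (U k)) z.snd) := by
  have hiff : scaledStep hB hU C D L W z = z ↔
      (∀ j, (scaledStep hB hU C D L W z).fst j = z.fst j) ∧
        ∀ k, (scaledStep hB hU C D L W z).snd k = z.snd k := by
    constructor
    · intro h
      simp [h]
    · intro h
      exact WithLp.ofLp_injective 2 (Prod.ext (PiLp.ext h.1) (PiLp.ext h.2))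
  rw [hiff]
  have key : (∀ j, C j (opSqrt (W j) (z.fst j))
        + ∑ k, ContinuousLinearMap.adjoint (L k j) (opSqrt (U k) (z.snd k)) = 0) →
      ∀ k, (scaledStep hB hU C D L W z).snd k = z.snd k ↔
        ∑ j, L k j (opSqrt (W j) (z.fst j)) - asMap (inverse (D k)) (opSqrt (U k) (z.snd k))
          ∈ inverse (B k) (opSqrt (U k) (z.snd k)) := by
    intro h k
    rw [scaledStep_snd_apply hB hU hW, congrResolvent_eq_iff]
    simp only [h, map_zero, sub_zero]
    constructor
    · rintro ⟨a, ha, h'⟩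
      rwa [← (hU k).bijective_opSqrt.1 (add_left_cancel h')]
    · exact fun h' => ⟨_, h', rfl⟩
  constructor
  · rintro ⟨h1, h2⟩
    have h3 : ∀ j, C j (opSqrt (W j) (z.fst j))
        + ∑ k, ContinuousLinearMap.adjoint (L k j) (opSqrt (U k) (z.snd k)) = 0 := by
      intro j
      have := h1 j
      rw [scaledStep_fst_apply hB hU hW, sub_eq_self] at this
      simp only [h2] at this
      exact (hW j).bijective_opSqrt.1 (this.trans (map_zero _).symm)
    exact ⟨h3, fun k => (key h3 k).1 (h2 k)⟩
  · rintro ⟨h1, h2⟩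
    have h3 := fun k => (key h1 k).2 (h2 k)
    refine ⟨fun j => ?_, h3⟩
    rw [scaledStep_fst_apply hB hU hW]
    simp only [h3]
    have := h1 j
    simp only [blockDiag_apply] at this
    rw [this, map_zero, sub_zero]

theorem scaledStep_averaged (hW : ∀ j, IsStronglyPositive (W j)) {μ : Fin p → ℝ} {ν : Fin q → ℝ}
    (hμ : ∀ j, IsCocoercive (μ j) fun x => opSqrt (W j) (C j (opSqrt (W j) x)))
    (hν : ∀ k, IsCocoercive (ν k) fun v =>
      opSqrt (U k) (asMap (inverse (D k)) (opSqrt (U k) v)))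
    (hq : 0 < q)
    (hstep : 1 / 2 < min (⨅ j, μ j)
      ((⨅ k, ν k) * (1 - ‖opSqrt (blockDiag U) ∘L blockOp L ∘L opSqrt (blockDiag W)‖ ^ 2))) :
    ∃ κ > 0, ∀ z z', ‖scaledStep hB hU C D L W z - scaledStep hB hU C D L W z'‖ ^ 2
      + κ * ‖scaledStep hB hU C D L W z - z - (scaledStep hB hU C D L W z' - z')‖ ^ 2
        ≤ ‖z - z'‖ ^ 2 := by
  have : Nonempty (Fin q) := ⟨⟨0, hq⟩⟩
  have hν0 : 0 < ⨅ k, ν k := by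
    obtain ⟨k, hk⟩ := exists_eq_ciInf_of_finite (f := ν)
    rw [← hk]
    exact (hν k).1
  exact primalDualStep_averaged (lt_min_iff.1 hstep).1 hν0 (lt_min_iff.1 hstep).2
    (norm_adjoint_scaledOp_sq_le hW hU)
    (conjMap_cocoercive hμ fun j => ciInf_le (Set.finite_range μ).bddBelow j)
    (conjMap_cocoercive hν fun k => ciInf_le (Set.finite_range ν).bddBelow k)
    (prod_firmlyNonexpansive fun k => congrResolvent_firmlyNonexpansive _ _ _)

end Blocks

end BlockPD

namespace BlockPD

/-! ### Coordinate projections of the primal-dual space -/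

section Coordinates

variable {p q : ℕ} {H : Fin p → Type*} {G : Fin q → Type*}
  [∀ j, NormedAddCommGroup (H j)] [∀ j, InnerProductSpace ℝ (H j)]
  [∀ k, NormedAddCommGroup (G k)] [∀ k, InnerProductSpace ℝ (G k)]

/-- The projections of the primal-dual space onto its blocks. -/
noncomputable def coordProj : Fin p ⊕ Fin q →
    WithLp 2 (PiLp 2 H × PiLp 2 G) →L[ℝ] WithLp 2 (PiLp 2 H × PiLp 2 G)
  | .inl j => ((WithLp.prodContinuousLinearEquiv 2 ℝ (PiLp 2 H) (PiLp 2 G)).symm :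
      PiLp 2 H × PiLp 2 G →L[ℝ] _) ∘L ((blockDiag fun j' => if j' = j then 1 else 0).prodMap 0) ∘L
      (WithLp.prodContinuousLinearEquiv 2 ℝ (PiLp 2 H) (PiLp 2 G) : _ →L[ℝ] PiLp 2 H × PiLp 2 G)
  | .inr k => ((WithLp.prodContinuousLinearEquiv 2 ℝ (PiLp 2 H) (PiLp 2 G)).symm :
      PiLp 2 H × PiLp 2 G →L[ℝ] _) ∘L (ContinuousLinearMap.prodMap 0
        (blockDiag fun k' => if k' = k then 1 else 0)) ∘L
      (WithLp.prodContinuousLinearEquiv 2 ℝ (PiLp 2 H) (PiLp 2 G) : _ →L[ℝ] PiLp 2 H × PiLp 2 G)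

theorem primalDual_ext {z z' : WithLp 2 (PiLp 2 H × PiLp 2 G)}
    (h1 : ∀ j, z.fst j = z'.fst j) (h2 : ∀ k, z.snd k = z'.snd k) : z = z' :=
  WithLp.ofLp_injective 2 (Prod.ext (PiLp.ext h1) (PiLp.ext h2))

theorem coordProj_fst_apply (i : Fin p ⊕ Fin q) (z : WithLp 2 (PiLp 2 H × PiLp 2 G))
    (j : Fin p) : (coordProj i z).fst j = if i = .inl j then z.fst j else 0 := by
  rcases i with j' | k
  · change (if j = j' then 1 else 0 : H j →L[ℝ] H j) (z.fst j) = _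
    by_cases h : j = j'
    · simp [h]
    · simp [h, Ne.symm h]
  · rfl

theorem coordProj_snd_apply (i : Fin p ⊕ Fin q) (z : WithLp 2 (PiLp 2 H × PiLp 2 G))
    (k : Fin q) : (coordProj i z).snd k = if i = .inr k then z.snd k else 0 := by
  rcases i with j | k'
  · rfl
  · change (if k = k' then 1 else 0 : G k →L[ℝ] G k) (z.snd k) = _
    by_cases h : k = k'
    · simp [h]
    · simp [h, Ne.symm h]

theorem sum_smul_coordProj_fst (a : Fin p ⊕ Fin q → ℝ) (z : WithLp 2 (PiLp 2 H × PiLp 2 G))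
    (j : Fin p) : (∑ i, a i • coordProj i z).fst j = a (.inl j) • z.fst j := by
  change (PiLp.proj 2 H j ∘L WithLp.fstL 2 ℝ (PiLp 2 H) (PiLp 2 G)) _ = _
  rw [map_sum]
  simp only [map_smul]
  change ∑ i, a i • (coordProj i z).fst j = _
  simp [coordProj_fst_apply]

theorem sum_smul_coordProj_snd (a : Fin p ⊕ Fin q → ℝ) (z : WithLp 2 (PiLp 2 H × PiLp 2 G))
    (k : Fin q) : (∑ i, a i • coordProj i z).snd k = a (.inr k) • z.snd k := by
  change (PiLp.proj 2 G k ∘L WithLp.sndL 2 ℝ (PiLp 2 H) (PiLp 2 G)) _ = _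
  rw [map_sum]
  simp only [map_smul]
  change ∑ i, a i • (coordProj i z).snd k = _
  simp [coordProj_snd_apply]

theorem isOrthogonalResolution_coordProj [∀ j, CompleteSpace (H j)] [∀ k, CompleteSpace (G k)] :
    IsOrthogonalResolution (coordProj (H := H) (G := G)) where
  isSelfAdjoint i := by
    rw [ContinuousLinearMap.isSelfAdjoint_iff_isSymmetric]
    intro x y
    change ⟪coordProj i x, y⟫_ℝ = ⟪x, coordProj i y⟫_ℝ
    have h : ∀ u v : WithLp 2 (PiLp 2 H × PiLp 2 G),
        ⟪u, v⟫_ℝ = ∑ j, ⟪u.fst j, v.fst j⟫_ℝ + ∑ k, ⟪u.snd k, v.snd k⟫_ℝ := fun u v => by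
      rw [WithLp.prod_inner_apply, PiLp.inner_apply, PiLp.inner_apply]
      rfl
    rw [h, h]
    congr 1 <;> refine Finset.sum_congr rfl fun j _ => ?_
    · rw [coordProj_fst_apply, coordProj_fst_apply]
      split_ifs <;> simp
    · rw [coordProj_snd_apply, coordProj_snd_apply]
      split_ifs <;> simp
  idempotent i x := by
    refine primalDual_ext (fun j => ?_) fun k => ?_
    · simp only [coordProj_fst_apply]
      split_ifs <;> rfl
    · simp only [coordProj_snd_apply]
      split_ifs <;> rfl
  orthogonal i i' hi x := by
    refine primalDual_ext (fun j => ?_) fun k => ?_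
    · simp only [coordProj_fst_apply]
      split_ifs with h h'
      · exact absurd (h.trans h'.symm) hi
      all_goals rfl
    · simp only [coordProj_snd_apply]
      split_ifs with h h'
      · exact absurd (h.trans h'.symm) hi
      all_goals rfl
  sum_apply x := by
    refine primalDual_ext (fun j => ?_) fun k => ?_
    · simpa using sum_smul_coordProj_fst (fun _ => 1) x j
    · simpa using sum_smul_coordProj_snd (fun _ => 1) x k

end Coordinates

/-! ### Weak convergence, continuity and measurability -/

section Auxiliary

variable {E : Type*} [NormedAddCommGroup E] [InnerProductSpace ℝ E]

theorem tendsto_toWeakSpace_of_inner [CompleteSpace E] {x : ℕ → E} {a : E}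
    (h : ∀ y, Tendsto (fun n => ⟪x n, y⟫_ℝ) atTop (𝓝 ⟪a, y⟫_ℝ)) :
    Tendsto (fun n => toWeakSpace ℝ E (x n)) atTop (𝓝 (toWeakSpace ℝ E a)) := by
  refine (WeakBilin.tendsto_iff_forall_eval_tendsto (topDualPairing ℝ E).flip
    (fun x y hxy => ?_)).2 fun f => ?_
  · refine ext_inner_right ℝ fun y => ?_
    have := LinearMap.congr_fun hxy (InnerProductSpace.toDual ℝ E y)
    rw [real_inner_comm, real_inner_comm y]
    exact this
  · have hf : ∀ y, f y = ⟪y, (InnerProductSpace.toDual ℝ E).symm f⟫_ℝ := fun y => by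
      rw [real_inner_comm, InnerProductSpace.toDual_symm_apply]
    change Tendsto (fun n => f (x n)) atTop (𝓝 (f a))
    simp only [hf]
    exact h _

theorem IsCocoercive.continuous {T : E → E} {β : ℝ} (hT : IsCocoercive β T) : Continuous T := by
  refine (LipschitzWith.of_dist_le_mul (K := ⟨β⁻¹, (inv_pos.2 hT.1).le⟩) fun x y => ?_).continuous
  rw [dist_eq_norm, dist_eq_norm]
  change _ ≤ β⁻¹ * _
  rw [inv_mul_eq_div, le_div_iff₀ hT.1, mul_comm]
  have h := (hT.2 x y).trans (real_inner_le_norm _ _)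
  rcases (norm_nonneg (T x - T y)).eq_or_lt with h0 | h0
  · rw [← h0, mul_zero]
    exact norm_nonneg _
  · exact le_of_mul_le_mul_right (by linarith) h0

theorem norm_congrResolvent_sub_le [CompleteSpace E] {A : E → Set E}
    (hA : IsMaximallyMonotone A) {t : E →L[ℝ] E} (ht : IsSelfAdjoint t)
    (hbij : Function.Bijective t) (g g' : E) :
    ‖congrResolvent hA ht hbij g - congrResolvent hA ht hbij g'‖ ≤ ‖g - g'‖ := by
  have h := (congrResolvent_firmlyNonexpansive hA ht hbij g g').trans (real_inner_le_norm _ _)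
  rcases (norm_nonneg (congrResolvent hA ht hbij g - congrResolvent hA ht hbij g')).eq_or_lt
    with h0 | h0
  · rw [← h0]
    exact norm_nonneg _
  · rw [sq] at h
    exact le_of_mul_le_mul_left h h0

variable [CompleteSpace E] {W : E →L[ℝ] E}

/-- The square root of a strongly positive operator, as an isomorphism. -/
noncomputable def IsStronglyPositive.sqrtEquiv (hW : IsStronglyPositive W) : E ≃L[ℝ] E :=
  ContinuousLinearEquiv.ofBijective (opSqrt W) (LinearMap.ker_eq_bot.2 hW.bijective_opSqrt.1)
    (LinearMap.range_eq_top.2 hW.bijective_opSqrt.2)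

theorem IsStronglyPositive.sqrtEquiv_apply (hW : IsStronglyPositive W) (x : E) :
    hW.sqrtEquiv x = opSqrt W x := rfl

theorem IsStronglyPositive.opSqrt_sqrtEquiv_symm (hW : IsStronglyPositive W) (x : E) :
    opSqrt W (hW.sqrtEquiv.symm x) = x := hW.sqrtEquiv.apply_symm_apply x

theorem IsStronglyPositive.sqrtEquiv_symm_opSqrt (hW : IsStronglyPositive W) (x : E) :
    hW.sqrtEquiv.symm (opSqrt W x) = x := hW.sqrtEquiv.symm_apply_apply x

/-- Continuity of the conjugated map passes to T by undoing the conjugation with the inverse square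
root. -/
theorem IsStronglyPositive.continuous_of_conj (hW : IsStronglyPositive W) {T : E → E} {β : ℝ}
    (hT : IsCocoercive β fun x => opSqrt W (T (opSqrt W x))) : Continuous T := by
  have h : T = fun x => hW.sqrtEquiv.symm
      (opSqrt W (T (opSqrt W (hW.sqrtEquiv.symm x)))) := by
    funext x
    rw [hW.sqrtEquiv_symm_opSqrt, hW.opSqrt_sqrtEquiv_symm]
  rw [h]
  exact hW.sqrtEquiv.symm.continuous.comp (hT.continuous.comp hW.sqrtEquiv.symm.continuous)

theorem IsStronglyPositive.J_precond_eq (hW : IsStronglyPositive W) {A : E → Set E}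
    (hA : IsMaximallyMonotone A) (g : E) : J (precond W A) g = opSqrt W
      (congrResolvent hA hW.isSelfAdjoint_opSqrt hW.bijective_opSqrt (hW.sqrtEquiv.symm g)) := by
  rw [← J_precond hA _ _ hW.opSqrt_comp_opSqrt, hW.opSqrt_sqrtEquiv_symm]

theorem IsStronglyPositive.continuous_J_precond (hW : IsStronglyPositive W) {A : E → Set E}
    (hA : IsMaximallyMonotone A) : Continuous (J (precond W A)) := by
  rw [funext (hW.J_precond_eq hA)]
  have h : Continuous (congrResolvent hA hW.isSelfAdjoint_opSqrt hW.bijective_opSqrt) :=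
    (LipschitzWith.of_dist_le_mul (K := 1) fun x y => by
      simpa [dist_eq_norm] using norm_congrResolvent_sub_le hA _ _ x y).continuous
  exact (opSqrt W).continuous.comp (h.comp hW.sqrtEquiv.symm.continuous)

end Auxiliary

end BlockPD

namespace BlockPD

/-! ### Errors of the iterations in the scaled variables -/

section Errors

variable {p q : ℕ} {H : Fin p → Type*} {G : Fin q → Type*}
  [∀ j, NormedAddCommGroup (H j)] [∀ j, InnerProductSpace ℝ (H j)] [∀ j, CompleteSpace (H j)]
  [∀ k, NormedAddCommGroup (G k)] [∀ k, InnerProductSpace ℝ (G k)] [∀ k, CompleteSpace (G k)]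
  {C : (j : Fin p) → H j → H j} {B D : (k : Fin q) → G k → Set (G k)}
  {L : (k : Fin q) → (j : Fin p) → H j →L[ℝ] G k}
  {W : (j : Fin p) → H j →L[ℝ] H j} {U : (k : Fin q) → G k →L[ℝ] G k}
  (hB : ∀ k, IsMaximallyMonotone (B k)) (hU : ∀ k, IsStronglyPositive (U k))

/-- The errors c and d sit inside the nonexpansive resolvent and b outside it, so bounded linear
factors suffice. Only the w_j with j in 𝕃_k matter, and these are computed whenever k is active. -/
theorem norm_sub_scaledStep_snd_le (hW : ∀ j, IsStronglyPositive (W j)) (k : Fin q) : ∃ M : ℝ, 0 ≤ M ∧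
    ∀ (z : WithLp 2 (PiLp 2 H × PiLp 2 G)) (x w c : PiLp 2 H) (v b d : PiLp 2 G),
      (∀ j, x j = opSqrt (W j) (z.fst j)) → (∀ k, v k = opSqrt (U k) (z.snd k)) →
      (∀ j ∈ primalIdx L k, w j = x j - W j (C j (x j) + c j)) →
      ‖(hU k).sqrtEquiv.symm (J (precond (U k) (inverse (B k)))
          (v k + U k (∑ j ∈ primalIdx L k, L k j (w j -
              W j (∑ k' ∈ dualIdx L j, ContinuousLinearMap.adjoint (L k' j) (v k')))
            - asMap (inverse (D k)) (v k) + d k)) + b k)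
        - (scaledStep hB hU C D L W z).snd k‖ ≤ M * (‖b‖ + ‖c‖ + ‖d‖) := by
  refine ⟨‖((hU k).sqrtEquiv.symm : G k →L[ℝ] G k)‖ + ‖opSqrt (U k)‖ *
    (1 + ∑ j, ‖L k j ∘L W j‖), by positivity, fun z x w c v b d hx hv hw => ?_⟩
  set t := opSqrt (U k) with ht
  set N := ‖((hU k).sqrtEquiv.symm : G k →L[ℝ] G k)‖ with hN
  set Λ := ∑ j, ‖L k j ∘L W j‖ with hΛ
  have hsum : ∑ j ∈ primalIdx L k, L k j (w j -
      W j (∑ k' ∈ dualIdx L j, ContinuousLinearMap.adjoint (L k' j) (v k')))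
      = ∑ j, L k j (opSqrt (W j) (z.fst j) - W j (C j (opSqrt (W j) (z.fst j))
          + ∑ k', ContinuousLinearMap.adjoint (L k' j) (opSqrt (U k') (z.snd k'))))
        - ∑ j, (L k j ∘L W j) (c j) := by
    simp only [ContinuousLinearMap.comp_apply]
    rw [← sum_primalIdx, ← sum_primalIdx (L := L) k fun j => W j (c j),
      ← Finset.sum_sub_distrib]
    refine Finset.sum_congr rfl fun j hj => ?_
    rw [hw j hj, sum_dualIdx, hx]
    simp only [hv, map_add, map_sub]
    abel
  rw [scaledStep_snd_apply hB hU hW, (hU k).J_precond_eq (hB k).inverse, map_add,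
    (hU k).sqrtEquiv_symm_opSqrt, hsum, hv k, map_add,
    (hU k).sqrtEquiv_symm_opSqrt, ← (hU k).opSqrt_opSqrt, (hU k).sqrtEquiv_symm_opSqrt,
    add_sub_right_comm]
  set S := ∑ j, L k j (opSqrt (W j) (z.fst j) - W j (C j (opSqrt (W j) (z.fst j))
          + ∑ k', ContinuousLinearMap.adjoint (L k' j) (opSqrt (U k') (z.snd k'))))
  have h1 := norm_congrResolvent_sub_le (hB k).inverse (hU k).isSelfAdjoint_opSqrt
    (hU k).bijective_opSqrt
    (z.snd k + t (S - ∑ j, (L k j ∘L W j) (c j) - asMap (inverse (D k)) (t (z.snd k)) + d k))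
    (z.snd k + t (S - asMap (inverse (D k)) (t (z.snd k))))
  rw [add_sub_add_left_eq_sub, ← map_sub, show S - ∑ j, (L k j ∘L W j) (c j)
      - asMap (inverse (D k)) (t (z.snd k)) + d k - (S - asMap (inverse (D k)) (t (z.snd k)))
      = d k - ∑ j, (L k j ∘L W j) (c j) by abel] at h1
  have h2 : ‖∑ j, (L k j ∘L W j) (c j)‖ ≤ Λ * ‖c‖ := by
    rw [hΛ, Finset.sum_mul]
    refine norm_sum_le_of_le _ fun j _ => ((L k j ∘L W j).le_opNorm _).trans ?_
    gcongr
    exact PiLp.norm_apply_le c j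
  have h3 : ‖t (d k - ∑ j, (L k j ∘L W j) (c j))‖ ≤ ‖t‖ * (‖d‖ + Λ * ‖c‖) :=
    (t.le_opNorm _).trans (by
      gcongr
      exact (norm_sub_le _ _).trans (add_le_add (PiLp.norm_apply_le d k) h2))
  have h4 : ‖(hU k).sqrtEquiv.symm (b k)‖ ≤ N * ‖b‖ :=
    (((hU k).sqrtEquiv.symm : G k →L[ℝ] G k).le_opNorm _).trans (by
      gcongr
      exact PiLp.norm_apply_le b k)
  refine (norm_add_le _ _).trans ((add_le_add (h1.trans h3) h4).trans ?_)
  have hΛ0 : 0 ≤ Λ := Finset.sum_nonneg fun j _ => norm_nonneg _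
  have hN0 : 0 ≤ N := norm_nonneg _
  have e1 : 0 ≤ N * (‖c‖ + ‖d‖) := by positivity
  have e2 : 0 ≤ ‖t‖ * (‖b‖ + ‖c‖ + Λ * (‖b‖ + ‖d‖)) := by positivity
  linarith

variable (hW : ∀ j, IsStronglyPositive (W j))

/-- With no primal resolvent the primal error is exactly linear in c and in the dual errors f. -/
theorem sub_scaledStep_fst_eq (j : Fin p) (z : WithLp 2 (PiLp 2 H × PiLp 2 G))
    {x w c : PiLp 2 H} {u f : PiLp 2 G} (hx : x j = opSqrt (W j) (z.fst j))
    (hw : w j = x j - W j (C j (x j) + c j))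
    (hu : ∀ k ∈ dualIdx L j,
      u k = opSqrt (U k) ((scaledStep hB hU C D L W z).snd k + f k)) :
    (hW j).sqrtEquiv.symm
        (w j - W j (∑ k ∈ dualIdx L j, ContinuousLinearMap.adjoint (L k j) (u k)))
      - (scaledStep hB hU C D L W z).fst j
      = -opSqrt (W j) (c j
          + ∑ k, (ContinuousLinearMap.adjoint (L k j) ∘L opSqrt (U k)) (f k)) := by
  have hsum : ∑ k ∈ dualIdx L j, ContinuousLinearMap.adjoint (L k j) (u k)
      = ∑ k, ContinuousLinearMap.adjoint (L k j)
          (opSqrt (U k) ((scaledStep hB hU C D L W z).snd k))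
        + ∑ k, (ContinuousLinearMap.adjoint (L k j) ∘L opSqrt (U k)) (f k) := by
    rw [← Finset.sum_add_distrib, Finset.sum_congr rfl fun k hk => by rw [hu k hk],
      sum_dualIdx j fun k => opSqrt (U k) ((scaledStep hB hU C D L W z).snd k + f k)]
    simp
  rw [hsum, hw, hx, scaledStep_fst_apply hB hU hW, ← (hW j).opSqrt_opSqrt,
    ← (hW j).opSqrt_opSqrt]
  simp only [map_sub, map_add, (hW j).sqrtEquiv_symm_opSqrt]
  abel

theorem norm_opSqrt_add_sum_le (j : Fin p) (c : PiLp 2 H) {f : PiLp 2 G} {M : Fin q → ℝ} {r : ℝ}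
    (hr : ‖c‖ ≤ r) (hf : ∀ k, ‖f k‖ ≤ M k * r) :
    ‖opSqrt (W j) (c j + ∑ k, (ContinuousLinearMap.adjoint (L k j) ∘L opSqrt (U k)) (f k))‖
      ≤ ‖opSqrt (W j)‖ *
        (1 + ∑ k, ‖ContinuousLinearMap.adjoint (L k j) ∘L opSqrt (U k)‖ * M k) * r := by
  rw [mul_assoc, add_mul, one_mul, Finset.sum_mul]
  refine (ContinuousLinearMap.le_opNorm _ _).trans ?_
  gcongr
  refine (norm_add_le _ _).trans (add_le_add ((PiLp.norm_apply_le c j).trans hr) ?_)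
  refine norm_sum_le_of_le _ fun k _ => (ContinuousLinearMap.le_opNorm _ _).trans ?_
  rw [mul_assoc]
  gcongr
  exact hf k

theorem norm_le_sum_fst_add_sum_snd (e : WithLp 2 (PiLp 2 H × PiLp 2 G)) :
    ‖e‖ ≤ ∑ j, ‖e.fst j‖ + ∑ k, ‖e.snd k‖ := by
  refine le_trans ?_ (add_le_add (norm_le_sum_norm e.fst) (norm_le_sum_norm e.snd))
  refine abs_le_of_sq_le_sq' ?_ (by positivity) |>.2
  rw [WithLp.prod_norm_sq_eq_of_L2]
  nlinarith [norm_nonneg e.fst, norm_nonneg e.snd]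

/-- The error of one iteration in the scaled variables; `α` is the activation variable. -/
noncomputable def scaledError (α : Fin p ⊕ Fin q → Bool) (w : PiLp 2 H) (u : PiLp 2 G)
    (C : (j : Fin p) → H j → H j) (D : (k : Fin q) → G k → Set (G k))
    (L : (k : Fin q) → (j : Fin p) → H j →L[ℝ] G k)
    (z : WithLp 2 (PiLp 2 H × PiLp 2 G)) : WithLp 2 (PiLp 2 H × PiLp 2 G) :=
  WithLp.toLp 2 (WithLp.toLp 2 fun j => bit (α (.inl j)) • ((hW j).sqrtEquiv.symm
        (w j - W j (∑ k ∈ dualIdx L j, ContinuousLinearMap.adjoint (L k j) (u k)))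
      - (scaledStep hB hU C D L W z).fst j),
    WithLp.toLp 2 fun k => bit (α (.inr k)) • ((hU k).sqrtEquiv.symm (u k)
      - (scaledStep hB hU C D L W z).snd k))

/-- On inactive coordinates the computed values may be far from T, but the activation bit sets the
error to zero there. On active ones the activation condition guarantees that all quantities read are
fresh, and M depends on neither the activation nor the iterate. -/
theorem exists_norm_scaledError_le (hL : ∀ j, (dualIdx L j).Nonempty) : ∃ M : ℝ,
    ∀ (α : Fin p ⊕ Fin q → Bool) (z : WithLp 2 (PiLp 2 H × PiLp 2 G))
      (x w c : PiLp 2 H) (v u b d : PiLp 2 G),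
      (∀ j, x j = opSqrt (W j) (z.fst j)) → (∀ k, v k = opSqrt (U k) (z.snd k)) →
      (∀ j, w j = bit ((dualIdx L j).sup fun k => α (.inr k)) • (x j - W j (C j (x j) + c j))) →
      (∀ k, u k = bit (α (.inr k)) • (J (precond (U k) (inverse (B k)))
          (v k + U k (∑ j ∈ primalIdx L k, L k j (w j -
              W j (∑ k' ∈ dualIdx L j, ContinuousLinearMap.adjoint (L k' j) (v k')))
            - asMap (inverse (D k)) (v k) + d k)) + b k)) →
      (∀ k, ∀ j ∈ primalIdx L k, α (.inl j) = true → α (.inr k) = true) →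
      ‖scaledError hB hU hW α w u C D L z‖ ≤ M * (‖b‖ + ‖c‖ + ‖d‖) := by
  choose M hM0 hM using norm_sub_scaledStep_snd_le (C := C) (D := D) (L := L) hB hU hW
  refine ⟨∑ j, ‖opSqrt (W j)‖ *
      (1 + ∑ k, ‖ContinuousLinearMap.adjoint (L k j) ∘L opSqrt (U k)‖ * M k) + ∑ k, M k,
    fun α z x w c v u b d hx hv hw hu hα => ?_⟩
  set r := ‖b‖ + ‖c‖ + ‖d‖ with hr
  have hr0 : 0 ≤ r := by positivity
  have hcr : ‖c‖ ≤ r := by rw [hr]; linarith [norm_nonneg b, norm_nonneg d]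
  set e := scaledError hB hU hW α w u C D L z with he
  have hmem : ∀ k j, j ∈ primalIdx L k ↔ k ∈ dualIdx L j := fun k j => by
    simp [primalIdx, dualIdx]
  have hw' : ∀ k j, j ∈ primalIdx L k → α (.inr k) = true →
      w j = x j - W j (C j (x j) + c j) := fun k j hj hk => by
    have : ((dualIdx L j).sup fun k => α (.inr k)) = true :=
      top_le_iff.1 (hk.ge.trans
        (Finset.le_sup (f := fun k => α (.inr k)) ((hmem k j).1 hj)))
    rw [hw, this, bit_true, one_smul]
  have hsnd : ∀ k, e.snd k = bit (α (.inr k)) • ((hU k).sqrtEquiv.symm (u k)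
      - (scaledStep hB hU C D L W z).snd k) := fun k => rfl
  have hfst : ∀ j, e.fst j = bit (α (.inl j)) • ((hW j).sqrtEquiv.symm
        (w j - W j (∑ k ∈ dualIdx L j, ContinuousLinearMap.adjoint (L k j) (u k)))
      - (scaledStep hB hU C D L W z).fst j) := fun j => rfl
  have h2 : ∀ k, ‖e.snd k‖ ≤ M k * r := fun k => by
    rw [hsnd]
    cases hk : α (.inr k) with
    | false =>
      rw [bit_false, zero_smul, norm_zero]
      exact mul_nonneg (hM0 k) hr0
    | true =>
      rw [hu k, hk, bit_true, one_smul, one_smul]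
      exact hM k z x w c v b d hx hv fun j hj => hw' k j hj hk
  have h1 : ∀ j, ‖e.fst j‖ ≤ ‖opSqrt (W j)‖ *
      (1 + ∑ k, ‖ContinuousLinearMap.adjoint (L k j) ∘L opSqrt (U k)‖ * M k) * r := fun j => by
    refine le_trans ?_ (norm_opSqrt_add_sum_le (f := e.snd) j c hcr h2)
    rw [hfst]
    cases hj : α (.inl j) with
    | false =>
      rw [bit_false, zero_smul, norm_zero]
      exact norm_nonneg _
    | true =>
      have hk : ∀ k ∈ dualIdx L j, α (.inr k) = true := fun k hk =>
        hα k j ((hmem k j).2 hk) hj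
      obtain ⟨k₀, hk₀⟩ := hL j
      rw [bit_true, one_smul, sub_scaledStep_fst_eq hB hU hW (f := e.snd) j z (hx j)
        (hw' k₀ j ((hmem k₀ j).2 hk₀) (hk k₀ hk₀)) fun k hk' => ?_, norm_neg]
      rw [hsnd, hk k hk', bit_true, one_smul, add_sub_cancel, (hU k).opSqrt_sqrtEquiv_symm]
  refine (norm_le_sum_fst_add_sum_snd e).trans ?_
  rw [add_mul, Finset.sum_mul, Finset.sum_mul]
  exact add_le_add (Finset.sum_le_sum fun j _ => h1 j) (Finset.sum_le_sum fun k _ => h2 k)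

/-- One iteration in the scaled variables. -/
theorem eq_add_sum_coordProj (α : Fin p ⊕ Fin q → Bool) {lam : ℝ}
    {z z' : WithLp 2 (PiLp 2 H × PiLp 2 G)} {x x' w : PiLp 2 H} {v v' u : PiLp 2 G}
    (hx : ∀ j, x j = opSqrt (W j) (z.fst j)) (hx' : ∀ j, x' j = opSqrt (W j) (z'.fst j))
    (hv : ∀ k, v k = opSqrt (U k) (z.snd k)) (hv' : ∀ k, v' k = opSqrt (U k) (z'.snd k))
    (hxx : ∀ j, x' j = x j + (lam * bit (α (.inl j))) •
      (w j - W j (∑ k ∈ dualIdx L j, ContinuousLinearMap.adjoint (L k j) (u k)) - x j))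
    (hvv : ∀ k, v' k = v k + (lam * bit (α (.inr k))) • (u k - v k)) :
    z' = z + ∑ i, (lam * bit (α i)) • coordProj i
      (scaledStep hB hU C D L W z - z + scaledError hB hU hW α w u C D L z) := by
  refine primalDual_ext (fun j => ?_) fun k => ?_
  · rw [WithLp.add_fst, PiLp.add_apply,
      sum_smul_coordProj_fst (fun i => lam * bit (α i))]
    refine (hW j).sqrtEquiv.injective ?_
    have h : (scaledStep hB hU C D L W z - z + scaledError hB hU hW α w u C D L z).fst j
        = (scaledStep hB hU C D L W z).fst j - z.fst j + bit (α (.inl j)) •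
          ((hW j).sqrtEquiv.symm
            (w j - W j (∑ k ∈ dualIdx L j, ContinuousLinearMap.adjoint (L k j) (u k)))
          - (scaledStep hB hU C D L W z).fst j) := rfl
    rw [(hW j).sqrtEquiv_apply, ← hx', hxx, hx, h]
    cases α (.inl j) <;> simp [bit, (hW j).sqrtEquiv_apply, (hW j).opSqrt_sqrtEquiv_symm]
  · rw [WithLp.add_snd, PiLp.add_apply,
      sum_smul_coordProj_snd (fun i => lam * bit (α i))]
    refine (hU k).sqrtEquiv.injective ?_
    have h : (scaledStep hB hU C D L W z - z + scaledError hB hU hW α w u C D L z).snd k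
        = (scaledStep hB hU C D L W z).snd k - z.snd k + bit (α (.inr k)) •
          ((hU k).sqrtEquiv.symm (u k) - (scaledStep hB hU C D L W z).snd k) := rfl
    rw [(hU k).sqrtEquiv_apply, ← hv', hvv, hv, h]
    cases α (.inr k) <;> simp [bit, (hU k).sqrtEquiv_apply, (hU k).opSqrt_sqrtEquiv_symm]

end Errors

end BlockPD

namespace BlockPD

/-! ### Measurability of the iterates -/

section Measurability

theorem measurable_piLp {n : ℕ} {V : Fin n → Type*} [∀ j, NormedAddCommGroup (V j)]
    [∀ j, MeasurableSpace (V j)] {Ω : Type*} [MeasurableSpace Ω]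
    {f : Ω → PiLp 2 V} (h : ∀ j, Measurable fun ω => f ω j) : Measurable f :=
  (WithLp.measurable_toLp 2 _).comp (measurable_pi_lambda (fun ω => (f ω).ofLp) h)

theorem measurable_piLp_apply {n : ℕ} {V : Fin n → Type*} [∀ j, NormedAddCommGroup (V j)]
    [∀ j, MeasurableSpace (V j)] {Ω : Type*} [MeasurableSpace Ω]
    {f : Ω → PiLp 2 V} (h : Measurable f) (j : Fin n) : Measurable fun ω => f ω j :=
  (measurable_pi_apply j).comp ((WithLp.measurable_ofLp 2 _).comp h)

variable {p q : ℕ} {H : Fin p → Type*} {G : Fin q → Type*}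
  [∀ j, NormedAddCommGroup (H j)] [∀ j, InnerProductSpace ℝ (H j)] [∀ j, CompleteSpace (H j)]
  [∀ j, SecondCountableTopology (H j)] [∀ j, MeasurableSpace (H j)] [∀ j, BorelSpace (H j)]
  [∀ k, NormedAddCommGroup (G k)] [∀ k, InnerProductSpace ℝ (G k)] [∀ k, CompleteSpace (G k)]
  [∀ k, SecondCountableTopology (G k)] [∀ k, MeasurableSpace (G k)] [∀ k, BorelSpace (G k)]
  {C : (j : Fin p) → H j → H j} {D J : (k : Fin q) → G k → G k}
  {L : (k : Fin q) → (j : Fin p) → H j →L[ℝ] G k}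
  {W : (j : Fin p) → H j →L[ℝ] H j} {U : (k : Fin q) → G k →L[ℝ] G k}

theorem measurable_iterates {Ω : Type*} [MeasurableSpace Ω]
    (hC : ∀ j, Continuous (C j)) (hD : ∀ k, Continuous (D k)) (hJ : ∀ k, Continuous (J k))
    {lam : ℕ → ℝ} {x w c : ℕ → Ω → PiLp 2 H} {v u b d : ℕ → Ω → PiLp 2 G}
    {η : ℕ → Ω → Fin p → ℝ} {σ : ℕ → Ω → Fin p → ℝ} {τ : ℕ → Ω → Fin q → ℝ}
    (hη : ∀ n j, Measurable fun ω => η n ω j) (hσ : ∀ n j, Measurable fun ω => σ n ω j)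
    (hτ : ∀ n k, Measurable fun ω => τ n ω k)
    (hx0 : Measurable (x 0)) (hv0 : Measurable (v 0))
    (hc : ∀ n, Measurable (c n)) (hb : ∀ n, Measurable (b n)) (hd : ∀ n, Measurable (d n))
    (hw : ∀ n ω j, w n ω j = η n ω j • (x n ω j - W j (C j (x n ω j) + c n ω j)))
    (hu : ∀ n ω k, u n ω k = τ n ω k •
        (J k (v n ω k + U k (∑ j ∈ primalIdx L k, L k j (w n ω j -
              W j (∑ k' ∈ dualIdx L j, ContinuousLinearMap.adjoint (L k' j) (v n ω k')))
            - D k (v n ω k) + d n ω k)) + b n ω k))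
    (hv : ∀ n ω k, v (n + 1) ω k = v n ω k + (lam n * τ n ω k) • (u n ω k - v n ω k))
    (hx : ∀ n ω j, x (n + 1) ω j = x n ω j + (lam n * σ n ω j) •
        (w n ω j - W j (∑ k ∈ dualIdx L j, ContinuousLinearMap.adjoint (L k j) (u n ω k))
          - x n ω j)) (n : ℕ) : Measurable (x n) ∧ Measurable (v n) := by
  induction n with
  | zero => exact ⟨hx0, hv0⟩
  | succ n ih =>
    have hxj := measurable_piLp_apply ih.1
    have hvk := measurable_piLp_apply ih.2
    have hcj := measurable_piLp_apply (hc n)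
    have hbk := measurable_piLp_apply (hb n)
    have hdk := measurable_piLp_apply (hd n)
    have hwj : ∀ j, Measurable fun ω => w n ω j := fun j => by
      simp only [hw]
      exact (hη n j).smul ((hxj j).sub ((W j).continuous.measurable.comp
        (((hC j).measurable.comp (hxj j)).add (hcj j))))
    have huk : ∀ k, Measurable fun ω => u n ω k := fun k => by
      simp only [hu]
      refine (hτ n k).smul (((hJ k).measurable.comp ((hvk k).add
        ((U k).continuous.measurable.comp (((Finset.measurable_fun_sum _ fun j _ => ?_).sub
          ((hD k).measurable.comp (hvk k))).add (hdk k))))).add (hbk k))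
      exact (L k j).continuous.measurable.comp ((hwj j).sub ((W j).continuous.measurable.comp
        (Finset.measurable_fun_sum _ fun k' _ =>
          (ContinuousLinearMap.adjoint (L k' j)).continuous.measurable.comp (hvk k'))))
    refine ⟨measurable_piLp fun j => ?_, measurable_piLp fun k => ?_⟩
    · simp only [hx]
      exact (hxj j).add (((hσ n j).const_mul _).smul (((hwj j).sub
        ((W j).continuous.measurable.comp (Finset.measurable_fun_sum _ fun k _ =>
          (ContinuousLinearMap.adjoint (L k j)).continuous.measurable.comp (huk k)))).sub (hxj j)))
    · simp only [hv]
      exact (hvk k).add (((hτ n k).const_mul _).smul ((huk k).sub (hvk k)))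

/-- A random variable in the primal-dual space is measurable if its components are images of
measurable ones by continuous linear maps. -/
theorem measurable_primalDual {Ω : Type*} {m : MeasurableSpace Ω}
    {f : Ω → WithLp 2 (PiLp 2 H × PiLp 2 G)} {x : Ω → PiLp 2 H} {v : Ω → PiLp 2 G}
    {R : (j : Fin p) → H j →L[ℝ] H j} {S : (k : Fin q) → G k →L[ℝ] G k}
    (hx : Measurable x) (hv : Measurable v) (hfx : ∀ ω j, (f ω).fst j = R j (x ω j))
    (hfv : ∀ ω k, (f ω).snd k = S k (v ω k)) : Measurable f := by
  refine measurable_of_measurable_inner fun y => ?_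
  have h : ∀ ω, ⟪f ω, y⟫_ℝ = ∑ j, ⟪R j (x ω j), y.fst j⟫_ℝ
      + ∑ k, ⟪S k (v ω k), y.snd k⟫_ℝ := fun ω => by
    rw [WithLp.prod_inner_apply, PiLp.inner_apply, PiLp.inner_apply]
    simp only [← hfx, ← hfv]
    rfl
  simp only [h]
  refine (Finset.measurable_fun_sum _ fun j _ => ?_).add (Finset.measurable_fun_sum _ fun k _ => ?_)
  · exact (continuous_id.inner continuous_const).measurable.comp
      ((R j).continuous.measurable.comp (measurable_piLp_apply hx j))
  · exact (continuous_id.inner continuous_const).measurable.comp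
      ((S k).continuous.measurable.comp (measurable_piLp_apply hv k))

end Measurability

/-! ### The filtration of the iterates -/

section History

variable {Ω : Type*} {E F : Type*} [MeasurableSpace E] [MeasurableSpace F]

/-- The filtration generated by two sequences of random variables. -/
def historyFiltration [m0 : MeasurableSpace Ω] {x : ℕ → Ω → E} {v : ℕ → Ω → F} (hx : ∀ n, Measurable (x n))
    (hv : ∀ n, Measurable (v n)) : Filtration ℕ m0 where
  seq := history x v
  mono' _ _ hmn := iSup₂_mono' fun i hi => ⟨i, hi.trans hmn, le_rfl⟩
  le' _ := iSup₂_le fun i _ => sup_le (hx i).comap_le (hv i).comap_le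

theorem measurable_history_left (x : ℕ → Ω → E) (v : ℕ → Ω → F) (n : ℕ) :
    Measurable[history x v n] (x n) :=
  measurable_iff_comap_le.2 (le_iSup₂_of_le n le_rfl le_sup_left)

theorem measurable_history_right (x : ℕ → Ω → E) (v : ℕ → Ω → F) (n : ℕ) :
    Measurable[history x v n] (v n) :=
  measurable_iff_comap_le.2 (le_iSup₂_of_le n le_rfl le_sup_right)

end History

end BlockPD

/-! ### Almost sure weak convergence of the algorithm -/

theorem proposition4p8
    {p q : ℕ} (hp : 0 < p) (hq : 0 < q)
    -- the separable real Hilbert spaces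
    {H : Fin p → Type*} {G : Fin q → Type*}
    [∀ j, NormedAddCommGroup (H j)] [∀ j, InnerProductSpace ℝ (H j)] [∀ j, CompleteSpace (H j)]
    [∀ j, TopologicalSpace.SeparableSpace (H j)]
    [∀ j, MeasurableSpace (H j)] [∀ j, BorelSpace (H j)]
    [∀ k, NormedAddCommGroup (G k)] [∀ k, InnerProductSpace ℝ (G k)] [∀ k, CompleteSpace (G k)]
    [∀ k, TopologicalSpace.SeparableSpace (G k)]
    [∀ k, MeasurableSpace (G k)] [∀ k, BorelSpace (G k)]
    -- the underlying probability space
    {Ω : Type*} [MeasurableSpace Ω] (P : Measure Ω) [IsProbabilityMeasure P]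
    -- the operators of the problem
    (A : (j : Fin p) → H j → Set (H j)) (C : (j : Fin p) → H j → H j)
    (B D : (k : Fin q) → G k → Set (G k)) (L : (k : Fin q) → (j : Fin p) → H j →L[ℝ] G k)
    (hA : ∀ j, IsMaximallyMonotone (A j))
    (hC : ∀ j, ∃ β, IsCocoercive β (C j))
    (hB : ∀ k, IsMaximallyMonotone (B k))
    (hD : ∀ k, IsMaximallyMonotone (D k) ∧ ∃ β, IsStronglyMonotone β (D k))
    (hLk : ∀ k, (primalIdx L k).Nonempty) (hLj : ∀ j, (dualIdx L j).Nonempty)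
    (hF : (primalSolutions A C B D L).Nonempty)
    (hA0 : ∀ j x, A j x = {0})
    -- the preconditioners and the step-size condition
    (W : (j : Fin p) → H j →L[ℝ] H j) (U : (k : Fin q) → G k →L[ℝ] G k)
    (μ : Fin p → ℝ) (ν : Fin q → ℝ)
    (hW : ∀ j, IsStronglyPositive (W j)) (hU : ∀ k, IsStronglyPositive (U k))
    (hμ : ∀ j, IsCocoercive (μ j) fun x => opSqrt (W j) (C j (opSqrt (W j) x)))
    (hν : ∀ k, IsCocoercive (ν k) fun v => opSqrt (U k) (asMap (inverse (D k)) (opSqrt (U k) v)))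
    (hstep : 1 / 2 < min (⨅ j, μ j)
      ((⨅ k, ν k) * (1 - ‖opSqrt (blockDiag U) ∘L blockOp L ∘L opSqrt (blockDiag W)‖ ^ 2)))
    -- relaxation parameters
    (lam : ℕ → ℝ) (hlam : ∀ n, lam n ∈ Set.Ioc (0 : ℝ) 1) (hlam_inf : 0 < ⨅ n, lam n)
    -- primal and dual iterates, auxiliary variables, errors, activation variables
    (x w c : ℕ → Ω → PiLp 2 H) (v u b d : ℕ → Ω → PiLp 2 G)
    (ε : ℕ → Ω → BinaryString (Fin p ⊕ Fin q))
    (hx0 : Measurable (x 0)) (hv0 : Measurable (v 0))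
    (hc : ∀ n, Measurable (c n)) (hb : ∀ n, Measurable (b n)) (hd : ∀ n, Measurable (d n))
    (hε : ∀ n, Measurable (ε n)) (hε_id : ∀ n, IdentDistrib (ε n) (ε 0) P P)
    -- the iterations
    (hw : ∀ n ω j, w n ω j =
      bit ((dualIdx L j).sup fun k => (ε n ω).1 (Sum.inr k)) •
        (x n ω j - W j (C j (x n ω j) + c n ω j)))
    (hu : ∀ n ω k, u n ω k =
      bit ((ε n ω).1 (Sum.inr k)) •
        (J (precond (U k) (inverse (B k)))
          (v n ω k + U k (∑ j ∈ primalIdx L k, L k j (w n ω j -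
              W j (∑ k' ∈ dualIdx L j, ContinuousLinearMap.adjoint (L k' j) (v n ω k')))
            - asMap (inverse (D k)) (v n ω k) + d n ω k))
          + b n ω k))
    (hv : ∀ n ω k, v (n + 1) ω k =
      v n ω k + (lam n * bit ((ε n ω).1 (Sum.inr k))) • (u n ω k - v n ω k))
    (hx : ∀ n ω j, x (n + 1) ω j =
      x n ω j + (lam n * bit ((ε n ω).1 (Sum.inl j))) •
        (w n ω j - W j (∑ k ∈ dualIdx L j, ContinuousLinearMap.adjoint (L k j) (u n ω k))
          - x n ω j))
    -- summable errors
    (hb_sum : SummableErrors P (history x v) b)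
    (hc_sum : SummableErrors P (history x v) c)
    (hd_sum : SummableErrors P (history x v) d)
    -- activation conditions
    (hind : ∀ n, Indep (MeasurableSpace.comap (ε n) inferInstance) (history x v n) P)
    (hprob : ∀ j, 0 < P {ω | (ε 0 ω).1 (Sum.inl j) = true})
    (hact : ∀ k n, (⋃ j ∈ primalIdx L k, {ω | (ε n ω).1 (Sum.inl j) = true}) ⊆
      {ω | (ε n ω).1 (Sum.inr k) = true}) :
    ConvergesWeaklyTo P x (primalSolutions A C B D L) ∧
      ConvergesWeaklyTo P v (dualSolutions A C B D L) := by
  have : ∀ j, SecondCountableTopology (H j) := fun j => UniformSpace.secondCountable_of_separable _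
  have : ∀ k, SecondCountableTopology (G k) := fun k => UniformSpace.secondCountable_of_separable _
  have hDs : ∀ k g, inverse (D k) g = {asMap (inverse (D k)) g} := fun k g => by
    obtain ⟨hDk, β, hβ⟩ := hD k
    exact inverse_eq_singleton_asMap hDk hβ g
  have hbit : ∀ (f : BinaryString (Fin p ⊕ Fin q) → Bool) n,
      Measurable fun ω => bit (f (ε n ω)) := fun f n =>
    (Measurable.of_discrete (f := fun a : BinaryString (Fin p ⊕ Fin q) => bit (f a))).comp (hε n)
  have hxv := measurable_iterates (C := C) (D := fun k => asMap (inverse (D k)))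
    (J := fun k => J (precond (U k) (inverse (B k)))) (L := L) (W := W) (U := U)
    (fun j => (hC j).choose_spec.continuous) (fun k => (hU k).continuous_of_conj (hν k))
    (fun k => (hU k).continuous_J_precond (hB k).inverse)
    (η := fun n ω j => bit ((dualIdx L j).sup fun k => (ε n ω).1 (Sum.inr k)))
    (σ := fun n ω j => bit ((ε n ω).1 (Sum.inl j))) (τ := fun n ω k => bit ((ε n ω).1 (Sum.inr k)))
    (fun n j => hbit (fun a => (dualIdx L j).sup fun k => a.1 (Sum.inr k)) n)
    (fun n j => hbit (fun a => a.1 (Sum.inl j)) n) (fun n k => hbit (fun a => a.1 (Sum.inr k)) n)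
    hx0 hv0 hc hb hd hw hu hv hx
  set ℱ := historyFiltration (fun n => (hxv n).1) fun n => (hxv n).2
  -- The iterates in the scaled variables, still adapted to the history of (x, v).
  set z : ℕ → Ω → WithLp 2 (PiLp 2 H × PiLp 2 G) := fun n ω =>
    WithLp.toLp 2 (WithLp.toLp 2 fun j => (hW j).sqrtEquiv.symm (x n ω j),
      WithLp.toLp 2 fun k => (hU k).sqrtEquiv.symm (v n ω k)) with hz
  have hxz : ∀ n ω j, x n ω j = opSqrt (W j) ((z n ω).fst j) := fun n ω j =>
    ((hW j).opSqrt_sqrtEquiv_symm _).symm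
  have hvz : ∀ n ω k, v n ω k = opSqrt (U k) ((z n ω).snd k) := fun n ω k =>
    ((hU k).opSqrt_sqrtEquiv_symm _).symm
  have hzm : ∀ n, Measurable[ℱ n] (z n) := fun n =>
    measurable_primalDual (m := history x v n)
      (R := fun j => ((hW j).sqrtEquiv.symm : H j →L[ℝ] H j))
      (S := fun k => ((hU k).sqrtEquiv.symm : G k →L[ℝ] G k))
      (measurable_history_left x v n) (measurable_history_right x v n)
      (fun _ _ => rfl) fun _ _ => rfl
  set e : ℕ → Ω → WithLp 2 (PiLp 2 H × PiLp 2 G) := fun n ω =>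
    scaledError hB hU hW (ε n ω).1 (w n ω) (u n ω) C D L (z n ω) with he
  have hz_step : ∀ n ω, z (n + 1) ω = z n ω + ∑ i, (lam n * bit ((ε n ω).1 i)) • coordProj i
      (scaledStep hB hU C D L W (z n ω) - z n ω + e n ω) := fun n ω =>
    eq_add_sum_coordProj hB hU hW (ε n ω).1 (hxz n ω) (hxz (n + 1) ω) (hvz n ω) (hvz (n + 1) ω)
      (hx n ω) (hv n ω)
  have hαk : ∀ n ω k, ∀ j ∈ primalIdx L k, (ε n ω).1 (Sum.inl j) = true →
      (ε n ω).1 (Sum.inr k) = true := fun n ω k j hj h => hact k n (Set.mem_biUnion hj h)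
  obtain ⟨M, hM⟩ := exists_norm_scaledError_le (C := C) (D := D) hB hU hW hLj
  have heM : ∀ n ω, ‖e n ω‖ₑ ≤ ENNReal.ofReal M * (‖b n ω‖ₑ + ‖c n ω‖ₑ + ‖d n ω‖ₑ) :=
    fun n ω => by
      have h := hM (ε n ω).1 (z n ω) (x n ω) (w n ω) (c n ω) (v n ω) (u n ω) (b n ω) (d n ω)
        (hxz n ω) (hvz n ω) (hw n ω) (hu n ω) (hαk n ω)
      simp only [← ofReal_norm]
      rw [← ENNReal.ofReal_add (norm_nonneg _) (norm_nonneg _),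
        ← ENNReal.ofReal_add (by positivity) (norm_nonneg _), ← ENNReal.ofReal_mul' (by positivity)]
      exact ENNReal.ofReal_le_ofReal h
  obtain ⟨ζ, hζm, hζ0, hζs, hζ⟩ := exists_summable_error_bound (P := P) (ℱ := ℱ)
    (fun n => (hb n).enorm) (fun n => (hc n).enorm) (fun n => (hd n).enorm) hb_sum hc_sum hd_sum M
  -- Identical distribution makes the activation probabilities independent of n, so one weighted
  -- norm serves all iterations.
  have hprob_n : ∀ n i, P {ω | (ε n ω).1 i = true} = P {ω | (ε 0 ω).1 i = true} := fun n i =>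
    (hε_id n).measure_mem_eq (s := {a | a.1 i = true}) .of_discrete
  -- A dual block inherits positive probability from any primal block j in the nonempty 𝕃_k, whose
  -- activation forces its own.
  have hprob_pos : ∀ i, 0 < P {ω | (ε 0 ω).1 i = true} := by
    rintro (j | k)
    · exact hprob j
    · obtain ⟨j, hj⟩ := hLk k
      exact (hprob j).trans_le (measure_mono fun ω h => hαk 0 ω k j hj h)
  obtain ⟨κ, hκ, hT⟩ := scaledStep_averaged hB hU hW hμ hν hq hstep
  have hfix : ∃ a, scaledStep hB hU C D L W a = a := by
    obtain ⟨x₀, hx₀⟩ := hF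
    obtain ⟨v₀, hv₀⟩ := exists_isKuhnTuckerPair hx₀ hA0 hDs
    obtain ⟨x₁, rfl⟩ := (blockDiag_bijective fun j => (hW j).bijective_opSqrt).2 x₀
    obtain ⟨v₁, rfl⟩ := (blockDiag_bijective fun k => (hU k).bijective_opSqrt).2 v₀
    exact ⟨WithLp.toLp 2 (x₁, v₁), (scaledStep_eq_self_iff hB hU hW _).2 hv₀⟩
  obtain ⟨zhat, hzhat, hzfix, hlim⟩ := exists_weak_limit_of_random_sweep (P := P) (ℱ := ℱ)
    isOrthogonalResolution_coordProj
    (π := fun i => (P {ω | (ε 0 ω).1 i = true}).toReal)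
    (fun i => ENNReal.toReal_pos (hprob_pos i).ne' (measure_ne_top _ _)) hκ hT hfix
    (𝒢 := fun n => MeasurableSpace.comap (ε n) inferInstance) (fun n => (hε n).comap_le) hind
    (ε := fun n ω => (ε n ω).1) (fun n i => ⟨{a | a.1 i = true}, .of_discrete, rfl⟩)
    (fun n i => (hprob_n n i).trans (ENNReal.ofReal_toReal (measure_ne_top _ _)).symm)
    hlam hlam_inf (fun n => ciInf_le ⟨0, Set.forall_mem_range.2 fun n => (hlam n).1.le⟩ n)
    hzm hz_step hζm hζ0 hζs fun n φ hφ => by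
      have h := hζ n (fun ω => ‖e n ω‖ₑ) (heM n) φ hφ
      simp only [← ofReal_norm, ← ENNReal.ofReal_pow (norm_nonneg _)] at h
      exact h
  have hKT := fun ω => (scaledStep_eq_self_iff hB hU hW _).1 (hzfix ω)
  have hs := isSelfAdjoint_blockDiag fun j => (hW j).isSelfAdjoint_opSqrt
  have ht := isSelfAdjoint_blockDiag fun k => (hU k).isSelfAdjoint_opSqrt
  refine ⟨⟨fun ω => blockDiag (fun j => opSqrt (W j)) (zhat ω).fst, ?_,
      fun ω => (hKT ω).mem_primalSolutions hA0 hDs, ?_⟩,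
    ⟨fun ω => blockDiag (fun k => opSqrt (U k)) (zhat ω).snd, ?_,
      fun ω => (hKT ω).mem_dualSolutions hA0 hDs, ?_⟩⟩
  · exact (blockDiag _ ∘L WithLp.fstL 2 ℝ (PiLp 2 H) (PiLp 2 G)).continuous.measurable.comp hzhat
  · filter_upwards [hlim] with ω hω
    refine tendsto_toWeakSpace_of_inner fun y => ?_
    -- Self-adjointness of the square root transfers it to the test vector, so weak convergence of z
    -- gives that of x.
    have h := hω (WithLp.toLp 2 (blockDiag (fun j => opSqrt (W j)) y, 0))
    simp only [WithLp.prod_inner_apply, inner_zero_right, add_zero] at h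
    have hx' : ∀ n, x n ω = blockDiag (fun j => opSqrt (W j)) (z n ω).fst := fun n =>
      PiLp.ext (hxz n ω)
    simp only [hx']
    have hsym : ∀ a, ⟪blockDiag (fun j => opSqrt (W j)) a, y⟫_ℝ
      = ⟪a, blockDiag (fun j => opSqrt (W j)) y⟫_ℝ := fun a => hs.isSymmetric a y
    simp only [hsym]
    exact h
  · exact (blockDiag _ ∘L WithLp.sndL 2 ℝ (PiLp 2 H) (PiLp 2 G)).continuous.measurable.comp hzhat
  · filter_upwards [hlim] with ω hω
    refine tendsto_toWeakSpace_of_inner fun y => ?_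
    have h := hω (WithLp.toLp 2 (0, blockDiag (fun k => opSqrt (U k)) y))
    simp only [WithLp.prod_inner_apply, inner_zero_right, zero_add] at h
    have hv' : ∀ n, v n ω = blockDiag (fun k => opSqrt (U k)) (z n ω).snd := fun n =>
      PiLp.ext (hvz n ω)
    simp only [hv']
    have hsym : ∀ a, ⟪blockDiag (fun k => opSqrt (U k)) a, y⟫_ℝ
      = ⟪a, blockDiag (fun k => opSqrt (U k)) y⟫_ℝ := fun a => ht.isSymmetric a y
    simp only [hsym]
    exact h
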